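/- **Setting.** Let $\mathrm{St}(n,r)=\{X\in\mathbb R^{n\times r}:X^\top X=I_r\}$ with tangent spaces $T_X=\{u: X^\top u+u^\top X=0\}$, orthogonal projections $\mathcal P_{T_X}(Y)=Y-\frac12X(X^\top Y+Y^\top X)$, polar retraction $\mathcal R_X(v)=(X+v)(I_r+v^\top v)^{-1/2}$, and Riemannian gradient $\operatorname{grad}\phi(X)=\mathcal P_{T_X}(\nabla\phi(X))$. Let $\|\cdot\|_F$ be the Frobenius norm and $\|\cdot\|_2$ the spectral norm. Agents $1,\dots,N$ are joined by a connected undirected graph; $W=(w_{ij})$ is symmetric with row sums $1$, $w_{ij}>0$ if $i=j$ or $ij$ is an edge, and $w_{ij}=0$ otherwise. Let $\sigma_2$ be the second largest singular value of $W$ and, for an integer $t\ge1$, let $L_t=1-\lambda_{\min}(W^t)$. Let $f=\frac1N\sum_i f_i$ and $f^*=\min_{\mathrm{St}(n,r)}f$. An induced arithmetic mean of $\mathbf X=(X_1,\dots,X_N)\in\mathrm{St}(n,r)^N$ is a minimizer $\hat X$ of $Y\mapsto\sum_i\|Y-X_i\|_F^2$ over $\mathrm{St}(n,r)$; write $\|\mathbf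 X-\hat{\mathbf X}\|_F^2=\sum_i\|X_i-\hat X\|_F^2$. For constants $\delta_2\le\frac16$, $\delta_1\le\frac{\delta_2}{5\sqrt r}$ let $\mathcal S$ be the set of $\mathbf X\in\mathrm{St}(n,r)^N$ with $\|\mathbf X-\hat{\mathbf X}\|_F^2\le N\delta_1^2$ and $\max_i\|X_i-\hat X\|_F\le\delta_2$. **Assumptions.** Each $f_i:\mathbb R^{n\times r}\to\mathbb R$ is differentiable with $L$-Lipschitz gradient. For $X\in \mathrm{St}(n,r)$ the oracle returns $G_i(X,\xi_i)\in T_X$ with $E[G_i(X,\xi_i)]=\operatorname{grad}f_i(X)$, $E\|G_i(X,\xi_i)-\operatorname{grad}f_i(X)\|_F^2\le\sigma^2$, and, for almost every value of $\xi_i$, $\|G_i(X,\xi_i)\|_F\le A_1$ for all $X\in\mathrm{St}(n,r)$, where $A_1>0$. The samples $\xi_{i,k}^{[j]}$ are distributed as $\xi_i$, are independent in $j$ for each $i,k$, and samples of different iterations $k$ are independent. **Algorithm.** Let $F_i^k(X)=\frac1{N_k}\sum_{j=1}^{N_k}G_i(X,\xi_{i,k}^{[j]})$, $\mathbf X_0\in\mathcal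 S$ deterministic, $Y_{i,0}=F_i^0(X_{i,0})$, and for $k\ge0$ $$v_{i,k}=\mathcal P_{T_{X_{i,k}}}Y_{i,k},\quad X_{i,k+1}=\mathcal R_{X_{i,k}}\Big(\alpha\,\mathcal P_{T_{X_{i,k}}}\Big[\sum_j (W^t)_{ij}X_{j,k}\Big]-\beta v_{i,k}\Big),\quad Y_{i,k+1}=\sum_j (W^t)_{ij}Y_{j,k}+F_i^{k+1}(X_{i,k+1})-F_i^k(X_{i,k}).$$ **Constants.** On $\mathrm{St}(n,r)$ let $\|\nabla f_i\|_F\le A_2$ and $\|\nabla f_i\|_2\le L_n$ for all $i$; put $A=\max\{A_1,A_2\}$, $L_G=L+2L_n$. Let $M$ satisfy $\|\mathcal R_X(v)-(X+v)\|_F\le M\|v\|_F^2$ for all $X\in\mathrm{St}(n,r)$, $v\in T_X$. Let $\Phi\ge1$ be a constant with $\Phi\le2-\max_i\|X_i-\hat X\|_F^2$ for all $\mathbf X\in\mathcal S$. Put $\rho_t=\sqrt{1-(\alpha L_t\Phi-\alpha^2L_t^2)}$ and $$\Gamma_0=\tfrac{2}{(1-\rho_t)^2},\quad\Gamma_1=\tfrac{2}{1-\rho_t^2}\|\mathbf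 X_0-\hat{\mathbf X}_0\|_F^2,\quad\Gamma_2=\tfrac{2}{(1-\sigma_2^t)^2},\quad\Gamma_3=\tfrac{2}{1-\sigma_2^{2t}}\cdot\tfrac1N\sum_iE\Big\|Y_{i,0}-\tfrac1N\sum_jF_j^0(X_{j,0})\Big\|_F^2,$$ $$D_1=(\delta_1^2+5)L_G+2MA,\quad D_4=\tfrac{4r\delta_1^2}{\beta^2L_G},\quad D_2=3L_G+2\alpha A+13L_G\tfrac{\delta_2^2}{r}\alpha^2+D_4,\quad D_3=\tfrac{1+4L_G^2\beta^2}{2L_G},\quad\tilde D_3=D_3+\tfrac{5\beta}8,$$ $$C_0=\tfrac{D_4\Gamma_0\alpha^2\delta_1^2}{25}+\Gamma_1(D_2+D_4),\quad C_1=D_2\Gamma_0+D_4\Gamma_0+D_1,\quad\tilde\Gamma_1=2L_G^2\beta\Gamma_1,\quad\tilde\Gamma_3=C_0+\tfrac\beta2(\Gamma_3+16\alpha^2L_G^2\Gamma_2\Gamma_1),$$ $\kappa=16+\Gamma_0\alpha^2\delta_1^2$ and $\Delta=f(\hat X_0)-f^*+\tilde\Gamma_3$. **Theorem.** Suppose $t\ge\log_{\sigma_2}\frac1{2\sqrt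 N}$ (no condition beyond $t\ge 1$ if $\sigma_2=0$), $0<\alpha\le\min\{1,\frac1M,\frac{\Phi}{L_t}\}$ and $$0<\beta\le\min\Big\{\tfrac{1-\rho_t}{10A+L_G}\delta_1,\ \tfrac{\alpha\delta_1}{5(10A+L_G)},\ \tfrac1{9L_G},\ \tfrac{1}{4[\alpha\delta_1L_G(16\Gamma_0+\Gamma_2)+2C_1]}\Big\}.$$ Then, for every choice of induced arithmetic means $\hat X_k$ of $\mathbf X_k$, all $\|\operatorname{grad}f(\hat X_k)\|_F^2$ are integrable, and $m_K:=\min_{0\le k\le K}E\|\operatorname{grad}f(\hat X_k)\|_F^2$ satisfies for every $K\ge0$: (i) if $N_k=\lceil q^{-k}\rceil$ with $q\in(0,1)$: $$m_K\le\frac{\kappa\Big[\Delta+\frac{\sigma^2(2\beta\Gamma_2(1+q)+\tilde D_3)}{1-q}\Big]+\tilde\Gamma_1}{\beta(K+1)};$$ (ii) if $N_k=\lceil(k+1)^a\rceil$ with $a>0$: $$m_K\le\frac{\tilde\Gamma_1+\kappa\big[\Delta+2\sigma^2(4\beta\Gamma_2+\tilde D_3)(\ln(K+1)+1)\big]}{\beta(K+1)}\quad(a=1),$$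 $$m_K\le\frac{\sigma^2\kappa(6\beta\Gamma_2+\tilde D_3)}{\beta(1-a)(K+1)^a}+\frac{\kappa\Delta+\tilde\Gamma_1}{\beta(K+1)}\quad(a<1),$$ $$m_K\le\frac{\sigma^2\kappa\big(3\Gamma_2a+\Gamma_2+\frac{a\tilde D_3}\beta\big)}{(a-1)(K+1)}+\frac{\kappa\Delta+\tilde\Gamma_1}{\beta(K+1)}\quad(a>1);$$ (iii) if $N_k=Q$ for a constant integer $Q>0$: $$m_K\le\kappa\,\frac{\sigma^2(4\beta\Gamma_2+\tilde D_3)}{\beta Q}+\frac{\tilde\Gamma_1+\kappa\Delta}{\beta(K+1)}.$$ In particular, with all the constants fixed, $m_K=O(1/K)$ in (i) and in (ii) for $a>1$, $m_K=O(\ln K/K)$ in (ii) for $a=1$, $m_K=O(1/K^a)$ in (ii) for $a<1$, and in (iii) $m_K$ is at most $O(1/K)$ plus a term $O(\sigma^2/Q)$. -/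

import Mathlib

open MeasureTheory ProbabilityTheory
open scoped Matrix Matrix.Norms.Frobenius MatrixOrder

namespace StiefelGT

/-! Throughout, `‖A‖` is the Frobenius norm of a real matrix `A`. -/

/-- Borel sigma-algebra on real matrices. -/
instance matrixMeasurableSpace (n r : ℕ) : MeasurableSpace (Matrix (Fin n) (Fin r) ℝ) := borel _

instance matrixBorelSpace (n r : ℕ) : BorelSpace (Matrix (Fin n) (Fin r) ℝ) := ⟨rfl⟩

section Geometry

variable {n r N : ℕ}

/-- The Stiefel manifold `St(n,r)`. -/
def stiefel (n r : ℕ) : Set (Matrix (Fin n) (Fin r) ℝ) := {X | Xᵀ * X = 1}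

/-- The tangent space of the Stiefel manifold at `X`. -/
def tangentSpace (X : Matrix (Fin n) (Fin r) ℝ) : Set (Matrix (Fin n) (Fin r) ℝ) :=
  {u | Xᵀ * u + uᵀ * X = 0}

/-- The orthogonal projection onto the tangent space at a point `X` of the Stiefel manifold
(see `tangentProj_mem` and `trace_sub_tangentProj`). -/
noncomputable def tangentProj (X Y : Matrix (Fin n) (Fin r) ℝ) : Matrix (Fin n) (Fin r) ℝ :=
  Y - (1 / 2 : ℝ) • (X * (Xᵀ * Y + Yᵀ * X))

theorem tangentProj_mem {X : Matrix (Fin n) (Fin r) ℝ} (hX : X ∈ stiefel n r)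
    (Y : Matrix (Fin n) (Fin r) ℝ) : tangentProj X Y ∈ tangentSpace X := by
  have hX' : Xᵀ * X = 1 := hX
  have h1 : Xᵀ * (X * (Xᵀ * Y + Yᵀ * X)) = Xᵀ * Y + Yᵀ * X := by
    rw [← Matrix.mul_assoc, hX', Matrix.one_mul]
  have h2 : (X * (Xᵀ * Y + Yᵀ * X))ᵀ * X = Xᵀ * Y + Yᵀ * X := by
    simp only [Matrix.transpose_mul, Matrix.transpose_add, Matrix.transpose_transpose]
    rw [Matrix.mul_assoc, hX', Matrix.mul_one, add_comm]
  change Xᵀ * (Y - (1 / 2 : ℝ) • (X * (Xᵀ * Y + Yᵀ * X)))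
    + (Y - (1 / 2 : ℝ) • (X * (Xᵀ * Y + Yᵀ * X)))ᵀ * X = 0
  rw [Matrix.mul_sub, Matrix.transpose_sub, Matrix.sub_mul, Matrix.transpose_smul,
    Matrix.mul_smul, Matrix.smul_mul, h1, h2]
  module

theorem trace_sub_tangentProj {X u : Matrix (Fin n) (Fin r) ℝ} (hu : u ∈ tangentSpace X)
    (Y : Matrix (Fin n) (Fin r) ℝ) : (uᵀ * (Y - tangentProj X Y)).trace = 0 := by
  have hu' : Xᵀ * u = -(uᵀ * X) := eq_neg_of_add_eq_zero_left hu
  have e : Y - tangentProj X Y = (1 / 2 : ℝ) • (X * (Xᵀ * Y + Yᵀ * X)) := by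
    simp [tangentProj]
  have key : (uᵀ * X * (Xᵀ * Y + Yᵀ * X)).trace
      = -(uᵀ * X * (Xᵀ * Y + Yᵀ * X)).trace := by
    calc (uᵀ * X * (Xᵀ * Y + Yᵀ * X)).trace
        = ((uᵀ * X * (Xᵀ * Y + Yᵀ * X))ᵀ).trace := (Matrix.trace_transpose _).symm
      _ = ((Xᵀ * Y + Yᵀ * X) * (Xᵀ * u)).trace := by
          simp only [Matrix.transpose_mul, Matrix.transpose_add, Matrix.transpose_transpose]
          rw [add_comm (Yᵀ * X)]
      _ = -(uᵀ * X * (Xᵀ * Y + Yᵀ * X)).trace := by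
          rw [hu', Matrix.mul_neg, Matrix.trace_neg, Matrix.trace_mul_comm]
  rw [e, Matrix.mul_smul, Matrix.trace_smul, ← Matrix.mul_assoc]
  have : (uᵀ * X * (Xᵀ * Y + Yᵀ * X)).trace = 0 := by linarith
  rw [this, smul_zero]

/-- The Euclidean gradient: the matrix of partial derivatives. -/
noncomputable def euclGrad (φ : Matrix (Fin n) (Fin r) ℝ → ℝ) (X : Matrix (Fin n) (Fin r) ℝ) :
    Matrix (Fin n) (Fin r) ℝ :=
  Matrix.of fun i j => fderiv ℝ φ X (Matrix.single i j 1)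

/-- The Riemannian gradient on the Stiefel manifold of a function on the ambient space. -/
noncomputable def riemGrad (φ : Matrix (Fin n) (Fin r) ℝ → ℝ) (X : Matrix (Fin n) (Fin r) ℝ) :
    Matrix (Fin n) (Fin r) ℝ :=
  tangentProj X (euclGrad φ X)

/-- `φ` is `L`-smooth on the Euclidean space of matrices. -/
def LSmooth (L : ℝ) (φ : Matrix (Fin n) (Fin r) ℝ → ℝ) : Prop :=
  Differentiable ℝ φ ∧ ∀ X Y, ‖euclGrad φ X - euclGrad φ Y‖ ≤ L * ‖X - Y‖

/-- The spectral norm (largest singular value) of a matrix. -/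
noncomputable def specNorm {m p : ℕ} (A : Matrix (Fin m) (Fin p) ℝ) : ℝ :=
  ‖(Matrix.toEuclideanLin A).toContinuousLinearMap‖

/-- The polar retraction `(X + v) (I + vᵀ v)^{-1/2}`. -/
noncomputable def polarRetraction (X v : Matrix (Fin n) (Fin r) ℝ) :
    Matrix (Fin n) (Fin r) ℝ :=
  (X + v) * (CFC.sqrt (1 + vᵀ * v))⁻¹

/-- `Zhat` is an induced arithmetic mean of `Z 1, …, Z N`: a minimizer over the Stiefel manifold
of the sum of the squared Frobenius distances to the `Z i`. -/
def IsIAM (Z : Fin N → Matrix (Fin n) (Fin r) ℝ) (Zhat : Matrix (Fin n) (Fin r) ℝ) : Prop :=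
  Zhat ∈ stiefel n r ∧ ∀ V ∈ stiefel n r, ∑ i, ‖Zhat - Z i‖ ^ 2 ≤ ∑ i, ‖V - Z i‖ ^ 2

/-- `Z` lies in the local region `S = S₁ ∩ S₂` with parameters `δ₁`, `δ₂`, where `Zhat` is an
induced arithmetic mean of `Z`. -/
def InRegion (δ₁ δ₂ : ℝ) (Z : Fin N → Matrix (Fin n) (Fin r) ℝ)
    (Zhat : Matrix (Fin n) (Fin r) ℝ) : Prop :=
  (∀ i, Z i ∈ stiefel n r) ∧ IsIAM Z Zhat ∧
    ∑ i, ‖Z i - Zhat‖ ^ 2 ≤ N * δ₁ ^ 2 ∧ ∀ i, ‖Z i - Zhat‖ ≤ δ₂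

end Geometry

section Network

variable {N : ℕ}

/-- The graph is connected, and `W` is a symmetric, nonnegative, doubly stochastic weight matrix
of it: `W i j > 0` exactly for edges and on the diagonal. -/
structure NetworkAssumption (𝒢 : SimpleGraph (Fin N)) (W : Matrix (Fin N) (Fin N) ℝ) : Prop where
  connected : 𝒢.Connected
  pos : ∀ i j, 𝒢.Adj i j ∨ i = j → 0 < W i j
  zero : ∀ i j, ¬ (𝒢.Adj i j ∨ i = j) → W i j = 0
  symm : Wᵀ = W
  row_sum : ∀ i, ∑ j, W i j = 1

/-- The second largest singular value of `W` (Mathlib numbers singular values from `0`,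
in decreasing order). -/
noncomputable def sigmaTwo (W : Matrix (Fin N) (Fin N) ℝ) : ℝ :=
  (Matrix.toEuclideanLin W).singularValues 1

/-- `L_t = 1 - (smallest eigenvalue of W ^ t)`. -/
noncomputable def Lt (W : Matrix (Fin N) (Fin N) ℝ) (t : ℕ) : ℝ :=
  1 - sInf (spectrum ℝ (W ^ t))

end Network

/-- The data of the distributed problem and of the algorithm: weight matrix `W`, number `t` of
communication rounds per iteration, step sizes `α`, `β`, local costs `f i`, stochastic oracles
`G i`, and the initial point `X₀`. -/
structure Data (n r N : ℕ) (Ξ : Fin N → Type*) where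
  W : Matrix (Fin N) (Fin N) ℝ
  t : ℕ
  α : ℝ
  β : ℝ
  f : Fin N → Matrix (Fin n) (Fin r) ℝ → ℝ
  G : (i : Fin N) → Matrix (Fin n) (Fin r) ℝ → Ξ i → Matrix (Fin n) (Fin r) ℝ
  X₀ : Fin N → Matrix (Fin n) (Fin r) ℝ

namespace Data

variable {n r N : ℕ} {Ξ : Fin N → Type*} (D : Data n r N Ξ)

/-- The global cost `f = (1/N) ∑ f_i`. -/
noncomputable def cost (X : Matrix (Fin n) (Fin r) ℝ) : ℝ := (1 / (N : ℝ)) * ∑ i, D.f i X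

/-- The minimum `f^*` of the global cost over the Stiefel manifold. -/
noncomputable def costMin : ℝ := sInf (D.cost '' stiefel n r)

/-- The variable-sample-size gradient estimate `F_i(X)` of agent `i` at iteration `k`: the mean of
`Nk k` oracle outputs, for a realization `s` of the samples (`s i k j` is the `j`-th sample of
agent `i` at iteration `k`). -/
noncomputable def batchGrad (Nk : ℕ → ℕ) (s : (i : Fin N) → ℕ → ℕ → Ξ i) (k : ℕ) (i : Fin N)
    (X : Matrix (Fin n) (Fin r) ℝ) : Matrix (Fin n) (Fin r) ℝ :=
  (1 / (Nk k : ℝ)) • ∑ j ∈ Finset.range (Nk k), D.G i X (s i k j)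

/-- The iterates `(X_k, Y_k)` of the distributed Riemannian stochastic gradient tracking
algorithm, for a realization `s` of the samples. -/
noncomputable def iter (Nk : ℕ → ℕ) (s : (i : Fin N) → ℕ → ℕ → Ξ i) :
    ℕ → (Fin N → Matrix (Fin n) (Fin r) ℝ) × (Fin N → Matrix (Fin n) (Fin r) ℝ)
  | 0 => (D.X₀, fun i => D.batchGrad Nk s 0 i (D.X₀ i))
  | k + 1 =>
    let X := (iter Nk s k).1
    let Y := (iter Nk s k).2
    let v := fun i => tangentProj (X i) (Y i)
    let X' := fun i => polarRetraction (X i)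
      (D.α • tangentProj (X i) (∑ j, (D.W ^ D.t) i j • X j) - D.β • v i)
    (X', fun i => ∑ j, (D.W ^ D.t) i j • Y j
      + D.batchGrad Nk s (k + 1) i (X' i) - D.batchGrad Nk s k i (X i))

/-- The initial gradient tracking error `‖Y_0 - F̄_0‖²`, where `F̄_0` is the average over the
agents of `F_i(X_{i,0})` and `‖·‖` is the norm of the stacked matrix. -/
noncomputable def trackErr₀ (Nk : ℕ → ℕ) (s : (i : Fin N) → ℕ → ℕ → Ξ i) : ℝ :=
  ∑ i, ‖(D.iter Nk s 0).2 i - (1 / (N : ℝ)) • ∑ j, D.batchGrad Nk s 0 j (D.X₀ j)‖ ^ 2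

/-- `‖grad f(X̂_k)‖²` for a realization `s` of the samples, where `iam` selects an induced
arithmetic mean of the current points of the agents. -/
noncomputable def gradSq
    (iam : (Fin N → Matrix (Fin n) (Fin r) ℝ) → Matrix (Fin n) (Fin r) ℝ)
    (Nk : ℕ → ℕ) (s : (i : Fin N) → ℕ → ℕ → Ξ i) (k : ℕ) : ℝ :=
  ‖riemGrad D.cost (iam (D.iter Nk s k).1)‖ ^ 2

end Data

section Oracle

variable {n r N : ℕ} {Ξ : Fin N → Type*} [∀ i, MeasurableSpace (Ξ i)]

/-- The assumptions on the stochastic oracles, `ν i` being the distribution of `ξ_i`. The outputs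
are tangent vectors, bounded in norm by `A₁` on the Stiefel manifold for almost every sample;
they are unbiased with variance at most `σ²`. -/
structure OracleAssumption (D : Data n r N Ξ) (ν : (i : Fin N) → Measure (Ξ i)) (σ A₁ : ℝ) :
    Prop where
  measurable : ∀ i, Measurable fun p : Matrix (Fin n) (Fin r) ℝ × Ξ i => D.G i p.1 p.2
  tangent : ∀ i, ∀ᵐ ξ ∂(ν i), ∀ X ∈ stiefel n r, D.G i X ξ ∈ tangentSpace X
  unbiased : ∀ i, ∀ X ∈ stiefel n r, ∫ ξ, D.G i X ξ ∂(ν i) = riemGrad (D.f i) X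
  variance : ∀ i, ∀ X ∈ stiefel n r, ∫ ξ, ‖D.G i X ξ - riemGrad (D.f i) X‖ ^ 2 ∂(ν i) ≤ σ ^ 2
  pos : 0 < A₁
  bounded : ∀ i, ∀ᵐ ξ ∂(ν i), ∀ X ∈ stiefel n r, ‖D.G i X ξ‖ ≤ A₁

/-- The samples `ξ i k j` (agent `i`, iteration `k`, number `j`) have law `ν i`; for fixed `i`
and `k` they are independent in `j`, and the samples of different iterations are independent
of one another. -/
structure SamplingAssumption {Ω : Type*} [MeasurableSpace Ω] (μ : Measure Ω)
    (ν : (i : Fin N) → Measure (Ξ i)) (ξ : (i : Fin N) → ℕ → ℕ → Ω → Ξ i) : Prop where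
  measurable : ∀ i k j, Measurable (ξ i k j)
  law : ∀ i k j, μ.map (ξ i k j) = ν i
  indep_batch : ∀ i k, iIndepFun (fun j => ξ i k j) μ
  indep_iter : iIndepFun (fun k ω => fun p : Fin N × ℕ => ξ p.1 k p.2 ω) μ

end Oracle

/-- The scalar parameters entering the convergence bounds. `Φ` is the constant in the step-size
condition, `M` the retraction constant, `LG = L + 2 L_n` the Lipschitz constant of the Riemannian
gradients, `A` the gradient bound, `e₀` the initial consensus error `‖X_0 - X̂_0‖²`. -/
structure Params where
  N : ℕ
  r : ℕ
  t : ℕ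
  α : ℝ
  β : ℝ
  δ₁ : ℝ
  δ₂ : ℝ
  Φ : ℝ
  Lt : ℝ
  σ₂ : ℝ
  M : ℝ
  LG : ℝ
  A : ℝ
  e₀ : ℝ

namespace Params

variable (p : Params)

noncomputable def ρ : ℝ := √(1 - (p.α * p.Lt * p.Φ - p.α ^ 2 * p.Lt ^ 2))
noncomputable def Γ₀ : ℝ := 2 / (1 - p.ρ) ^ 2
noncomputable def Γ₁ : ℝ := 2 / (1 - p.ρ ^ 2) * p.e₀
noncomputable def Γ₂ : ℝ := 2 / (1 - p.σ₂ ^ p.t) ^ 2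

/-- `y₀` is the initial expected gradient tracking error, which depends on the sample sizes. -/
noncomputable def Γ₃ (y₀ : ℝ) : ℝ := 2 / (1 - p.σ₂ ^ (2 * p.t)) * (1 / (p.N : ℝ)) * y₀

noncomputable def D₁ : ℝ := (p.δ₁ ^ 2 + 5) * p.LG + 2 * p.M * p.A
noncomputable def D₃ : ℝ := (1 + 4 * p.LG ^ 2 * p.β ^ 2) / (2 * p.LG)
noncomputable def D₄ : ℝ := 4 * p.r * p.δ₁ ^ 2 / (p.β ^ 2 * p.LG)
noncomputable def Ctil : ℝ := p.δ₂ ^ 2 / p.r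
noncomputable def D₂ : ℝ :=
  3 * p.LG + 2 * p.α * p.A + 13 * p.LG * p.Ctil * p.α ^ 2 + p.D₄
noncomputable def C₀ : ℝ := p.D₄ * p.Γ₀ * p.α ^ 2 * p.δ₁ ^ 2 / 25 + p.Γ₁ * (p.D₂ + p.D₄)
noncomputable def C₁ : ℝ := p.D₂ * p.Γ₀ + p.D₄ * p.Γ₀ + p.D₁
noncomputable def Γtil₁ : ℝ := 2 * p.LG ^ 2 * p.β * p.Γ₁
noncomputable def Γtil₃ (y₀ : ℝ) : ℝ :=
  p.C₀ + p.β / 2 * (p.Γ₃ y₀ + 16 * p.α ^ 2 * p.LG ^ 2 * p.Γ₂ * p.Γ₁)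
noncomputable def Dtil₃ : ℝ := p.D₃ + 5 * p.β / 8

/-- The factor `16 + Γ₀ α² δ₁²`. -/
noncomputable def κ : ℝ := 16 + p.Γ₀ * p.α ^ 2 * p.δ₁ ^ 2

/-- The upper bound `β̄` for the step size `β` that keeps the iterates in the local region. -/
noncomputable def βbar : ℝ :=
  min ((1 - p.ρ) / (10 * p.A + p.LG) * p.δ₁) (p.α * p.δ₁ / (5 * (10 * p.A + p.LG)))

/-- The conditions on the step sizes `α` and `β`. -/
structure StepSize : Prop where
  α_pos : 0 < p.α
  α_le : p.α ≤ min 1 (min (1 / p.M) (p.Φ / p.Lt))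
  β_pos : 0 < p.β
  β_le : p.β ≤ min p.βbar (min (1 / (9 * p.LG))
    (1 / (4 * (p.α * p.δ₁ * p.LG * (16 * p.Γ₀ + p.Γ₂) + 2 * p.C₁))))

end Params

section Bound

variable {n r N : ℕ} {Ξ : Fin N → Type*} {Ω : Type*} [MeasurableSpace Ω]

/-- The scalar parameters attached to the data and to the constants `δ₁, δ₂, Φ, M, L, L_n, A₁, A₂`;
`iam` selects induced arithmetic means. -/
noncomputable def Data.params (D : Data n r N Ξ)
    (iam : (Fin N → Matrix (Fin n) (Fin r) ℝ) → Matrix (Fin n) (Fin r) ℝ)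
    (δ₁ δ₂ Φ M L Ln A₁ A₂ : ℝ) : Params where
  N := N
  r := r
  t := D.t
  α := D.α
  β := D.β
  δ₁ := δ₁
  δ₂ := δ₂
  Φ := Φ
  Lt := StiefelGT.Lt D.W D.t
  σ₂ := sigmaTwo D.W
  M := M
  LG := L + 2 * Ln
  A := max A₁ A₂
  e₀ := ∑ i, ‖D.X₀ i - iam D.X₀‖ ^ 2

/-- `f(X̂_0) - f^* + Γ̃₃` for the sample sizes `Nk`. -/
noncomputable def Data.gap (D : Data n r N Ξ)
    (iam : (Fin N → Matrix (Fin n) (Fin r) ℝ) → Matrix (Fin n) (Fin r) ℝ)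
    (μ : Measure Ω) (ξ : (i : Fin N) → ℕ → ℕ → Ω → Ξ i) (p : Params) (Nk : ℕ → ℕ) : ℝ :=
  D.cost (iam D.X₀) - D.costMin + p.Γtil₃ (∫ ω, D.trackErr₀ Nk (fun i k j => ξ i k j ω) ∂μ)

/-- With sample sizes `Nk`, the squared gradient norms at the means `X̂_k` are integrable, and
for every `K` one has `min_{k = 0, …, K} E ‖grad f(X̂_k)‖² ≤ B K`. -/
def Data.MinGradBound (D : Data n r N Ξ)
    (iam : (Fin N → Matrix (Fin n) (Fin r) ℝ) → Matrix (Fin n) (Fin r) ℝ)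
    (μ : Measure Ω) (ξ : (i : Fin N) → ℕ → ℕ → Ω → Ξ i) (Nk : ℕ → ℕ) (B : ℕ → ℝ) : Prop :=
  (∀ k, Integrable (fun ω => D.gradSq iam Nk (fun i k j => ξ i k j ω) k) μ) ∧
  ∀ K : ℕ, (Finset.range (K + 1)).inf' Finset.nonempty_range_add_one
    (fun k => ∫ ω, D.gradSq iam Nk (fun i k j => ξ i k j ω) k ∂μ) ≤ B K

end Bound

end StiefelGT

/-! The proof is a Lyapunov argument along each realization of the samples, followed by one
expectation. Let `e` be the root mean square distance of the agents to their induced mean X̂, `τ`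
the spread of the trackers Y, and `n` the root mean square error of the gradient estimates. The
potential f(X̂) + 3 L_G α e² + (3/10) β τ² loses at least (β/16)‖grad f(X̂)‖² in iteration k, up to
10 β n_k² + (18/5) β n_{k+1}² (`Setting.potential_succ_le`).

Three facts carry this decrease. First, W^t contracts vectors of mean zero by s = σ₂^t ≤ 1/(2√N),
and s² ≤ 1/8 because the step-size conditions exclude N = 1. As the polar retraction does not
increase distances to the manifold (`norm_polarRetraction_sub_le`), the consensus error contracts by
1 - 3α/10 up to a term of order β. Second, the average of the trackers equals the average of the
gradient estimates, which is grad f(X̂) up to L_G e + n. Third, the chord identity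
`inner_sub_stiefel_mul_symm` makes every effect of curvature quadratic: it gives the Riemannian
descent inequality, and it shows that X̂ is a Lipschitz function of the Euclidean average.
Criticality of X̂ moreover makes its distance to that average of second order. Hence X̂ moves along
minus β times the averaged search direction, up to a small error.

Almost surely the trackers stay bounded by 6A, so an induction keeps all iterates in the region e ≤
δ₁, max ≤ 1/6, where these estimates hold (`Setting.region`). The elaborate constants act only
through domination. The condition on β involving C₁ yields 88 L_G β ≤ 1, 24 L_G β ≤ α² and 64 δ₁² ≤
L_G β α², which is what the absorption of error terms requires; the other constants majorize the
initial potential and the noise coefficient (`Admissible.potential_le`).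

For the expectation, X_k depends on earlier samples only and is independent of the batch of
iteration k, so E n_k² ≤ σ²/N_k. Summing over k and bounding the minimum by the average leaves ∑
1/N_k, the one quantity that distinguishes the sampling policies. -/

namespace StiefelGT

/-! ### Frobenius inner product and chords of the Stiefel manifold -/

section Frobenius

variable {n r m : ℕ}

theorem frobenius_norm_sq (A : Matrix (Fin n) (Fin r) ℝ) : ‖A‖ ^ 2 = ∑ i, ∑ j, A i j ^ 2 := by
  rw [Matrix.frobenius_norm_def, ← Real.sqrt_eq_rpow, Real.sq_sqrt]
  · simp
  · positivity

theorem trace_transpose_mul (A B : Matrix (Fin n) (Fin r) ℝ) :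
    (Aᵀ * B).trace = ∑ i, ∑ j, A i j * B i j := by
  simp only [Matrix.trace, Matrix.diag, Matrix.mul_apply, Matrix.transpose_apply]
  exact Finset.sum_comm

/-- The trace inner product, which induces the Frobenius norm. -/
noncomputable instance frobeniusInner : InnerProductSpace ℝ (Matrix (Fin n) (Fin r) ℝ) where
  inner A B := (Aᵀ * B).trace
  norm_sq_eq_re_inner A := by
    rw [frobenius_norm_sq, trace_transpose_mul]
    simp [sq]
  conj_inner_symm A B := by
    simp only [trace_transpose_mul, mul_comm, conj_trivial]
  add_left A B C := by
    simp [Matrix.add_mul]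
  smul_left A B c := by
    simp

theorem inner_eq_trace (A B : Matrix (Fin n) (Fin r) ℝ) : inner ℝ A B = (Aᵀ * B).trace := rfl

theorem inner_transpose (A B : Matrix (Fin n) (Fin r) ℝ) : inner ℝ Aᵀ Bᵀ = inner ℝ A B := by
  rw [real_inner_comm, inner_eq_trace, inner_eq_trace, Matrix.transpose_transpose,
    Matrix.trace_mul_comm]

theorem inner_mul_left_eq (C : Matrix (Fin m) (Fin n) ℝ) (A : Matrix (Fin n) (Fin r) ℝ)
    (B : Matrix (Fin m) (Fin r) ℝ) : inner ℝ (C * A) B = inner ℝ A (Cᵀ * B) := by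
  rw [inner_eq_trace, inner_eq_trace, Matrix.transpose_mul, Matrix.mul_assoc]

theorem inner_mul_right_eq (A : Matrix (Fin n) (Fin m) ℝ) (C : Matrix (Fin m) (Fin r) ℝ)
    (B : Matrix (Fin n) (Fin r) ℝ) : inner ℝ (A * C) B = inner ℝ A (B * Cᵀ) := by
  rw [inner_eq_trace, inner_eq_trace, Matrix.transpose_mul, Matrix.trace_mul_comm,
    ← Matrix.mul_assoc, Matrix.trace_mul_comm, ← Matrix.mul_assoc]

theorem norm_stiefel_mul {X : Matrix (Fin n) (Fin r) ℝ} (hX : X ∈ stiefel n r)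
    (B : Matrix (Fin r) (Fin m) ℝ) : ‖X * B‖ = ‖B‖ := by
  have hX' : Xᵀ * X = 1 := hX
  rw [← sq_eq_sq₀ (norm_nonneg _) (norm_nonneg _), ← real_inner_self_eq_norm_sq,
    ← real_inner_self_eq_norm_sq, inner_mul_left_eq, ← Matrix.mul_assoc, hX', Matrix.one_mul]

theorem norm_transpose_stiefel_mul_le {X : Matrix (Fin n) (Fin r) ℝ} (hX : X ∈ stiefel n r)
    (B : Matrix (Fin n) (Fin m) ℝ) : ‖Xᵀ * B‖ ≤ ‖B‖ := by
  have h1 : ‖Xᵀ * B‖ ^ 2 = inner ℝ (X * (Xᵀ * B)) B := by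
    rw [← real_inner_self_eq_norm_sq, inner_mul_left_eq, Matrix.transpose_transpose,
      real_inner_comm, inner_mul_left_eq]
  have h2 := real_inner_le_norm (X * (Xᵀ * B)) B
  rw [norm_stiefel_mul hX] at h2
  nlinarith [norm_nonneg (Xᵀ * B), norm_nonneg B]

theorem norm_sq_stiefel {X : Matrix (Fin n) (Fin r) ℝ} (hX : X ∈ stiefel n r) :
    ‖X‖ ^ 2 = r := by
  have hX' : Xᵀ * X = 1 := hX
  rw [← real_inner_self_eq_norm_sq, inner_eq_trace, hX']
  simp

/-- The gram matrix of the difference of two points of the Stiefel manifold. -/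
theorem gram_sub {X Z : Matrix (Fin n) (Fin r) ℝ} (hX : X ∈ stiefel n r) (hZ : Z ∈ stiefel n r) :
    Xᵀ * Z + Zᵀ * X = (2 : ℝ) • (1 : Matrix (Fin r) (Fin r) ℝ) - (X - Z)ᵀ * (X - Z) := by
  have hX' : Xᵀ * X = 1 := hX
  have hZ' : Zᵀ * Z = 1 := hZ
  simp only [Matrix.transpose_sub, Matrix.sub_mul, Matrix.mul_sub, hX', hZ']
  module

/-- A vector `X * H` with `H` symmetric is normal at `X`, and the manifold leaves its tangent space
only to second order, so a chord pairs quadratically with it. Algebraically, the symmetric part of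
`1 - Xᵀ * Z` is half the Gram matrix of `X - Z`. -/
theorem inner_sub_stiefel_mul_symm {X Z : Matrix (Fin n) (Fin r) ℝ} (hX : X ∈ stiefel n r)
    (hZ : Z ∈ stiefel n r) {H : Matrix (Fin r) (Fin r) ℝ} (hH : Hᵀ = H) :
    inner ℝ (X - Z) (X * H) = 1 / 2 * inner ℝ (X - Z) ((X - Z) * H) := by
  have hX' : Xᵀ * X = 1 := hX
  have h1 : inner ℝ (X - Z) (X * H) = inner ℝ (1 - Xᵀ * Z) H := by
    rw [real_inner_comm, inner_mul_left_eq, Matrix.mul_sub, hX', real_inner_comm]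
  have h2 : inner ℝ (X - Z) ((X - Z) * H) = inner ℝ ((X - Z)ᵀ * (X - Z)) H := by
    rw [inner_mul_left_eq, Matrix.transpose_transpose]
  have h3 : inner ℝ (1 - Xᵀ * Z) H = inner ℝ (1 - Zᵀ * X) H := by
    rw [← inner_transpose, hH]
    simp
  have h4 := gram_sub hX hZ
  have h5 : (X - Z)ᵀ * (X - Z) = (1 - Xᵀ * Z) + (1 - Zᵀ * X) := by
    have : (X - Z)ᵀ * (X - Z) = (2 : ℝ) • (1 : Matrix (Fin r) (Fin r) ℝ) - (Xᵀ * Z + Zᵀ * X) := by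
      rw [h4]; abel
    rw [this]; module
  rw [h1, h2, h5, inner_add_left, ← h3]
  ring

end Frobenius

/-! ### Tangent projections and the spectral norm -/

section Tangent

variable {n r : ℕ}

theorem tangentProj_add (X Y Z : Matrix (Fin n) (Fin r) ℝ) :
    tangentProj X (Y + Z) = tangentProj X Y + tangentProj X Z := by
  simp only [tangentProj, Matrix.mul_add, Matrix.transpose_add, Matrix.add_mul]
  module

theorem tangentProj_smul (X : Matrix (Fin n) (Fin r) ℝ) (c : ℝ) (Y : Matrix (Fin n) (Fin r) ℝ) :
    tangentProj X (c • Y) = c • tangentProj X Y := by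
  simp only [tangentProj, Matrix.mul_add, Matrix.transpose_smul, Matrix.smul_mul, Matrix.mul_smul]
  module

/-- The projection onto the tangent space as a linear map. -/
noncomputable def tangentProjLin (X : Matrix (Fin n) (Fin r) ℝ) :
    Matrix (Fin n) (Fin r) ℝ →ₗ[ℝ] Matrix (Fin n) (Fin r) ℝ where
  toFun := tangentProj X
  map_add' := tangentProj_add X
  map_smul' := tangentProj_smul X

theorem tangentProj_sub (X Y Z : Matrix (Fin n) (Fin r) ℝ) :
    tangentProj X (Y - Z) = tangentProj X Y - tangentProj X Z :=
  (tangentProjLin X).map_sub Y Z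

theorem tangentProj_sum {ι : Type*} (X : Matrix (Fin n) (Fin r) ℝ) (s : Finset ι)
    (Y : ι → Matrix (Fin n) (Fin r) ℝ) :
    tangentProj X (∑ i ∈ s, Y i) = ∑ i ∈ s, tangentProj X (Y i) :=
  map_sum (tangentProjLin X) Y s

theorem inner_tangent_sub_tangentProj {X u : Matrix (Fin n) (Fin r) ℝ} (hu : u ∈ tangentSpace X)
    (Y : Matrix (Fin n) (Fin r) ℝ) : inner ℝ u (Y - tangentProj X Y) = 0 :=
  trace_sub_tangentProj hu Y

theorem norm_tangentProj_le {X : Matrix (Fin n) (Fin r) ℝ} (hX : X ∈ stiefel n r)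
    (Y : Matrix (Fin n) (Fin r) ℝ) : ‖tangentProj X Y‖ ≤ ‖Y‖ := by
  have h := inner_tangent_sub_tangentProj (tangentProj_mem hX Y) Y
  rw [inner_sub_right, real_inner_self_eq_norm_sq] at h
  have h2 := real_inner_le_norm (tangentProj X Y) Y
  nlinarith [norm_nonneg (tangentProj X Y), norm_nonneg Y]

theorem tangentProj_of_mem {X u : Matrix (Fin n) (Fin r) ℝ} (hu : u ∈ tangentSpace X) :
    tangentProj X u = u := by
  have h : Xᵀ * u + uᵀ * X = 0 := hu
  simp [tangentProj, h]

theorem tangentProj_self {X : Matrix (Fin n) (Fin r) ℝ} (hX : X ∈ stiefel n r) :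
    tangentProj X X = 0 := by
  have h : Xᵀ * X = 1 := hX
  simp only [tangentProj, h, Matrix.mul_add, Matrix.mul_one]
  module

theorem tangentSpace_add {X u v : Matrix (Fin n) (Fin r) ℝ} (hu : u ∈ tangentSpace X)
    (hv : v ∈ tangentSpace X) : u + v ∈ tangentSpace X := by
  have h : Xᵀ * u + uᵀ * X = 0 := hu
  have h' : Xᵀ * v + vᵀ * X = 0 := hv
  change Xᵀ * (u + v) + (u + v)ᵀ * X = 0
  rw [Matrix.mul_add, Matrix.transpose_add, Matrix.add_mul, add_add_add_comm, h, h', add_zero]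

theorem tangentSpace_smul {X u : Matrix (Fin n) (Fin r) ℝ} (c : ℝ) (hu : u ∈ tangentSpace X) :
    c • u ∈ tangentSpace X := by
  have h : Xᵀ * u + uᵀ * X = 0 := hu
  change Xᵀ * (c • u) + (c • u)ᵀ * X = 0
  rw [Matrix.mul_smul, Matrix.transpose_smul, Matrix.smul_mul, ← smul_add, h, smul_zero]

theorem specNorm_nonneg (A : Matrix (Fin n) (Fin r) ℝ) : 0 ≤ specNorm A := norm_nonneg _

theorem specNorm_transpose (A : Matrix (Fin n) (Fin r) ℝ) : specNorm Aᵀ = specNorm A :=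
  Matrix.l2_opNorm_conjTranspose A

theorem norm_mul_le_specNorm_mul {m : ℕ} (A : Matrix (Fin n) (Fin r) ℝ)
    (B : Matrix (Fin r) (Fin m) ℝ) : ‖A * B‖ ≤ specNorm A * ‖B‖ := by
  -- Each column of `A * B` is `A` applied to a column of `B`, and squared Frobenius norms add over
  -- columns.
  have key (c : Fin m) : ∑ i, (A * B) i c ^ 2 ≤ specNorm A ^ 2 * ∑ i, B i c ^ 2 := by
    have h := Matrix.l2_opNorm_mulVec A (WithLp.toLp 2 (fun i => B i c))
    have h' : ‖WithLp.toLp 2 (A *ᵥ fun i => B i c)‖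
      ≤ specNorm A * ‖WithLp.toLp 2 (fun i => B i c)‖ := h
    have h2 := pow_le_pow_left₀ (norm_nonneg _) h' 2
    rw [mul_pow, EuclideanSpace.norm_sq_eq, EuclideanSpace.norm_sq_eq] at h2
    simpa [Matrix.mul_apply, Matrix.mulVec, dotProduct] using h2
  refine le_of_sq_le_sq ?_ (mul_nonneg (specNorm_nonneg _) (norm_nonneg _))
  rw [mul_pow, frobenius_norm_sq, frobenius_norm_sq, Finset.sum_comm,
    Finset.sum_comm (f := fun i j => B i j ^ 2), Finset.mul_sum]
  exact Finset.sum_le_sum fun c _ => key c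

theorem norm_mul_le_mul_specNorm {m : ℕ} (A : Matrix (Fin n) (Fin r) ℝ)
    (B : Matrix (Fin r) (Fin m) ℝ) : ‖A * B‖ ≤ ‖A‖ * specNorm B := by
  have h := norm_mul_le_specNorm_mul Bᵀ Aᵀ
  rwa [← Matrix.transpose_mul, Matrix.frobenius_norm_transpose, Matrix.frobenius_norm_transpose,
    specNorm_transpose, mul_comm] at h

theorem specNorm_le_norm (A : Matrix (Fin n) (Fin r) ℝ) : specNorm A ≤ ‖A‖ := by
  refine ContinuousLinearMap.opNorm_le_bound _ (norm_nonneg _) fun x => ?_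
  refine (sq_le_sq₀ (norm_nonneg ((Matrix.toEuclideanLin A) x))
    (mul_nonneg (norm_nonneg A) (norm_nonneg x))).1 ?_
  rw [mul_pow, frobenius_norm_sq, EuclideanSpace.norm_sq_eq, EuclideanSpace.norm_sq_eq,
    Finset.sum_mul]
  apply Finset.sum_le_sum
  intro i _
  simp only [Real.norm_eq_abs, sq_abs]
  have h := Finset.sum_mul_sq_le_sq_mul_sq Finset.univ (A i) (fun j => x j)
  exact h

/-- Telescoping the two occurrences of the base point leaves four products, each with one factor `X
- Z`, one factor `G`, and otherwise only points of the manifold. Measuring `G` in the spectral norm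
is what produces the Lipschitz constant `L + 2 * Ln`. -/
theorem norm_tangentProj_sub_tangentProj_le_spec {X Z : Matrix (Fin n) (Fin r) ℝ}
    (hX : X ∈ stiefel n r) (hZ : Z ∈ stiefel n r) (G : Matrix (Fin n) (Fin r) ℝ) :
    ‖tangentProj X G - tangentProj Z G‖ ≤ 2 * specNorm G * ‖X - Z‖ := by
  have e : tangentProj X G - tangentProj Z G = -((1 / 2 : ℝ) •
      ((X - Z) * (Xᵀ * G) + Z * ((X - Z)ᵀ * G) + (X - Z) * (Gᵀ * X) + Z * (Gᵀ * (X - Z)))) := by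
    simp only [tangentProj, Matrix.transpose_sub, Matrix.sub_mul, Matrix.mul_sub, Matrix.mul_add]
    module
  have h1 : ‖(X - Z) * (Xᵀ * G)‖ ≤ ‖X - Z‖ * specNorm G := by
    rw [← Matrix.mul_assoc]
    refine (norm_mul_le_mul_specNorm _ _).trans ?_
    gcongr
    · exact specNorm_nonneg _
    · rw [← Matrix.frobenius_norm_transpose, Matrix.transpose_mul, Matrix.transpose_transpose,
        norm_stiefel_mul hX, Matrix.frobenius_norm_transpose]
  have h2 : ‖Z * ((X - Z)ᵀ * G)‖ ≤ ‖X - Z‖ * specNorm G := by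
    rw [norm_stiefel_mul hZ, ← Matrix.frobenius_norm_transpose (X - Z)]
    exact norm_mul_le_mul_specNorm _ _
  have h3 : ‖(X - Z) * (Gᵀ * X)‖ ≤ ‖X - Z‖ * specNorm G := by
    rw [← Matrix.frobenius_norm_transpose, Matrix.transpose_mul, Matrix.transpose_mul,
      Matrix.transpose_transpose, Matrix.mul_assoc]
    refine (norm_transpose_stiefel_mul_le hX _).trans ?_
    rw [mul_comm, ← Matrix.frobenius_norm_transpose (X - Z)]
    exact norm_mul_le_specNorm_mul _ _
  have h4 : ‖Z * (Gᵀ * (X - Z))‖ ≤ ‖X - Z‖ * specNorm G := by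
    rw [norm_stiefel_mul hZ, mul_comm, ← specNorm_transpose]
    exact norm_mul_le_specNorm_mul _ _
  rw [e, norm_neg, norm_smul, Real.norm_of_nonneg (by norm_num)]
  have := norm_add₄_le (a := (X - Z) * (Xᵀ * G)) (b := Z * ((X - Z)ᵀ * G))
    (c := (X - Z) * (Gᵀ * X)) (d := Z * (Gᵀ * (X - Z)))
  linarith

theorem norm_tangentProj_sub_tangentProj_le {X Z : Matrix (Fin n) (Fin r) ℝ}
    (hX : X ∈ stiefel n r) (hZ : Z ∈ stiefel n r) (G : Matrix (Fin n) (Fin r) ℝ) :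
    ‖tangentProj X G - tangentProj Z G‖ ≤ 2 * ‖X - Z‖ * ‖G‖ := by
  have h := norm_tangentProj_sub_tangentProj_le_spec hX hZ G
  have := mul_le_mul_of_nonneg_right (specNorm_le_norm G) (norm_nonneg (X - Z))
  linarith

end Tangent

/-! ### The polar retraction: distances and continuity -/

section Polar

variable {n r : ℕ}

theorem one_add_gram_posSemidef (v : Matrix (Fin n) (Fin r) ℝ) : (1 + vᵀ * v).PosSemidef :=
  Matrix.PosSemidef.one.add (Matrix.posSemidef_conjTranspose_mul_self v)

/-- The positive square root of `I + vᵀ v`. -/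
noncomputable def sqrtGram (v : Matrix (Fin n) (Fin r) ℝ) : Matrix (Fin r) (Fin r) ℝ :=
  CFC.sqrt (1 + vᵀ * v)

theorem sqrtGram_posSemidef (v : Matrix (Fin n) (Fin r) ℝ) : (sqrtGram v).PosSemidef :=
  Matrix.nonneg_iff_posSemidef.1 (CFC.sqrt_nonneg (1 + vᵀ * v))

theorem sqrtGram_transpose (v : Matrix (Fin n) (Fin r) ℝ) : (sqrtGram v)ᵀ = sqrtGram v :=
  (sqrtGram_posSemidef v).1

theorem sqrtGram_mul_self (v : Matrix (Fin n) (Fin r) ℝ) :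
    sqrtGram v * sqrtGram v = 1 + vᵀ * v :=
  CFC.sqrt_mul_sqrt_self _ (one_add_gram_posSemidef v).nonneg

/-- For an eigenvalue `μ` of `sqrtGram v - 1`, both `μ + 1` and the eigenvalue `(μ + 1) ^ 2 - 1` of
`vᵀ * v` are nonnegative, which forces `μ ≥ 0`. -/
theorem sqrtGram_sub_one_posSemidef (v : Matrix (Fin n) (Fin r) ℝ) :
    (sqrtGram v - 1).PosSemidef := by
  have hh : (sqrtGram v - 1).IsHermitian :=
    (sqrtGram_posSemidef v).1.sub Matrix.isHermitian_one
  refine hh.posSemidef_iff_eigenvalues_nonneg.2 fun i => ?_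
  set μ := hh.eigenvalues i with hμ
  set b : Fin r → ℝ := (hh.eigenvectorBasis i).ofLp with hb
  have hbn : b ⬝ᵥ b = 1 := by
    have h1 := hh.eigenvectorBasis.orthonormal.1 i
    have h2 : ‖hh.eigenvectorBasis i‖ ^ 2 = 1 := by rw [h1]; norm_num
    rw [EuclideanSpace.norm_sq_eq] at h2
    simpa [dotProduct, sq, hb] using h2
  have h1 : (sqrtGram v - 1) *ᵥ b = μ • b := hh.mulVec_eigenvectorBasis i
  have h2 : sqrtGram v *ᵥ b = (μ + 1) • b := by
    rw [Matrix.sub_mulVec, Matrix.one_mulVec] at h1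
    rw [add_smul, one_smul, ← h1]; simp
  have h3 : (1 + vᵀ * v) *ᵥ b = (μ + 1) ^ 2 • b := by
    rw [← sqrtGram_mul_self, ← Matrix.mulVec_mulVec, h2, Matrix.mulVec_smul, h2, smul_smul, sq]
  have h4 : 0 ≤ b ⬝ᵥ (sqrtGram v *ᵥ b) := by
    simpa using (sqrtGram_posSemidef v).dotProduct_mulVec_nonneg b
  have h5 : 0 ≤ b ⬝ᵥ ((vᵀ * v) *ᵥ b) := by
    simpa using (Matrix.posSemidef_conjTranspose_mul_self v).dotProduct_mulVec_nonneg b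
  have h6 : (vᵀ * v) *ᵥ b = ((μ + 1) ^ 2 - 1) • b := by
    rw [Matrix.add_mulVec, Matrix.one_mulVec] at h3
    rw [sub_smul, one_smul, ← h3]; simp
  rw [h2, dotProduct_smul, hbn] at h4
  rw [h6, dotProduct_smul, hbn] at h5
  simp only [smul_eq_mul, mul_one] at h4 h5
  simp only [Pi.zero_apply]
  nlinarith

theorem inner_mul_posSemidef_nonneg {m : ℕ} (B : Matrix (Fin m) (Fin r) ℝ)
    {T : Matrix (Fin r) (Fin r) ℝ} (hT : T.PosSemidef) : 0 ≤ inner ℝ B (B * T) := by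
  have h := (hT.mul_mul_conjTranspose_same B).trace_nonneg
  have e : inner ℝ B (B * T) = (B * T * Bᴴ).trace := by
    rw [inner_eq_trace, Matrix.trace_mul_comm]; rfl
  rwa [e]

theorem sqrtGram_isUnit (v : Matrix (Fin n) (Fin r) ℝ) : IsUnit (sqrtGram v).det := by
  have h1 : (1 + vᵀ * v).PosDef :=
    Matrix.PosDef.one.add_posSemidef (Matrix.posSemidef_conjTranspose_mul_self v)
  have h2 : (sqrtGram v).det * (sqrtGram v).det ≠ 0 := by
    rw [← Matrix.det_mul, sqrtGram_mul_self]; exact h1.det_pos.ne'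
  exact (left_ne_zero_of_mul h2).isUnit

theorem polarRetraction_mul_sqrtGram (X v : Matrix (Fin n) (Fin r) ℝ) :
    polarRetraction X v * sqrtGram v = X + v := by
  rw [polarRetraction, ← sqrtGram, Matrix.mul_assoc, Matrix.nonsing_inv_mul _ (sqrtGram_isUnit v),
    Matrix.mul_one]

theorem gram_add_tangent {X v : Matrix (Fin n) (Fin r) ℝ} (hX : X ∈ stiefel n r)
    (hv : v ∈ tangentSpace X) : (X + v)ᵀ * (X + v) = 1 + vᵀ * v := by
  have hX' : Xᵀ * X = 1 := hX
  have hv' : Xᵀ * v + vᵀ * X = 0 := hv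
  rw [Matrix.transpose_add, Matrix.add_mul, Matrix.mul_add, Matrix.mul_add, hX']
  calc 1 + Xᵀ * v + (vᵀ * X + vᵀ * v) = 1 + vᵀ * v + (Xᵀ * v + vᵀ * X) := by abel
    _ = _ := by rw [hv', add_zero]

theorem polarRetraction_mem {X v : Matrix (Fin n) (Fin r) ℝ} (hX : X ∈ stiefel n r)
    (hv : v ∈ tangentSpace X) : polarRetraction X v ∈ stiefel n r := by
  change (polarRetraction X v)ᵀ * polarRetraction X v = 1
  have e : polarRetraction X v = (X + v) * (sqrtGram v)⁻¹ := rfl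
  rw [e, Matrix.transpose_mul, Matrix.transpose_nonsing_inv, sqrtGram_transpose,
    Matrix.mul_assoc, ← Matrix.mul_assoc (X + v)ᵀ, gram_add_tangent hX hv, ← sqrtGram_mul_self,
    Matrix.mul_assoc, Matrix.mul_nonsing_inv _ (sqrtGram_isUnit v), Matrix.mul_one,
    Matrix.nonsing_inv_mul _ (sqrtGram_isUnit v)]

/-- The polar retraction does not increase the distance to points of the Stiefel manifold. -/
theorem norm_polarRetraction_sub_le {X v Z : Matrix (Fin n) (Fin r) ℝ} (hX : X ∈ stiefel n r)
    (hv : v ∈ tangentSpace X) (hZ : Z ∈ stiefel n r) :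
    ‖polarRetraction X v - Z‖ ≤ ‖X + v - Z‖ := by
  set R := polarRetraction X v with hR
  have hRm : R ∈ stiefel n r := polarRetraction_mem hX hv
  have hT := sqrtGram_sub_one_posSemidef v
  set T := sqrtGram v - 1 with hTdef
  -- Polar factorization `X + v = R * (1 + T)` with `T` positive semidefinite. The vector `R * T` is
  -- normal at `R`, so the chord identity shows that the cross term below is nonnegative.
  have e : X + v - Z = (R - Z) + R * T := by
    rw [hTdef, Matrix.mul_sub, Matrix.mul_one, hR, polarRetraction_mul_sqrtGram]
    abel
  have h1 : 0 ≤ inner ℝ (R - Z) (R * T) := by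
    have hTt : Tᵀ = T := hT.1
    rw [inner_sub_stiefel_mul_symm hRm hZ hTt]
    have := inner_mul_posSemidef_nonneg (R - Z) hT
    linarith
  have h2 : ‖X + v - Z‖ ^ 2 = ‖R - Z‖ ^ 2 + 2 * inner ℝ (R - Z) (R * T) + ‖R * T‖ ^ 2 := by
    rw [e, norm_add_sq_real]
  nlinarith [norm_nonneg (R - Z), norm_nonneg (X + v - Z), sq_nonneg ‖R * T‖]

/-- With `E = S - T` one has `S² - T² = E S + T E`; pairing with `E` gives at least `‖E‖ ^ 2`, since
`S ≥ 1` and `T ≥ 0`. The bound serves the continuity of the retraction, hence the measurability of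
the iterates. -/
theorem norm_sqrtGram_sub_le (u v : Matrix (Fin n) (Fin r) ℝ) :
    ‖sqrtGram u - sqrtGram v‖ ≤ ‖uᵀ * u - vᵀ * v‖ := by
  set S := sqrtGram u
  set T := sqrtGram v
  set E := S - T with hE
  have e : uᵀ * u - vᵀ * v = E * S + T * E := by
    have h1 : S * S = 1 + uᵀ * u := sqrtGram_mul_self u
    have h2 : T * T = 1 + vᵀ * v := sqrtGram_mul_self v
    rw [hE, Matrix.sub_mul, Matrix.mul_sub, h1, h2]
    abel
  have hS := inner_mul_posSemidef_nonneg E (sqrtGram_sub_one_posSemidef u)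
  have hT := inner_mul_posSemidef_nonneg Eᵀ (sqrtGram_posSemidef v)
  have hT' : inner ℝ Eᵀ (Eᵀ * T) = inner ℝ E (T * E) := by
    rw [← inner_transpose E, Matrix.transpose_mul, sqrtGram_transpose]
  have h1 : inner ℝ E (E * S) = inner ℝ E (E * (S - 1)) + ‖E‖ ^ 2 := by
    rw [← real_inner_self_eq_norm_sq, ← inner_add_right, Matrix.mul_sub, Matrix.mul_one,
      sub_add_cancel]
  have h2 : ‖E‖ ^ 2 ≤ inner ℝ E (uᵀ * u - vᵀ * v) := by
    rw [e, inner_add_right, h1, ← hT']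
    linarith
  have h3 := real_inner_le_norm E (uᵀ * u - vᵀ * v)
  by_contra! hc
  have : 0 < ‖E‖ := (norm_nonneg _).trans_lt hc
  nlinarith

theorem continuous_sqrtGram :
    Continuous (sqrtGram : Matrix (Fin n) (Fin r) ℝ → Matrix (Fin r) (Fin r) ℝ) := by
  rw [continuous_iff_continuousAt]
  intro v
  have h : Filter.Tendsto (fun u : Matrix (Fin n) (Fin r) ℝ => ‖uᵀ * u - vᵀ * v‖) (nhds v)
      (nhds 0) := by
    have hc : Continuous fun u : Matrix (Fin n) (Fin r) ℝ => ‖uᵀ * u - vᵀ * v‖ :=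
      (((continuous_id.matrix_transpose).matrix_mul continuous_id).sub continuous_const).norm
    simpa using hc.tendsto v
  exact tendsto_iff_norm_sub_tendsto_zero.2
    (squeeze_zero (fun _ => norm_nonneg _) (fun u => norm_sqrtGram_sub_le u v) h)

theorem continuous_sqrtGram_inv :
    Continuous fun v : Matrix (Fin n) (Fin r) ℝ => (sqrtGram v)⁻¹ := by
  have h : (fun v : Matrix (Fin n) (Fin r) ℝ => (sqrtGram v)⁻¹)
      = fun v => ((sqrtGram v).det)⁻¹ • (sqrtGram v).adjugate := by
    funext v
    rw [Matrix.inv_def, Ring.inverse_eq_inv']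
  rw [h]
  exact (continuous_sqrtGram.matrix_det.inv₀ fun v => (sqrtGram_isUnit v).ne_zero).smul
    continuous_sqrtGram.matrix_adjugate

theorem continuous_polarRetraction :
    Continuous fun p : Matrix (Fin n) (Fin r) ℝ × Matrix (Fin n) (Fin r) ℝ =>
      polarRetraction p.1 p.2 :=
  (continuous_fst.add continuous_snd).matrix_mul (continuous_sqrtGram_inv.comp continuous_snd)

theorem continuous_tangentProj :
    Continuous fun p : Matrix (Fin n) (Fin r) ℝ × Matrix (Fin n) (Fin r) ℝ =>
      tangentProj p.1 p.2 := by
  unfold tangentProj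
  refine continuous_snd.sub ((continuous_const_smul (1 / 2 : ℝ)).comp ?_)
  exact continuous_fst.matrix_mul
    ((continuous_fst.matrix_transpose.matrix_mul continuous_snd).add
      (continuous_snd.matrix_transpose.matrix_mul continuous_fst))

end Polar

set_option linter.unusedSectionVars false

/-! ### Averages and root mean squares over the agents -/

section RootMeanSquare

variable {N : ℕ} {E : Type*} [NormedAddCommGroup E] [InnerProductSpace ℝ E]

/-- The average of a finite family of vectors. -/
noncomputable def mean (x : Fin N → E) : E := (1 / (N : ℝ)) • ∑ i, x i

/-- The root mean square of the norms of a finite family of vectors. -/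
noncomputable def rms (x : Fin N → E) : ℝ := √(1 / (N : ℝ) * ∑ i, ‖x i‖ ^ 2)

theorem rms_nonneg (x : Fin N → E) : 0 ≤ rms x := Real.sqrt_nonneg _

theorem rms_sq (x : Fin N → E) : rms x ^ 2 = 1 / (N : ℝ) * ∑ i, ‖x i‖ ^ 2 :=
  Real.sq_sqrt (by positivity)

theorem rms_eq_norm (x : Fin N → E) : rms x = √(1 / (N : ℝ)) * ‖WithLp.toLp 2 x‖ := by
  rw [rms, Real.sqrt_mul (by positivity), PiLp.norm_eq_of_L2]

theorem rms_add_le (x y : Fin N → E) : rms (fun i => x i + y i) ≤ rms x + rms y := by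
  have h : WithLp.toLp 2 (fun i => x i + y i) = WithLp.toLp 2 x + WithLp.toLp 2 y := rfl
  rw [rms_eq_norm, rms_eq_norm, rms_eq_norm, h, ← mul_add]
  exact mul_le_mul_of_nonneg_left (norm_add_le _ _) (Real.sqrt_nonneg _)

theorem rms_mono {F : Type*} [NormedAddCommGroup F] [InnerProductSpace ℝ F] {x : Fin N → E}
    {y : Fin N → F} (h : ∀ i, ‖x i‖ ≤ ‖y i‖) : rms x ≤ rms y := by
  apply Real.sqrt_le_sqrt
  gcongr with i
  exact h i

theorem rms_smul (c : ℝ) (x : Fin N → E) : rms (fun i => c • x i) = |c| * rms x := by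
  have h : WithLp.toLp 2 (fun i => c • x i) = c • WithLp.toLp 2 x := rfl
  rw [rms_eq_norm, rms_eq_norm, h, norm_smul, Real.norm_eq_abs]
  ring

theorem rms_neg (x : Fin N → E) : rms (fun i => -x i) = rms x := by
  simp [rms]

theorem rms_sub_le (x y : Fin N → E) : rms (fun i => x i - y i) ≤ rms x + rms y := by
  have h := rms_add_le x (fun i => -y i)
  rw [rms_neg] at h
  simpa only [sub_eq_add_neg] using h

theorem rms_norm (x : Fin N → E) : rms (fun i => ‖x i‖) = rms x := by
  simp [rms]

theorem rms_const (hN : 0 < N) (a : E) : rms (fun _ : Fin N => a) = ‖a‖ := by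
  have : (N : ℝ) ≠ 0 := by positivity
  rw [rms, Finset.sum_const, Finset.card_univ, Fintype.card_fin, nsmul_eq_mul, ← mul_assoc,
    one_div_mul_cancel this, one_mul, Real.sqrt_sq (norm_nonneg _)]

theorem rms_le_of_forall_le (hN : 0 < N) {x : Fin N → E} {c : ℝ} (hc : 0 ≤ c)
    (h : ∀ i, ‖x i‖ ≤ c) : rms x ≤ c := by
  have h1 : rms x ≤ rms (fun _ : Fin N => c) :=
    rms_mono fun i => by rw [Real.norm_of_nonneg hc]; exact h i
  rwa [rms_const hN, Real.norm_of_nonneg hc] at h1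

theorem mean_add (x y : Fin N → E) : mean (fun i => x i + y i) = mean x + mean y := by
  simp [mean, Finset.sum_add_distrib, smul_add]

theorem mean_sub (x y : Fin N → E) : mean (fun i => x i - y i) = mean x - mean y := by
  simp [mean, Finset.sum_sub_distrib, smul_sub]

theorem mean_smul (c : ℝ) (x : Fin N → E) : mean (fun i => c • x i) = c • mean x := by
  simp only [mean, ← Finset.smul_sum]
  rw [smul_comm]

theorem mean_const (hN : 0 < N) (a : E) : mean (fun _ : Fin N => a) = a := by
  have : (N : ℝ) ≠ 0 := by positivity
  simp [mean, ← Nat.cast_smul_eq_nsmul ℝ, smul_smul, this]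

theorem norm_mean_le_mean_norm (x : Fin N → E) : ‖mean x‖ ≤ mean (fun i => ‖x i‖) := by
  rw [mean, norm_smul, mean, smul_eq_mul, Real.norm_of_nonneg (by positivity)]
  gcongr
  exact norm_sum_le _ _

theorem mean_le_mean {a b : Fin N → ℝ} (h : ∀ i, a i ≤ b i) : mean a ≤ mean b := by
  simp only [mean, smul_eq_mul]
  gcongr with i
  exact h i

theorem rms_sq_eq_mean (x : Fin N → E) : rms x ^ 2 = mean (fun i => ‖x i‖ ^ 2) := rms_sq x

/-- Variance decomposition: deviations from the mean are orthogonal to constant families. -/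
theorem rms_sq_eq (hN : 0 < N) (x : Fin N → E) :
    rms x ^ 2 = ‖mean x‖ ^ 2 + rms (fun i => x i - mean x) ^ 2 := by
  have hN' : (N : ℝ) ≠ 0 := by positivity
  have h1 : ∑ i, x i = (N : ℝ) • mean x := by
    rw [mean, smul_smul, mul_one_div_cancel hN', one_smul]
  have h2 : ∑ i, ‖x i - mean x‖ ^ 2 = ∑ i, ‖x i‖ ^ 2 - N * ‖mean x‖ ^ 2 := by
    simp only [norm_sub_sq_real, Finset.sum_add_distrib, Finset.sum_sub_distrib]
    rw [← Finset.mul_sum, ← sum_inner, h1, real_inner_smul_left, real_inner_self_eq_norm_sq]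
    simp
    ring
  rw [rms_sq, rms_sq, h2]
  field_simp
  ring

theorem norm_mean_le (hN : 0 < N) (x : Fin N → E) : ‖mean x‖ ≤ rms x := by
  have h := rms_sq_eq hN x
  nlinarith [norm_nonneg (mean x), rms_nonneg x, sq_nonneg (rms fun i => x i - mean x)]

theorem rms_sub_mean_le (hN : 0 < N) (x : Fin N → E) : rms (fun i => x i - mean x) ≤ rms x := by
  have h := rms_sq_eq hN x
  nlinarith [rms_nonneg (fun i => x i - mean x), rms_nonneg x, sq_nonneg ‖mean x‖]

theorem mean_sub_mean (hN : 0 < N) (x : Fin N → E) : mean (fun i => x i - mean x) = 0 := by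
  rw [mean_sub, mean_const hN, sub_self]

/-- The factor `√N` is the one that the requirement `σ₂ ^ t ≤ 1 / (2 * √N)` cancels. -/
theorem norm_le_sqrt_mul_rms (hN : 0 < N) (x : Fin N → E) (i : Fin N) :
    ‖x i‖ ≤ √N * rms x := by
  have h : ‖x i‖ ^ 2 ≤ ∑ i, ‖x i‖ ^ 2 :=
    Finset.single_le_sum (f := fun i => ‖x i‖ ^ 2) (fun _ _ => by positivity) (Finset.mem_univ i)
  have hN' : (N : ℝ) ≠ 0 := by positivity
  refine (sq_le_sq₀ (norm_nonneg _) (mul_nonneg (Real.sqrt_nonneg _) (rms_nonneg _))).1 ?_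
  rw [mul_pow, Real.sq_sqrt (by positivity), rms_sq, ← mul_assoc, mul_one_div_cancel hN', one_mul]
  exact h

end RootMeanSquare

/-! ### Averaging with a symmetric stochastic matrix -/

section Mixing

variable {N : ℕ} {E : Type*} [NormedAddCommGroup E] [InnerProductSpace ℝ E]

/-- `P` is a symmetric stochastic matrix which contracts the vectors of mean zero by `s`. -/
structure IsMixing (P : Matrix (Fin N) (Fin N) ℝ) (s : ℝ) : Prop where
  nonneg : ∀ i j, 0 ≤ P i j
  symm : ∀ i j, P i j = P j i
  row_sum : ∀ i, ∑ j, P i j = 1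
  factor_nonneg : 0 ≤ s
  contract : ∀ z : Fin N → ℝ, ∑ i, z i = 0 → ∑ i, (∑ j, P i j * z j) ^ 2 ≤ s ^ 2 * ∑ i, z i ^ 2

/-- The average of the vectors of a family with the weights in the rows of `P`. -/
def mix (P : Matrix (Fin N) (Fin N) ℝ) (x : Fin N → E) (i : Fin N) : E := ∑ j, P i j • x j

theorem mix_add (P : Matrix (Fin N) (Fin N) ℝ) (x y : Fin N → E) (i : Fin N) :
    mix P (fun j => x j + y j) i = mix P x i + mix P y i := by
  simp [mix, Finset.sum_add_distrib]

theorem mix_sub (P : Matrix (Fin N) (Fin N) ℝ) (x y : Fin N → E) (i : Fin N) :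
    mix P (fun j => x j - y j) i = mix P x i - mix P y i := by
  simp [mix, Finset.sum_sub_distrib, smul_sub]

variable {P : Matrix (Fin N) (Fin N) ℝ} {s : ℝ}

theorem IsMixing.mix_const (hP : IsMixing P s) (a : E) (i : Fin N) : mix P (fun _ => a) i = a := by
  rw [mix, ← Finset.sum_smul, hP.row_sum, one_smul]

theorem IsMixing.col_sum (hP : IsMixing P s) (j : Fin N) : ∑ i, P i j = 1 := by
  rw [← hP.row_sum j]
  exact Finset.sum_congr rfl fun i _ => hP.symm i j

theorem IsMixing.mean_mix (hP : IsMixing P s) (x : Fin N → E) : mean (mix P x) = mean x := by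
  simp only [mean, mix]
  rw [Finset.sum_comm]
  simp [← Finset.sum_smul, hP.col_sum]

theorem IsMixing.norm_mix_le (hP : IsMixing P s) (x : Fin N → E) (i : Fin N) :
    ‖mix P x i‖ ≤ mix P (fun j => ‖x j‖) i := by
  refine (norm_sum_le _ _).trans (Finset.sum_le_sum fun j _ => ?_)
  rw [norm_smul, Real.norm_of_nonneg (hP.nonneg i j), smul_eq_mul]

theorem IsMixing.mix_mono (hP : IsMixing P s) {a b : Fin N → ℝ} (h : ∀ i, a i ≤ b i)
    (i : Fin N) : mix P a i ≤ mix P b i :=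
  Finset.sum_le_sum fun j _ => mul_le_mul_of_nonneg_left (h j) (hP.nonneg i j)

/-- Jensen's inequality for the weights in row `i`, obtained from the nonnegativity of the weighted
variance. -/
theorem IsMixing.mix_sq_le (hP : IsMixing P s) (a : Fin N → ℝ) (i : Fin N) :
    mix P a i ^ 2 ≤ mix P (fun j => a j ^ 2) i := by
  have h : 0 ≤ ∑ j, P i j * (a j - mix P a i) ^ 2 :=
    Finset.sum_nonneg fun j _ => mul_nonneg (hP.nonneg i j) (sq_nonneg _)
  have e : ∑ j, P i j * (a j - mix P a i) ^ 2
      = mix P (fun j => a j ^ 2) i - 2 * mix P a i * mix P a i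
        + mix P a i ^ 2 * ∑ j, P i j := by
    conv_rhs => rw [mix, mul_assoc]; arg 1; arg 2; rw [← mul_assoc]; arg 2; rw [mix]
    rw [Finset.mul_sum, Finset.mul_sum, ← Finset.sum_sub_distrib, ← Finset.sum_add_distrib]
    refine Finset.sum_congr rfl fun j _ => ?_
    simp only [smul_eq_mul]
    ring
  rw [e, hP.row_sum] at h
  nlinarith

theorem IsMixing.rms_mix_le (hP : IsMixing P s) (x : Fin N → E) : rms (mix P x) ≤ rms x := by
  refine (sq_le_sq₀ (rms_nonneg _) (rms_nonneg _)).1 ?_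
  have h : mean (fun i => ‖mix P x i‖ ^ 2) ≤ mean (mix P fun j => ‖x j‖ ^ 2) :=
    mean_le_mean fun i => (pow_le_pow_left₀ (norm_nonneg _) (hP.norm_mix_le x i) 2).trans
      (hP.mix_sq_le _ i)
  rwa [hP.mean_mix, ← rms_sq_eq_mean, ← rms_sq_eq_mean] at h

end Mixing

/-! ### Contraction of matrix-valued families -/

section MatrixMixing

variable {N n r : ℕ} {P : Matrix (Fin N) (Fin N) ℝ} {s : ℝ}

/-- The squared Frobenius norm is a sum over entries, so the scalar contraction applies to each
entry separately. -/
theorem IsMixing.rms_mix_le_of_mean_zero (hP : IsMixing P s)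
    {x : Fin N → Matrix (Fin n) (Fin r) ℝ} (hx : mean x = 0) : rms (mix P x) ≤ s * rms x := by
  rcases Nat.eq_zero_or_pos N with rfl | hN
  · simp [rms]
  have hN' : (1 / (N : ℝ)) ≠ 0 := by positivity
  have hx' : ∑ i, x i = 0 := by simpa [mean, hN.ne'] using hx
  refine (sq_le_sq₀ (rms_nonneg _) (mul_nonneg hP.factor_nonneg (rms_nonneg _))).1 ?_
  rw [mul_pow, rms_sq, rms_sq, mul_left_comm]
  refine mul_le_mul_of_nonneg_left ?_ (by positivity)
  simp only [frobenius_norm_sq]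
  rw [Finset.sum_comm, Finset.sum_comm (γ := Fin N), Finset.mul_sum]
  refine Finset.sum_le_sum fun a _ => ?_
  rw [Finset.sum_comm, Finset.sum_comm (γ := Fin N), Finset.mul_sum]
  refine Finset.sum_le_sum fun b _ => ?_
  have h := hP.contract (fun i => x i a b) (by
    have := congrFun (congrFun hx' a) b
    simpa [Matrix.sum_apply] using this)
  simpa [mix, Matrix.sum_apply] using h

theorem IsMixing.rms_mix_le_add (hP : IsMixing P s) (hN : 0 < N)
    (x : Fin N → Matrix (Fin n) (Fin r) ℝ) : rms (mix P x) ≤ ‖mean x‖ + s * rms x := by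
  have h1 : rms (mix P fun i => x i - mean x) ≤ s * rms (fun i => x i - mean x) :=
    hP.rms_mix_le_of_mean_zero (mean_sub_mean hN x)
  have e : mix P x = fun i => mean x + mix P (fun i => x i - mean x) i := by
    funext i
    rw [mix_sub, hP.mix_const]
    abel
  have h2 := rms_add_le (fun _ => mean x) (mix P fun i => x i - mean x)
  rw [← e, rms_const hN] at h2
  have h3 := mul_le_mul_of_nonneg_left (rms_sub_mean_le hN x) hP.factor_nonneg
  linarith

/-- A bound for each single agent: `s * √N ≤ 1 / 2` pays for the passage from the root mean square
to one member of the family. -/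
theorem IsMixing.norm_mix_le_add (hP : IsMixing P s) (hN : 0 < N) (hs : s ≤ 1 / (2 * √N))
    (x : Fin N → Matrix (Fin n) (Fin r) ℝ) (i : Fin N) :
    ‖mix P x i‖ ≤ ‖mean x‖ + 1 / 2 * rms x := by
  have h1 : rms (mix P fun i => x i - mean x) ≤ s * rms (fun i => x i - mean x) :=
    hP.rms_mix_le_of_mean_zero (mean_sub_mean hN x)
  have e : mix P x i = mean x + mix P (fun i => x i - mean x) i := by
    rw [mix_sub, hP.mix_const]
    abel
  have h2 := norm_le_sqrt_mul_rms hN (mix P fun i => x i - mean x) i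
  have hsN : 0 < √(N : ℝ) := Real.sqrt_pos.2 (by positivity)
  have h3 : √N * s ≤ 1 / 2 := by
    calc √N * s ≤ √N * (1 / (2 * √N)) := by gcongr
      _ = 1 / 2 := by field_simp
  have h4 := rms_sub_mean_le hN x
  have h5 : √N * rms (mix P fun i => x i - mean x) ≤ 1 / 2 * rms x := by
    calc √N * rms (mix P fun i => x i - mean x) ≤ √N * (s * rms x) := by
          gcongr; exact h1.trans (mul_le_mul_of_nonneg_left h4 hP.factor_nonneg)
      _ = √N * s * rms x := by ring
      _ ≤ _ := mul_le_mul_of_nonneg_right h3 (rms_nonneg _)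
  rw [e]
  exact (norm_add_le _ _).trans (by linarith)

end MatrixMixing

/-! ### Descent inequality and Lipschitz Riemannian gradients -/

section Smooth

variable {n r : ℕ}

theorem fderiv_eq_inner_euclGrad (φ : Matrix (Fin n) (Fin r) ℝ → ℝ)
    (X V : Matrix (Fin n) (Fin r) ℝ) : fderiv ℝ φ X V = inner ℝ (euclGrad φ X) V := by
  conv_lhs => rw [Matrix.matrix_eq_sum_single V]
  rw [inner_eq_trace, trace_transpose_mul, map_sum]
  refine Finset.sum_congr rfl fun a _ => ?_
  rw [map_sum]
  refine Finset.sum_congr rfl fun b _ => ?_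
  have h : Matrix.single a b (V a b) = V a b • Matrix.single a b (1 : ℝ) := by
    rw [Matrix.smul_single, smul_eq_mul, mul_one]
  rw [h, map_smul, smul_eq_mul, mul_comm]
  rfl

theorem LSmooth.le_quadratic {L : ℝ} {φ : Matrix (Fin n) (Fin r) ℝ → ℝ} (h : LSmooth L φ)
    (X Y : Matrix (Fin n) (Fin r) ℝ) :
    φ Y ≤ φ X + inner ℝ (euclGrad φ X) (Y - X) + L / 2 * ‖Y - X‖ ^ 2 := by
  set V := Y - X with hV
  -- The defect in the quadratic bound along the segment from `X` to `Y`; the Lipschitz gradient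
  -- makes its derivative nonpositive on [0, 1].
  set ψ : ℝ → ℝ := fun t => φ (X + t • V) - t * inner ℝ (euclGrad φ X) V - L / 2 * t ^ 2 * ‖V‖ ^ 2
    with hψ
  have hd (t : ℝ) : HasDerivAt ψ (inner ℝ (euclGrad φ (X + t • V)) V - inner ℝ (euclGrad φ X) V
      - L * t * ‖V‖ ^ 2) t := by
    have h1 : HasDerivAt (fun t : ℝ => X + t • V) V t := by
      have h0 : HasDerivAt (fun t : ℝ => t • V) V t := by
        have := (hasDerivAt_id t).smul_const V
        rw [one_smul] at this
        exact this
      exact h0.const_add X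
    have h2 : HasDerivAt (fun t : ℝ => φ (X + t • V)) (inner ℝ (euclGrad φ (X + t • V)) V) t :=
      fderiv_eq_inner_euclGrad φ (X + t • V) V ▸
        (h.1 (X + t • V)).hasFDerivAt.comp_hasDerivAt t h1
    have h3 : HasDerivAt (fun t : ℝ => t * inner ℝ (euclGrad φ X) V)
        (inner ℝ (euclGrad φ X) V) t := by
      simpa using (hasDerivAt_id t).mul_const (inner ℝ (euclGrad φ X) V)
    have h4 : HasDerivAt (fun t : ℝ => L / 2 * t ^ 2 * ‖V‖ ^ 2) (L * t * ‖V‖ ^ 2) t := by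
      have := ((hasDerivAt_pow 2 t).const_mul (L / 2)).mul_const (‖V‖ ^ 2)
      refine this.congr_deriv ?_
      push_cast
      ring
    exact (h2.sub h3).sub h4
  have hanti : AntitoneOn ψ (Set.Icc 0 1) := by
    refine antitoneOn_of_deriv_nonpos (convex_Icc 0 1)
      (fun t _ => (hd t).continuousAt.continuousWithinAt)
      (fun t _ => (hd t).differentiableAt.differentiableWithinAt) fun t ht => ?_
    rw [interior_Icc] at ht
    rw [(hd t).deriv, ← inner_sub_left]
    have h1 := real_inner_le_norm (euclGrad φ (X + t • V) - euclGrad φ X) V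
    have h2 := h.2 (X + t • V) X
    rw [add_sub_cancel_left, norm_smul, Real.norm_of_nonneg ht.1.le] at h2
    nlinarith [norm_nonneg V, mul_le_mul_of_nonneg_right h2 (norm_nonneg V)]
  have h01 := hanti (Set.left_mem_Icc.2 zero_le_one) (Set.right_mem_Icc.2 zero_le_one) zero_le_one
  simp only [hψ, one_smul, zero_smul, add_zero] at h01
  have hY : X + V = Y := by rw [hV]; abel
  rw [hY] at h01
  nlinarith

theorem LSmooth.continuous_euclGrad {L : ℝ} {φ : Matrix (Fin n) (Fin r) ℝ → ℝ}
    (h : LSmooth L φ) : Continuous (euclGrad φ) := by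
  refine LipschitzWith.continuous (K := L.toNNReal) (LipschitzWith.of_dist_le_mul fun X Y => ?_)
  rw [dist_eq_norm, dist_eq_norm]
  refine (h.2 X Y).trans ?_
  gcongr
  exact Real.le_coe_toNNReal L

theorem LSmooth.continuous_riemGrad {L : ℝ} {φ : Matrix (Fin n) (Fin r) ℝ → ℝ}
    (h : LSmooth L φ) : Continuous (riemGrad φ) :=
  continuous_tangentProj.comp (continuous_id.prodMk h.continuous_euclGrad)

/-- The normal component of the Euclidean gradient contributes a second order term. -/
theorem inner_euclGrad_sub_le {X Y G : Matrix (Fin n) (Fin r) ℝ} (hX : X ∈ stiefel n r)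
    (hY : Y ∈ stiefel n r) {K : ℝ} (hG : specNorm G ≤ K) :
    inner ℝ G (Y - X) ≤ inner ℝ (tangentProj X G) (Y - X) + K / 2 * ‖Y - X‖ ^ 2 := by
  set S := Xᵀ * G + Gᵀ * X with hS
  have hSt : Sᵀ = S := by
    rw [hS, Matrix.transpose_add, Matrix.transpose_mul, Matrix.transpose_mul,
      Matrix.transpose_transpose, Matrix.transpose_transpose, add_comm]
  -- The normal part of `G` is `X` times a symmetric matrix, so its pairing with the chord is
  -- quadratic.
  have e : G = tangentProj X G + (1 / 2 : ℝ) • (X * S) := by simp [tangentProj, hS]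
  have h1 : inner ℝ (X * S) (Y - X) = - (1 / 2 * inner ℝ (X - Y) ((X - Y) * S)) := by
    rw [← inner_sub_stiefel_mul_symm hX hY hSt, real_inner_comm, ← neg_sub X Y, inner_neg_left]
  have h2 : inner ℝ (X - Y) ((X - Y) * S) = 2 * inner ℝ (X - Y) ((X - Y) * (Xᵀ * G)) := by
    have : inner ℝ (X - Y) ((X - Y) * (Gᵀ * X)) = inner ℝ (X - Y) ((X - Y) * (Xᵀ * G)) := by
      rw [real_inner_comm, inner_mul_right_eq, Matrix.transpose_mul, Matrix.transpose_transpose]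
    rw [hS, Matrix.mul_add, inner_add_right, this]
    ring
  have h3 : ‖(X - Y) * (Xᵀ * G)‖ ≤ ‖X - Y‖ * K := by
    rw [← Matrix.mul_assoc]
    refine (norm_mul_le_mul_specNorm _ _).trans ?_
    have h : ‖(X - Y) * Xᵀ‖ = ‖X - Y‖ := by
      rw [← Matrix.frobenius_norm_transpose, Matrix.transpose_mul, Matrix.transpose_transpose,
        norm_stiefel_mul hX, Matrix.frobenius_norm_transpose]
    rw [h]
    gcongr
  have h4 := (abs_le.1 (abs_real_inner_le_norm (X - Y) ((X - Y) * (Xᵀ * G)))).1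
  have h5 := mul_le_mul_of_nonneg_left h3 (norm_nonneg (X - Y))
  have h6 : inner ℝ G (Y - X) = inner ℝ (tangentProj X G) (Y - X)
      + 1 / 2 * inner ℝ (X * S) (Y - X) := by
    conv_lhs => rw [e, inner_add_left, real_inner_smul_left]
  rw [h6, h1, h2, norm_sub_rev Y X]
  nlinarith

/-- The descent inequality on the Stiefel manifold. -/
theorem LSmooth.le_quadratic_riemGrad {L K : ℝ} {φ : Matrix (Fin n) (Fin r) ℝ → ℝ}
    (h : LSmooth L φ) {X Y : Matrix (Fin n) (Fin r) ℝ} (hX : X ∈ stiefel n r)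
    (hY : Y ∈ stiefel n r) (hK : specNorm (euclGrad φ X) ≤ K) :
    φ Y ≤ φ X + inner ℝ (riemGrad φ X) (Y - X) + (L + K) / 2 * ‖Y - X‖ ^ 2 := by
  have h1 := h.le_quadratic X Y
  have h2 := inner_euclGrad_sub_le hX hY hK
  rw [← riemGrad] at h2
  linarith

theorem LSmooth.norm_riemGrad_sub_le {L K : ℝ} {φ : Matrix (Fin n) (Fin r) ℝ → ℝ}
    (h : LSmooth L φ) {X Y : Matrix (Fin n) (Fin r) ℝ} (hX : X ∈ stiefel n r)
    (hY : Y ∈ stiefel n r) (hK : specNorm (euclGrad φ X) ≤ K) :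
    ‖riemGrad φ X - riemGrad φ Y‖ ≤ (L + 2 * K) * ‖X - Y‖ := by
  have e : riemGrad φ X - riemGrad φ Y = (tangentProj X (euclGrad φ X)
      - tangentProj Y (euclGrad φ X)) + tangentProj Y (euclGrad φ X - euclGrad φ Y) := by
    rw [tangentProj_sub]; simp only [riemGrad]; abel
  have h1 := norm_tangentProj_sub_tangentProj_le_spec hX hY (euclGrad φ X)
  have h2 := (norm_tangentProj_le hY (euclGrad φ X - euclGrad φ Y)).trans (h.2 X Y)
  have h3 := mul_le_mul_of_nonneg_right hK (norm_nonneg (X - Y))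
  rw [e]
  refine (norm_add_le _ _).trans ?_
  linarith

theorem norm_riemGrad_le {φ : Matrix (Fin n) (Fin r) ℝ → ℝ} {X : Matrix (Fin n) (Fin r) ℝ}
    (hX : X ∈ stiefel n r) : ‖riemGrad φ X‖ ≤ ‖euclGrad φ X‖ :=
  norm_tangentProj_le hX _

end Smooth

/-! ### The global cost -/

section Cost

variable {n r N : ℕ} {Ξ : Fin N → Type*} {D : Data n r N Ξ}

theorem Data.euclGrad_cost (hd : ∀ i, Differentiable ℝ (D.f i)) (X : Matrix (Fin n) (Fin r) ℝ) :
    euclGrad D.cost X = mean fun i => euclGrad (D.f i) X := by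
  have h : fderiv ℝ D.cost X = (1 / (N : ℝ)) • ∑ i, fderiv ℝ (D.f i) X := by
    have h1 : HasFDerivAt (fun X => ∑ i, D.f i X) (∑ i, fderiv ℝ (D.f i) X) X :=
      HasFDerivAt.fun_sum fun i _ => (hd i X).hasFDerivAt
    exact (h1.const_mul (1 / (N : ℝ))).fderiv
  ext a b
  simp [euclGrad, h, mean, Matrix.sum_apply]

theorem Data.riemGrad_cost (hd : ∀ i, Differentiable ℝ (D.f i)) (X : Matrix (Fin n) (Fin r) ℝ) :
    riemGrad D.cost X = mean fun i => riemGrad (D.f i) X := by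
  rw [riemGrad, D.euclGrad_cost hd, mean, tangentProj_smul, tangentProj_sum]
  rfl

theorem Data.lSmooth_cost (hN : 0 < N) {L : ℝ} (h : ∀ i, LSmooth L (D.f i)) :
    LSmooth L D.cost := by
  refine ⟨?_, fun X Y => ?_⟩
  · have : Differentiable ℝ fun X => ∑ i, D.f i X :=
      Differentiable.fun_sum fun i _ => (h i).1
    exact this.const_mul _
  · rw [D.euclGrad_cost fun i => (h i).1, D.euclGrad_cost fun i => (h i).1, ← mean_sub]
    refine (norm_mean_le_mean_norm _).trans ?_
    refine (mean_le_mean fun i => (h i).2 X Y).trans ?_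
    rw [mean_const hN]

theorem Data.cost_le_quadratic (hN : 0 < N) {L K : ℝ} (h : ∀ i, LSmooth L (D.f i))
    {X Y : Matrix (Fin n) (Fin r) ℝ} (hX : X ∈ stiefel n r) (hY : Y ∈ stiefel n r)
    (hK : ∀ i, specNorm (euclGrad (D.f i) X) ≤ K) :
    D.cost Y ≤ D.cost X + inner ℝ (riemGrad D.cost X) (Y - X) + (L + K) / 2 * ‖Y - X‖ ^ 2 := by
  have h1 := mean_le_mean fun i => (h i).le_quadratic_riemGrad hX hY (hK i)
  rw [mean_add, mean_add, mean_const hN] at h1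
  have h2 : mean (fun i => inner ℝ (riemGrad (D.f i) X) (Y - X))
      = inner ℝ (riemGrad D.cost X) (Y - X) := by
    rw [D.riemGrad_cost fun i => (h i).1, mean, mean, real_inner_smul_left, sum_inner,
      smul_eq_mul]
  rw [h2] at h1
  exact h1

theorem Data.norm_riemGrad_cost_le (hN : 0 < N) (hd : ∀ i, Differentiable ℝ (D.f i)) {A : ℝ}
    {X : Matrix (Fin n) (Fin r) ℝ} (hX : X ∈ stiefel n r)
    (hA : ∀ i, ‖euclGrad (D.f i) X‖ ≤ A) : ‖riemGrad D.cost X‖ ≤ A := by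
  rw [D.riemGrad_cost hd]
  refine (norm_mean_le_mean_norm _).trans ?_
  refine (mean_le_mean fun i => (norm_riemGrad_le hX).trans (hA i)).trans ?_
  rw [mean_const hN]

/-- Needed because `costMin` is an `sInf`, which bounds from below only a set that is bounded below.
The descent inequality from an arbitrary `Y` to a fixed `X` gives the bound, since chords have
length at most `2 * √r`. -/
theorem Data.bddBelow_cost (hN : 0 < N) {L K A : ℝ} (h : ∀ i, LSmooth L (D.f i))
    (hK : ∀ i, ∀ X ∈ stiefel n r, specNorm (euclGrad (D.f i) X) ≤ K)
    (hA : ∀ i, ∀ X ∈ stiefel n r, ‖euclGrad (D.f i) X‖ ≤ A) :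
    BddBelow (D.cost '' stiefel n r) := by
  rcases Set.eq_empty_or_nonempty (stiefel n r) with he | ⟨X, hX⟩
  · simp [he]
  have hA0 : 0 ≤ A := (norm_nonneg _).trans (hA ⟨0, hN⟩ X hX)
  refine ⟨D.cost X - A * (2 * √r) - |(L + K) / 2| * (2 * √r) ^ 2, ?_⟩
  rintro _ ⟨Y, hY, rfl⟩
  have h1 := D.cost_le_quadratic hN h hY hX fun i => hK i Y hY
  have hn {Z : Matrix (Fin n) (Fin r) ℝ} (hZ : Z ∈ stiefel n r) : ‖Z‖ = √r := by
    rw [← norm_sq_stiefel hZ, Real.sqrt_sq (norm_nonneg _)]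
  have h2 : ‖X - Y‖ ≤ 2 * √r := by
    refine (norm_sub_le _ _).trans ?_
    rw [hn hX, hn hY]; linarith
  have h3 := real_inner_le_norm (riemGrad D.cost Y) (X - Y)
  have h4 : ‖riemGrad D.cost Y‖ * ‖X - Y‖ ≤ A * (2 * √r) :=
    mul_le_mul (D.norm_riemGrad_cost_le hN (fun i => (h i).1) hY fun i => hA i Y hY) h2
      (norm_nonneg _) hA0
  have h5 : (L + K) / 2 * ‖X - Y‖ ^ 2 ≤ |(L + K) / 2| * (2 * √r) ^ 2 :=
    mul_le_mul (le_abs_self _) (pow_le_pow_left₀ (norm_nonneg _) h2 2) (by positivity)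
      (abs_nonneg _)
  linarith

end Cost

/-! ### Induced arithmetic means and their stability -/

section InducedMean

variable {n r N : ℕ} {M : ℝ}

/-- All points of the manifold have the same norm, so minimizing the squared distances amounts to
maximizing the pairing with the average. -/
theorem IsIAM.inner_mean_le (hN : 0 < N) {Z : Fin N → Matrix (Fin n) (Fin r) ℝ}
    {Zh V : Matrix (Fin n) (Fin r) ℝ} (h : IsIAM Z Zh) (hV : V ∈ stiefel n r) :
    inner ℝ V (mean Z) ≤ inner ℝ Zh (mean Z) := by
  have e {U : Matrix (Fin n) (Fin r) ℝ} (hU : U ∈ stiefel n r) :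
      ∑ i, ‖U - Z i‖ ^ 2 = N * r - 2 * inner ℝ U (∑ i, Z i) + ∑ i, ‖Z i‖ ^ 2 := by
    simp only [norm_sub_sq_real, Finset.sum_add_distrib, Finset.sum_sub_distrib,
      norm_sq_stiefel hU]
    rw [← Finset.mul_sum, ← inner_sum]
    simp
  have h1 := h.2 V hV
  rw [e hV, e h.1] at h1
  simp only [mean, real_inner_smul_right]
  gcongr
  linarith

/-- First order optimality of an induced arithmetic mean. -/
theorem IsIAM.tangentProj_mean (hN : 0 < N)
    (hM : ∀ X ∈ stiefel n r, ∀ v ∈ tangentSpace X,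
      ‖polarRetraction X v - (X + v)‖ ≤ M * ‖v‖ ^ 2)
    {Z : Fin N → Matrix (Fin n) (Fin r) ℝ} {Zh : Matrix (Fin n) (Fin r) ℝ} (h : IsIAM Z Zh) :
    tangentProj Zh (mean Z) = 0 := by
  set w := tangentProj Zh (mean Z) with hw
  have hwt : w ∈ tangentSpace Zh := tangentProj_mem h.1 _
  by_contra hne
  have hpos : 0 < ‖w‖ ^ 2 := by have := norm_pos_iff.2 hne; positivity
  have hin : inner ℝ w (mean Z) = ‖w‖ ^ 2 := by
    have := inner_tangent_sub_tangentProj hwt (mean Z)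
    rw [inner_sub_right, ← hw, real_inner_self_eq_norm_sq] at this
    linarith
  -- Moving along `w` gains `t * ‖w‖ ^ 2` to first order, and the retraction error costs at most
  -- `|M| * t ^ 2 * ‖w‖ ^ 2 * ‖mean Z‖`. This `t` keeps the cost below half of the gain; the summand
  -- 1 keeps the denominator positive.
  set t : ℝ := 1 / (2 * (|M| * ‖mean Z‖ + 1)) with ht
  have ht0 : 0 < t := by positivity
  have htw : t • w ∈ tangentSpace Zh := tangentSpace_smul t hwt
  have h1 := h.inner_mean_le hN (polarRetraction_mem h.1 htw)
  have h2 := hM Zh h.1 _ htw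
  have h3 := (abs_le.1 (abs_real_inner_le_norm (polarRetraction Zh (t • w) - (Zh + t • w))
    (mean Z))).1
  rw [inner_sub_left, inner_add_left, real_inner_smul_left, hin] at h3
  rw [norm_smul, Real.norm_of_nonneg ht0.le] at h2
  have h4 : ‖polarRetraction Zh (t • w) - (Zh + t • w)‖ * ‖mean Z‖
      ≤ |M| * (t * ‖w‖) ^ 2 * ‖mean Z‖ := by
    refine mul_le_mul_of_nonneg_right (h2.trans ?_) (norm_nonneg _)
    exact mul_le_mul_of_nonneg_right (le_abs_self M) (by positivity)
  have h5 : t * ‖w‖ ^ 2 ≤ t * ‖w‖ ^ 2 * (t * (|M| * ‖mean Z‖)) := by nlinarith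
  have h6 : t * (|M| * ‖mean Z‖) ≤ 1 / 2 := by
    rw [ht, div_mul_eq_mul_div, one_mul, div_le_div_iff₀ (by positivity) (by norm_num)]
    linarith
  have h7 : 0 < t * ‖w‖ ^ 2 := by positivity
  nlinarith

/-- `Zh` is a point of the Stiefel manifold which is critical for the sum of the squared
distances to the points `Z i` of the manifold. -/
structure IsCriticalMean (Z : Fin N → Matrix (Fin n) (Fin r) ℝ) (Zh : Matrix (Fin n) (Fin r) ℝ) :
    Prop where
  mem : ∀ i, Z i ∈ stiefel n r
  mean_mem : Zh ∈ stiefel n r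
  critical : tangentProj Zh (mean Z) = 0

/-- The average of the gram matrices of the deviations. -/
noncomputable def devGram (Z : Fin N → Matrix (Fin n) (Fin r) ℝ) (Zh : Matrix (Fin n) (Fin r) ℝ) :
    Matrix (Fin r) (Fin r) ℝ :=
  mean fun i => (Z i - Zh)ᵀ * (Z i - Zh)

theorem devGram_transpose (Z : Fin N → Matrix (Fin n) (Fin r) ℝ)
    (Zh : Matrix (Fin n) (Fin r) ℝ) : (devGram Z Zh)ᵀ = devGram Z Zh := by
  simp [devGram, mean, Matrix.transpose_sum]

theorem norm_devGram_le (Z : Fin N → Matrix (Fin n) (Fin r) ℝ)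
    (Zh : Matrix (Fin n) (Fin r) ℝ) : ‖devGram Z Zh‖ ≤ rms (fun i => Z i - Zh) ^ 2 := by
  rw [rms_sq_eq_mean]
  refine (norm_mean_le_mean_norm _).trans (mean_le_mean fun i => ?_)
  refine (Matrix.frobenius_norm_mul _ _).trans ?_
  rw [Matrix.frobenius_norm_transpose, sq]

variable {Z : Fin N → Matrix (Fin n) (Fin r) ℝ} {Zh : Matrix (Fin n) (Fin r) ℝ}

/-- Criticality says that the average is normal at `Zh`, that is, `Zh` times a symmetric matrix,
which the Gram identity evaluates. The mean thus differs from the Euclidean average to second order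
only. -/
theorem IsCriticalMean.mean_eq (h : IsCriticalMean Z Zh) (hN : 0 < N) :
    mean Z = Zh - (1 / 2 : ℝ) • (Zh * devGram Z Zh) := by
  have e : Zhᵀ * mean Z + (mean Z)ᵀ * Zh
      = (2 : ℝ) • (1 : Matrix (Fin r) (Fin r) ℝ) - devGram Z Zh := by
    have e1 : Zhᵀ * mean Z + (mean Z)ᵀ * Zh = mean fun i => (Z i)ᵀ * Zh + Zhᵀ * Z i := by
      rw [mean_add, add_comm]
      simp [mean, Matrix.transpose_sum, Matrix.mul_sum, Matrix.sum_mul]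
    rw [e1, devGram, ← mean_const hN ((2 : ℝ) • (1 : Matrix (Fin r) (Fin r) ℝ)), ← mean_sub]
    refine congrArg mean (funext fun i => ?_)
    rw [add_comm, ← neg_sub Zh (Z i), Matrix.transpose_neg, Matrix.neg_mul, Matrix.mul_neg, neg_neg]
    exact gram_sub h.mean_mem (h.mem i)
  have hc := h.critical
  rw [tangentProj, e, sub_eq_zero] at hc
  rw [hc, Matrix.mul_sub, Matrix.mul_smul, Matrix.mul_one]
  module

theorem IsCriticalMean.norm_mean_dev_le (h : IsCriticalMean Z Zh) (hN : 0 < N) :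
    ‖mean fun i => Z i - Zh‖ ≤ 1 / 2 * rms (fun i => Z i - Zh) ^ 2 := by
  rw [mean_sub, mean_const hN, h.mean_eq hN, sub_sub_cancel_left, norm_neg, norm_smul,
    norm_stiefel_mul h.mean_mem, Real.norm_of_nonneg (by norm_num)]
  have := norm_devGram_le Z Zh
  linarith

/-- Subtracting the two formulas for the averages and pairing with `Zh - Uh`, the chord identity
bounds each curvature term by a quarter of `‖Zh - Uh‖ ^ 2`, so half of it survives. The bound
controls the motion of the mean between iterations and also gives the measurability of the selected
means. -/
theorem IsCriticalMean.norm_sub_le (h : IsCriticalMean Z Zh) (hN : 0 < N)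
    {U : Fin N → Matrix (Fin n) (Fin r) ℝ} {Uh : Matrix (Fin n) (Fin r) ℝ}
    (hU : IsCriticalMean U Uh) (hZ1 : rms (fun i => Z i - Zh) ≤ 1)
    (hU1 : rms (fun i => U i - Uh) ≤ 1) : ‖Zh - Uh‖ ≤ 2 * ‖mean Z - mean U‖ := by
  set Q := devGram Z Zh with hQ
  set K := devGram U Uh with hK
  have e : mean Z - mean U = (Zh - Uh) - (1 / 2 : ℝ) • (Zh * Q - Uh * K) := by
    rw [h.mean_eq hN, hU.mean_eq hN]; module
  have h1 := inner_sub_stiefel_mul_symm h.mean_mem hU.mean_mem (devGram_transpose Z Zh)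
  have h2 := inner_sub_stiefel_mul_symm hU.mean_mem h.mean_mem (devGram_transpose U Uh)
  rw [← neg_sub Zh Uh, inner_neg_left, inner_neg_left, Matrix.neg_mul, inner_neg_right] at h2
  have h3 : inner ℝ (Zh - Uh) (mean Z - mean U) = ‖Zh - Uh‖ ^ 2
      - 1 / 4 * (inner ℝ (Zh - Uh) ((Zh - Uh) * Q) + inner ℝ (Zh - Uh) ((Zh - Uh) * K)) := by
    rw [e, inner_sub_right, real_inner_self_eq_norm_sq, real_inner_smul_right, inner_sub_right]
    linarith
  have hb {H : Matrix (Fin r) (Fin r) ℝ} (hH : ‖H‖ ≤ 1) :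
      inner ℝ (Zh - Uh) ((Zh - Uh) * H) ≤ ‖Zh - Uh‖ ^ 2 := by
    have h4 := real_inner_le_norm (Zh - Uh) ((Zh - Uh) * H)
    have h5 := Matrix.frobenius_norm_mul (Zh - Uh) H
    have h6 := norm_nonneg (Zh - Uh)
    nlinarith [mul_le_mul_of_nonneg_left hH h6]
  have hQ1 : ‖Q‖ ≤ 1 := (norm_devGram_le Z Zh).trans (pow_le_one₀ (rms_nonneg _) hZ1)
  have hK1 : ‖K‖ ≤ 1 := (norm_devGram_le U Uh).trans (pow_le_one₀ (rms_nonneg _) hU1)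
  have h7 := hb hQ1
  have h8 := hb hK1
  have h9 := real_inner_le_norm (Zh - Uh) (mean Z - mean U)
  by_contra! hc
  have := norm_nonneg (mean Z - mean U)
  nlinarith

end InducedMean

/-! ### The projected consensus direction -/

section ConsensusStep

variable {n r N : ℕ} {P : Matrix (Fin N) (Fin N) ℝ} {s : ℝ}
  {X : Fin N → Matrix (Fin n) (Fin r) ℝ}

/-- The normal component of the displacement from `X i` to the weighted average of the `X j`. -/
noncomputable def curvTerm (P : Matrix (Fin N) (Fin N) ℝ) (X : Fin N → Matrix (Fin n) (Fin r) ℝ)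
    (i : Fin N) : Matrix (Fin n) (Fin r) ℝ :=
  (1 / 2 : ℝ) • (X i * mix P (fun j => (X i - X j)ᵀ * (X i - X j)) i)

/-- The projection only adds a correction that is quadratic in the differences of the points. The
reference point `Xh` cancels; it is inserted to obtain the deviations that mixing contracts. -/
theorem IsMixing.tangentProj_mix (hP : IsMixing P s) (hX : ∀ i, X i ∈ stiefel n r)
    (Xh : Matrix (Fin n) (Fin r) ℝ) (i : Fin N) :
    tangentProj (X i) (mix P X i)
      = mix P (fun j => X j - Xh) i - (X i - Xh) + curvTerm P X i := by
  have e : (X i)ᵀ * mix P X i + (mix P X i)ᵀ * X i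
      = (2 : ℝ) • (1 : Matrix (Fin r) (Fin r) ℝ)
        - mix P (fun j => (X i - X j)ᵀ * (X i - X j)) i := by
    rw [← hP.mix_const ((2 : ℝ) • (1 : Matrix (Fin r) (Fin r) ℝ)) i, ← mix_sub]
    simp only [← gram_sub (hX i) (hX _)]
    simp [mix, Matrix.transpose_sum, Matrix.mul_sum, Matrix.sum_mul, Finset.sum_add_distrib]
  rw [tangentProj, e, curvTerm, mix_sub, hP.mix_const, Matrix.mul_sub, Matrix.mul_smul,
    Matrix.mul_one]
  module

theorem IsMixing.norm_curvTerm_le (hP : IsMixing P s) (hX : ∀ i, X i ∈ stiefel n r)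
    (i : Fin N) : ‖curvTerm P X i‖ ≤ 1 / 2 * mix P (fun j => ‖X i - X j‖ ^ 2) i := by
  rw [curvTerm, norm_smul, norm_stiefel_mul (hX i), Real.norm_of_nonneg (by norm_num)]
  gcongr
  refine (hP.norm_mix_le _ i).trans (hP.mix_mono (fun j => ?_) i)
  refine (Matrix.frobenius_norm_mul _ _).trans ?_
  rw [Matrix.frobenius_norm_transpose, sq]

/-- One factor of each square is spent on the uniform bound `c`, which leaves an estimate linear in
the deviations, as the contraction of the consensus error requires. -/
theorem IsMixing.norm_curvTerm_le_max (hP : IsMixing P s) (hX : ∀ i, X i ∈ stiefel n r)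
    {Xh : Matrix (Fin n) (Fin r) ℝ} {c : ℝ} (hmax : ∀ i, ‖X i - Xh‖ ≤ c) (i : Fin N) :
    ‖curvTerm P X i‖ ≤ c * (‖X i - Xh‖ + mix P (fun j => ‖X j - Xh‖) i) := by
  refine (hP.norm_curvTerm_le hX i).trans ?_
  have h1 : mix P (fun j => ‖X i - X j‖ ^ 2) i
      ≤ mix P (fun j => (2 * c) • (‖X i - Xh‖ + ‖X j - Xh‖)) i := by
    refine hP.mix_mono (fun j => ?_) i
    have h : ‖X i - X j‖ ≤ ‖X i - Xh‖ + ‖X j - Xh‖ := by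
      have := norm_sub_le (X i - Xh) (X j - Xh)
      rwa [sub_sub_sub_cancel_right] at this
    have h2 := hmax i
    have h3 := hmax j
    rw [smul_eq_mul]
    nlinarith [norm_nonneg (X i - X j), norm_nonneg (X i - Xh), norm_nonneg (X j - Xh)]
  have h2 : mix P (fun j => (2 * c) • (‖X i - Xh‖ + ‖X j - Xh‖)) i
      = 2 * c * (‖X i - Xh‖ + mix P (fun j => ‖X j - Xh‖) i) := by
    have h3 : mix P (fun _ => ‖X i - Xh‖) i = ‖X i - Xh‖ := hP.mix_const _ i
    conv_rhs => rw [← h3, ← mix_add]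
    simp only [mix, smul_eq_mul, Finset.mul_sum]
    exact Finset.sum_congr rfl fun j _ => by ring
  linarith

theorem IsMixing.rms_curvTerm_le (hP : IsMixing P s) (hX : ∀ i, X i ∈ stiefel n r)
    {Xh : Matrix (Fin n) (Fin r) ℝ} {c : ℝ} (hc : 0 ≤ c) (hmax : ∀ i, ‖X i - Xh‖ ≤ c) :
    rms (curvTerm P X) ≤ 2 * c * rms (fun i => X i - Xh) := by
  have h1 : rms (curvTerm P X)
      ≤ rms (fun i => c • (‖X i - Xh‖ + mix P (fun j => ‖X j - Xh‖) i)) :=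
    rms_mono fun i => (hP.norm_curvTerm_le_max hX hmax i).trans (le_abs_self _)
  have h2 := rms_add_le (fun i => ‖X i - Xh‖) (mix P fun j => ‖X j - Xh‖)
  have h3 := hP.rms_mix_le (fun j => ‖X j - Xh‖)
  rw [rms_norm] at h2 h3
  rw [rms_smul, abs_of_nonneg hc] at h1
  nlinarith

/-- Here both factors are kept: the motion of the average needs an estimate of second order. -/
theorem IsMixing.mean_norm_curvTerm_le (hP : IsMixing P s) (hX : ∀ i, X i ∈ stiefel n r)
    (Xh : Matrix (Fin n) (Fin r) ℝ) :
    mean (fun i => ‖curvTerm P X i‖) ≤ 2 * rms (fun i => X i - Xh) ^ 2 := by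
  have h1 (i : Fin N) : ‖curvTerm P X i‖
      ≤ ‖X i - Xh‖ ^ 2 + mix P (fun j => ‖X j - Xh‖ ^ 2) i := by
    refine (hP.norm_curvTerm_le hX i).trans ?_
    have h2 : mix P (fun j => ‖X i - X j‖ ^ 2) i
        ≤ mix P (fun j => 2 * ‖X i - Xh‖ ^ 2 + 2 * ‖X j - Xh‖ ^ 2) i := by
      refine hP.mix_mono (fun j => ?_) i
      have h : ‖X i - X j‖ ≤ ‖X i - Xh‖ + ‖X j - Xh‖ := by
        have := norm_sub_le (X i - Xh) (X j - Xh)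
        rwa [sub_sub_sub_cancel_right] at this
      nlinarith [norm_nonneg (X i - X j), sq_nonneg (‖X i - Xh‖ - ‖X j - Xh‖)]
    have h3 : mix P (fun j => 2 * ‖X j - Xh‖ ^ 2) i = 2 * mix P (fun j => ‖X j - Xh‖ ^ 2) i := by
      simp only [mix, smul_eq_mul, Finset.mul_sum]
      exact Finset.sum_congr rfl fun j _ => by ring
    rw [mix_add, hP.mix_const, h3] at h2
    linarith
  refine (mean_le_mean h1).trans ?_
  rw [mean_add, ← rms_sq_eq_mean]
  have h2 := hP.mean_mix (fun j => ‖X j - Xh‖ ^ 2)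
  have h3 : mean (fun i => mix P (fun j => ‖X j - Xh‖ ^ 2) i) = rms (fun i => X i - Xh) ^ 2 := by
    rw [rms_sq_eq_mean]; exact h2
  rw [h3]
  linarith

end ConsensusStep

/-! ### One iteration: consensus, displacement, averaged direction -/

section Step

variable {n r N : ℕ}

theorem mean_mul_le_rms_mul_rms (a b : Fin N → ℝ) :
    mean (fun i => a i * b i) ≤ rms a * rms b := by
  rcases Nat.eq_zero_or_pos N with rfl | hN
  · simp [mean, rms]
  have h : ∀ t : ℝ, 0 ≤ rms a ^ 2 * (t * t) + (-2 * mean fun i => a i * b i) * t + rms b ^ 2 := by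
    intro t
    have e : rms a ^ 2 * (t * t) + (-2 * mean fun i => a i * b i) * t + rms b ^ 2
        = mean fun i => (t * a i - b i) ^ 2 := by
      rw [rms_sq_eq_mean, rms_sq_eq_mean]
      simp only [mean, smul_eq_mul, Real.norm_eq_abs, sq_abs, sub_sq, Finset.sum_add_distrib,
        Finset.sum_sub_distrib, mul_pow, ← Finset.mul_sum]
      have : ∑ i, 2 * (t * a i) * b i = 2 * t * ∑ i, a i * b i := by
        rw [Finset.mul_sum]; exact Finset.sum_congr rfl fun i _ => by ring
      rw [this]
      ring
    rw [e]
    simp only [mean, smul_eq_mul]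
    positivity
  have hd := discrim_le_zero h
  rw [discrim] at hd
  refine le_of_abs_le ((sq_le_sq₀ (abs_nonneg _)
    (mul_nonneg (rms_nonneg a) (rms_nonneg b))).1 ?_)
  rw [sq_abs, mul_pow]
  linarith

/-- The tangent vector along which an agent moves. -/
noncomputable def stepDir (P : Matrix (Fin N) (Fin N) ℝ) (α β : ℝ)
    (X Y : Fin N → Matrix (Fin n) (Fin r) ℝ) (i : Fin N) : Matrix (Fin n) (Fin r) ℝ :=
  α • tangentProj (X i) (mix P X i) - β • tangentProj (X i) (Y i)

/-- The new points of the agents. -/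
noncomputable def stepX (P : Matrix (Fin N) (Fin N) ℝ) (α β : ℝ)
    (X Y : Fin N → Matrix (Fin n) (Fin r) ℝ) (i : Fin N) : Matrix (Fin n) (Fin r) ℝ :=
  polarRetraction (X i) (stepDir P α β X Y i)

variable {P : Matrix (Fin N) (Fin N) ℝ} {s α β M : ℝ} {X Y : Fin N → Matrix (Fin n) (Fin r) ℝ}
  {Xh : Matrix (Fin n) (Fin r) ℝ}

theorem stepDir_mem (hX : ∀ i, X i ∈ stiefel n r) (i : Fin N) :
    stepDir P α β X Y i ∈ tangentSpace (X i) := by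
  rw [stepDir, sub_eq_add_neg, ← neg_smul]
  exact tangentSpace_add (tangentSpace_smul _ (tangentProj_mem (hX i) _))
    (tangentSpace_smul _ (tangentProj_mem (hX i) _))

theorem stepX_mem (hX : ∀ i, X i ∈ stiefel n r) (i : Fin N) :
    stepX P α β X Y i ∈ stiefel n r :=
  polarRetraction_mem (hX i) (stepDir_mem hX i)

/-- The hypotheses under which one step of the algorithm is analysed. -/
structure StepSetting (P : Matrix (Fin N) (Fin N) ℝ) (s α β M : ℝ)
    (X : Fin N → Matrix (Fin n) (Fin r) ℝ) (Xh : Matrix (Fin n) (Fin r) ℝ) : Prop where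
  hN : 0 < N
  mixing : IsMixing P s
  s_le : s ≤ 1 / (2 * √N)
  s_sq : s ^ 2 ≤ 1 / 8
  α_pos : 0 < α
  α_le : α ≤ 1
  β_pos : 0 < β
  M_nonneg : 0 ≤ M
  M_mul_le : M * α ≤ 1
  retraction : ∀ X ∈ stiefel n r, ∀ v ∈ tangentSpace X,
    ‖polarRetraction X v - (X + v)‖ ≤ M * ‖v‖ ^ 2
  critical : IsCriticalMean X Xh
  rms_le : rms (fun i => X i - Xh) ≤ 1 / 320
  max_le : ∀ i, ‖X i - Xh‖ ≤ 1 / 6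

namespace StepSetting

/-- The average deviation is at most `rms ^ 2 / 2`, negligible for `rms ≤ 1 / 320`; what remains is
`s ≤ √(1/8)`, below 9/25 with room for this excess. -/
theorem rms_mix_dev_le (h : StepSetting P s α β M X Xh) :
    rms (mix P fun i => X i - Xh) ≤ 9 / 25 * rms (fun i => X i - Xh) := by
  have h1 := h.mixing.rms_mix_le_add h.hN (fun i => X i - Xh)
  have h2 := h.critical.norm_mean_dev_le h.hN
  have h3 := h.rms_le
  have h4 := rms_nonneg (fun i => X i - Xh)
  have h5 : s ≤ 0.354 := by
    by_contra! hc
    have := h.s_sq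
    nlinarith
  nlinarith

/-- The projection annihilates `X i`, so no curvature term appears and the constant is 1 + 9/25 ≤
3/2. -/
theorem rms_tangentProj_mix_le (h : StepSetting P s α β M X Xh) :
    rms (fun i => tangentProj (X i) (mix P X i)) ≤ 3 / 2 * rms (fun i => X i - Xh) := by
  have h1 : rms (fun i => tangentProj (X i) (mix P X i))
      ≤ rms (fun i => mix P (fun i => X i - Xh) i - (X i - Xh)) := by
    refine rms_mono fun i => ?_
    have e : tangentProj (X i) (mix P X i)
        = tangentProj (X i) (mix P (fun i => X i - Xh) i - (X i - Xh)) := by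
      rw [mix_sub, h.mixing.mix_const, sub_sub_sub_cancel_right, tangentProj_sub,
        tangentProj_self (h.critical.mem i), sub_zero]
    rw [e]
    exact norm_tangentProj_le (h.critical.mem i) _
  have h2 := rms_sub_le (mix P fun i => X i - Xh) (fun i => X i - Xh)
  have h3 := h.rms_mix_dev_le
  have h4 := rms_nonneg (fun i => X i - Xh)
  linarith

theorem rms_tangentProj_le (h : StepSetting P s α β M X Xh)
    (Y : Fin N → Matrix (Fin n) (Fin r) ℝ) :
    rms (fun i => tangentProj (X i) (Y i)) ≤ rms Y :=
  rms_mono fun i => norm_tangentProj_le (h.critical.mem i) (Y i)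

theorem rms_stepDir_le (h : StepSetting P s α β M X Xh)
    (Y : Fin N → Matrix (Fin n) (Fin r) ℝ) :
    rms (stepDir P α β X Y) ≤ 3 / 2 * α * rms (fun i => X i - Xh) + β * rms Y := by
  have h1 := rms_sub_le (fun i => α • tangentProj (X i) (mix P X i))
    (fun i => β • tangentProj (X i) (Y i))
  rw [rms_smul, rms_smul, abs_of_pos h.α_pos, abs_of_pos h.β_pos] at h1
  have h2 := mul_le_mul_of_nonneg_left h.rms_tangentProj_mix_le h.α_pos.le
  have h3 := mul_le_mul_of_nonneg_left (h.rms_tangentProj_le Y) h.β_pos.le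
  refine (show rms (stepDir P α β X Y) ≤ _ from h1).trans ?_
  linarith

theorem dev_add_stepDir (h : StepSetting P s α β M X Xh)
    (Y : Fin N → Matrix (Fin n) (Fin r) ℝ) (i : Fin N) :
    X i + stepDir P α β X Y i - Xh = ((1 - α) • (X i - Xh) + α • mix P (fun i => X i - Xh) i
      + α • curvTerm P X i) - β • tangentProj (X i) (Y i) := by
  rw [stepDir, h.mixing.tangentProj_mix h.critical.mem Xh]
  module

/-- The retraction does not increase the distance to `Xh`, so the step before retraction may be
estimated instead. Mixing leaves 9/25, curvature adds 2 · 1/6, and 1 - 9/25 - 1/3 ≥ 3/10. -/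
theorem rms_stepX_sub_le (h : StepSetting P s α β M X Xh)
    (Y : Fin N → Matrix (Fin n) (Fin r) ℝ) :
    rms (fun i => stepX P α β X Y i - Xh)
      ≤ (1 - 3 / 10 * α) * rms (fun i => X i - Xh) + β * rms Y := by
  have hα := h.α_pos
  have h1 : rms (fun i => stepX P α β X Y i - Xh)
      ≤ rms (fun i => X i + stepDir P α β X Y i - Xh) := rms_mono fun i =>
    norm_polarRetraction_sub_le (h.critical.mem i) (stepDir_mem h.critical.mem i)
      h.critical.mean_mem
  simp only [h.dev_add_stepDir] at h1
  have h2 := rms_sub_le (fun i => (1 - α) • (X i - Xh) + α • mix P (fun i => X i - Xh) i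
      + α • curvTerm P X i) (fun i => β • tangentProj (X i) (Y i))
  have h3 := rms_add_le (fun i => (1 - α) • (X i - Xh) + α • mix P (fun i => X i - Xh) i)
    (fun i => α • curvTerm P X i)
  have h4 := rms_add_le (fun i => (1 - α) • (X i - Xh))
    (fun i => α • mix P (fun i => X i - Xh) i)
  rw [rms_smul, abs_of_pos h.β_pos] at h2
  rw [rms_smul, abs_of_pos hα] at h3
  rw [rms_smul, rms_smul, abs_of_pos hα, abs_of_nonneg (sub_nonneg.2 h.α_le)] at h4
  have h5 := mul_le_mul_of_nonneg_left h.rms_mix_dev_le hα.le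
  have h6 := mul_le_mul_of_nonneg_left
    (h.mixing.rms_curvTerm_le h.critical.mem (by norm_num) h.max_le) hα.le
  have h7 := mul_le_mul_of_nonneg_left (h.rms_tangentProj_le Y) h.β_pos.le
  have h8 : 0 ≤ α * rms (fun i => X i - Xh) := mul_nonneg hα.le (rms_nonneg _)
  have h9 : rms (fun i => mix P (fun i => X i - Xh) i) = rms (mix P fun i => X i - Xh) := rfl
  have h10 : rms (fun i => curvTerm P X i) = rms (curvTerm P X) := rfl
  rw [h9] at h4
  rw [h10] at h3
  linarith

theorem norm_stepX_sub_le (h : StepSetting P s α β M X Xh)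
    (Y : Fin N → Matrix (Fin n) (Fin r) ℝ) (i : Fin N) :
    ‖stepX P α β X Y i - Xh‖
      ≤ (1 - α) / 6 + α * (rms (fun i => X i - Xh) + 1 / 18) + β * ‖Y i‖ := by
  have hα := h.α_pos
  have h1 := norm_polarRetraction_sub_le (h.critical.mem i)
    (stepDir_mem (P := P) (α := α) (β := β) (Y := Y) h.critical.mem i) h.critical.mean_mem
  rw [h.dev_add_stepDir] at h1
  have h2 := norm_sub_le ((1 - α) • (X i - Xh) + α • mix P (fun i => X i - Xh) i
      + α • curvTerm P X i) (β • tangentProj (X i) (Y i))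
  have h3 := norm_add₃_le (a := (1 - α) • (X i - Xh)) (b := α • mix P (fun i => X i - Xh) i)
    (c := α • curvTerm P X i)
  rw [norm_smul, norm_smul, norm_smul, Real.norm_of_nonneg hα.le,
    Real.norm_of_nonneg (sub_nonneg.2 h.α_le)] at h3
  rw [norm_smul (α := ℝ) β, Real.norm_of_nonneg h.β_pos.le] at h2
  have h4 := mul_le_mul_of_nonneg_left (h.max_le i) (sub_nonneg.2 h.α_le)
  have h5 : ‖mix P (fun i => X i - Xh) i‖ ≤ rms (fun i => X i - Xh) := by
    have h6 := h.mixing.norm_mix_le_add h.hN h.s_le (fun i => X i - Xh) i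
    have h7 := h.critical.norm_mean_dev_le h.hN
    have h8 := h.rms_le
    have h9 := rms_nonneg (fun i => X i - Xh)
    nlinarith
  -- 1/18 = 1/6 · (1/6 + 1/6).
  have h6 : ‖curvTerm P X i‖ ≤ 1 / 18 := by
    refine (h.mixing.norm_curvTerm_le_max h.critical.mem h.max_le i).trans ?_
    have h7 : mix P (fun j => ‖X j - Xh‖) i ≤ 1 / 6 :=
      (h.mixing.mix_mono h.max_le i).trans_eq (h.mixing.mix_const _ i)
    have h8 := h.max_le i
    linarith
  have h7 := mul_le_mul_of_nonneg_left (norm_tangentProj_le (h.critical.mem i) (Y i)) h.β_pos.le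
  have h8 := mul_le_mul_of_nonneg_left h5 hα.le
  have h9 := mul_le_mul_of_nonneg_left h6 hα.le
  refine (show ‖stepX P α β X Y i - Xh‖ ≤ _ from h1).trans ?_
  linarith

theorem rms_stepX_sub_self_le (h : StepSetting P s α β M X Xh)
    (Y : Fin N → Matrix (Fin n) (Fin r) ℝ) :
    rms (fun i => stepX P α β X Y i - X i)
      ≤ 3 / 2 * α * rms (fun i => X i - Xh) + β * rms Y := by
  refine le_trans (rms_mono fun i => ?_) (h.rms_stepDir_le Y)
  -- The distance bound is applied with `X i` itself as the target point.
  have := norm_polarRetraction_sub_le (h.critical.mem i)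
    (stepDir_mem (P := P) (α := α) (β := β) (Y := Y) h.critical.mem i) (h.critical.mem i)
  rwa [add_sub_cancel_left] at this

theorem norm_mean_stepX_sub_le (h : StepSetting P s α β M X Xh)
    (Y : Fin N → Matrix (Fin n) (Fin r) ℝ) :
    ‖mean (stepX P α β X Y) - mean X‖
      ≤ 3 / 2 * α * rms (fun i => X i - Xh) + β * rms Y := by
  have h1 := norm_mean_le h.hN (fun i => stepX P α β X Y i - X i)
  rw [mean_sub] at h1
  exact h1.trans (h.rms_stepX_sub_self_le Y)

/-- The average of the points moves along the average of the search directions, up to a second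
order error. -/
theorem norm_mean_stepX_sub_add_le (h : StepSetting P s α β M X Xh)
    (Y : Fin N → Matrix (Fin n) (Fin r) ℝ) :
    ‖mean (stepX P α β X Y) - mean X + β • mean (fun i => tangentProj (X i) (Y i))‖
      ≤ 2 * α * rms (fun i => X i - Xh) ^ 2
        + M * (3 / 2 * α * rms (fun i => X i - Xh) + β * rms Y) ^ 2 := by
  have e : mean (stepX P α β X Y) - mean X + β • mean (fun i => tangentProj (X i) (Y i))
      -- Mixing preserves the average, so the linear consensus terms cancel; curvature and
      -- retraction error remain, both of second order.
      = α • mean (curvTerm P X) + mean fun i => stepX P α β X Y i - (X i + stepDir P α β X Y i) := by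
    have e1 (i : Fin N) : X i + stepDir P α β X Y i = X i + α • (mix P (fun i => X i - Xh) i
        - (X i - Xh)) + α • curvTerm P X i - β • tangentProj (X i) (Y i) := by
      rw [stepDir, h.mixing.tangentProj_mix h.critical.mem Xh]
      module
    have e2 : mean (fun i => mix P (fun i => X i - Xh) i) = mean (fun i => X i - Xh) :=
      h.mixing.mean_mix _
    have e3 : mean (fun i => stepX P α β X Y i) = mean (stepX P α β X Y) := rfl
    have e4 : mean (fun i => curvTerm P X i) = mean (curvTerm P X) := rfl
    have e5 : mean (fun i => X i) = mean X := rfl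
    simp only [e1]
    rw [mean_sub, mean_sub, mean_add, mean_add, mean_smul, mean_sub, e2, mean_smul, mean_smul, e3,
      e4, e5]
    module
  have h1 : ‖mean (curvTerm P X)‖ ≤ 2 * rms (fun i => X i - Xh) ^ 2 :=
    (norm_mean_le_mean_norm _).trans (h.mixing.mean_norm_curvTerm_le h.critical.mem Xh)
  have h2 : ‖mean fun i => stepX P α β X Y i - (X i + stepDir P α β X Y i)‖
      ≤ M * rms (stepDir P α β X Y) ^ 2 := by
    refine (norm_mean_le_mean_norm _).trans ?_
    rw [rms_sq_eq_mean, ← smul_eq_mul, ← mean_smul]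
    exact mean_le_mean fun i => h.retraction _ (h.critical.mem i) _ (stepDir_mem h.critical.mem i)
  have h3 := pow_le_pow_left₀ (rms_nonneg _) (h.rms_stepDir_le Y) 2
  have h4 := mul_le_mul_of_nonneg_left h3 h.M_nonneg
  rw [e]
  refine (norm_add_le _ _).trans ?_
  rw [norm_smul, Real.norm_of_nonneg h.α_pos.le]
  have h5 := mul_le_mul_of_nonneg_left h1 h.α_pos.le
  linarith

/-- The average of the search directions approximates a given tangent vector at the mean. -/
theorem norm_mean_tangentProj_sub_le (h : StepSetting P s α β M X Xh)
    (Y : Fin N → Matrix (Fin n) (Fin r) ℝ) {g : Matrix (Fin n) (Fin r) ℝ}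
    (hg : g ∈ tangentSpace Xh) :
    ‖mean (fun i => tangentProj (X i) (Y i)) - g‖
      ≤ ‖mean Y - g‖ + 2 * (rms (fun i => X i - Xh) * rms Y) := by
  have e : mean (fun i => tangentProj (X i) (Y i)) - g
      -- The projection at `Xh` fixes `g`; replacing the projections at the `X i` by it costs a
      -- factor `‖X i - Xh‖`.
      = tangentProj Xh (mean Y - g) + mean fun i => tangentProj (X i) (Y i)
        - tangentProj Xh (Y i) := by
    have e1 : mean (fun i => tangentProj Xh (Y i)) = tangentProj Xh (mean Y) := by
      rw [mean, mean, tangentProj_smul, tangentProj_sum]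
    rw [mean_sub, e1, tangentProj_sub, tangentProj_of_mem hg]
    abel
  have h1 : ‖mean fun i => tangentProj (X i) (Y i) - tangentProj Xh (Y i)‖
      ≤ mean fun i => (2 : ℝ) • (‖X i - Xh‖ * ‖Y i‖) := by
    refine (norm_mean_le_mean_norm _).trans (mean_le_mean fun i => ?_)
    refine (norm_tangentProj_sub_tangentProj_le (h.critical.mem i) h.critical.mean_mem _).trans ?_
    rw [smul_eq_mul, mul_assoc]
  have h2 := mean_mul_le_rms_mul_rms (fun i => ‖X i - Xh‖) (fun i => ‖Y i‖)
  rw [rms_norm, rms_norm] at h2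
  rw [mean_smul, smul_eq_mul] at h1
  have h3 := norm_tangentProj_le h.critical.mean_mem (mean Y - g)
  rw [e]
  refine (norm_add_le _ _).trans ?_
  linarith

end StepSetting

/-- The root mean square distance to an induced arithmetic mean is minimal. -/
theorem IsIAM.rms_le {Z : Fin N → Matrix (Fin n) (Fin r) ℝ} {Zh V : Matrix (Fin n) (Fin r) ℝ}
    (h : IsIAM Z Zh) (hV : V ∈ stiefel n r) :
    rms (fun i => Z i - Zh) ≤ rms (fun i => Z i - V) := by
  have h1 := h.2 V hV
  simp only [norm_sub_rev _ (Z _)] at h1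
  apply Real.sqrt_le_sqrt
  gcongr

end Step

/-! ### Decrease of the potential in one step -/

section Descent

/-- The left side collects the errors in the displacement of the mean: curvature, retraction, and
the gap between mean and Euclidean average before and after the step. The variable `b` stands for `β
* rms Y`. One factor of each square is bounded by a multiple of `δ`. -/
theorem displacement_bound {α δ M e e' b : ℝ} (hα : 0 < α) (hα1 : α ≤ 1) (hM : 0 ≤ M)
    (hMα : M * α ≤ 1) (hδ : δ ≤ 1 / 320) (he0 : 0 ≤ e) (he'0 : 0 ≤ e') (hb0 : 0 ≤ b) (he : e ≤ δ)
    (he' : e' ≤ δ) (hee' : e' ≤ e + b) (hb : b ≤ 3 / 25 * α * δ) :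
    2 * α * e ^ 2 + M * (3 / 2 * α * e + b) ^ 2 + 1 / 2 * e ^ 2 + 1 / 2 * e' ^ 2
      ≤ 21 / 4 * δ * e + 3 / 250 * b := by
  have hδ0 : 0 ≤ δ := he0.trans he
  have h1 : M * (3 / 2 * α * e + b) ^ 2 ≤ 9 / 4 * α * e ^ 2 + 3 * e * b + 3 / 25 * δ * b := by
    have e1 : M * (3 / 2 * α * e + b) ^ 2
        = M * α * (9 / 4 * α * e ^ 2 + 3 * e * b) + M * b * b := by ring
    have h2 : M * α * (9 / 4 * α * e ^ 2 + 3 * e * b) ≤ 1 * (9 / 4 * α * e ^ 2 + 3 * e * b) :=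
      mul_le_mul_of_nonneg_right hMα (by positivity)
    have h3 : M * b * b ≤ 3 / 25 * δ * b := by
      refine mul_le_mul_of_nonneg_right ?_ hb0
      calc M * b ≤ M * (3 / 25 * α * δ) := mul_le_mul_of_nonneg_left hb hM
        _ = M * α * (3 / 25 * δ) := by ring
        _ ≤ 1 * (3 / 25 * δ) := mul_le_mul_of_nonneg_right hMα (by positivity)
        _ = _ := one_mul _
    linarith
  have h4 : α * e ^ 2 ≤ e ^ 2 := mul_le_of_le_one_left (sq_nonneg e) hα1
  have h5 : e ^ 2 ≤ δ * e := by rw [sq]; exact mul_le_mul_of_nonneg_right he he0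
  have h6 : e' ^ 2 ≤ δ * (e + b) := by rw [sq]; exact mul_le_mul he' hee' he'0 hδ0
  have h7 : e * b ≤ δ * b := mul_le_mul_of_nonneg_right he hb0
  have h8 : δ * b ≤ 1 / 320 * b := mul_le_mul_of_nonneg_right hδ hb0
  linarith

/-- Young's inequality ((1-θ)e + b)² ≤ (1-θ)e² + b²/θ with θ = 3α/10. Multiplication by `α` makes
the coefficient of `b ^ 2` independent of `α`, which explains the weight `3 * L * α` in the
potential. -/
theorem contraction_sq {α e e' b : ℝ} (hα : 0 < α) (hα1 : α ≤ 1)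
    (he'0 : 0 ≤ e') (h : e' ≤ (1 - 3 / 10 * α) * e + b) :
    α * e' ^ 2 ≤ α * e ^ 2 - 3 / 10 * α ^ 2 * e ^ 2 + 10 / 3 * b ^ 2 := by
  have h1 : e' ^ 2 ≤ ((1 - 3 / 10 * α) * e + b) ^ 2 := pow_le_pow_left₀ he'0 h 2
  have h2 : 0 ≤ (1 - 3 / 10 * α) * (3 / 10 * α * e - b) ^ 2 :=
    mul_nonneg (by linarith) (sq_nonneg _)
  nlinarith [mul_le_mul_of_nonneg_left h1 hα.le]

/-- The decrease of the potential in one step, in terms of the scalar error quantities. -/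
theorem potential_decrease {α β δ L f f' g e e' V τ n w : ℝ} (hα : 0 < α) (hα1 : α ≤ 1)
    (hβ : 0 < β) (hL : 0 < L) (hy1 : 88 * (L * β) ≤ 1) (hy2 : 24 * (L * β) ≤ α ^ 2)
    (hδy : 64 * δ ^ 2 ≤ L * β * α ^ 2) (hg0 : 0 ≤ g) (he'0 : 0 ≤ e')
    (hV0 : 0 ≤ V) (hw0 : 0 ≤ w) (hcontr : e' ≤ (1 - 3 / 10 * α) * e + β * V)
    (hw : w ≤ 21 / 4 * δ * e + 3 / 250 * (β * V))
    (hV : V ^ 2 ≤ (g + (L * e + n)) ^ 2 + τ ^ 2)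
    (hf : f' ≤ f - β * (g ^ 2 - g * (L * e + n + V / 160)) + g * w + L / 2 * (β * V + w) ^ 2) :
    f' + 3 * L * α * e' ^ 2
        + 3 / 10 * β * (3 / 16 * τ ^ 2
          + 12 * (n ^ 2 + 9 / 4 * (α * (L * e)) ^ 2 + (L * β * V) ^ 2))
      ≤ f + 3 * L * α * e ^ 2 + 3 / 10 * β * τ ^ 2 - β / 16 * g ^ 2 + 10 * β * n ^ 2 := by
  have hLβ : 0 < L * β := mul_pos hL hβ
  -- cross terms of the gradient with the errors
  have c1 : g * (L * e) ≤ 1 / 10 * g ^ 2 + 5 / 2 * (L * e) ^ 2 := by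
    linarith [sq_nonneg (g - 5 * (L * e))]
  have c2 : g * n ≤ 1 / 10 * g ^ 2 + 5 / 2 * n ^ 2 := by
    linarith [sq_nonneg (g - 5 * n)]
  have c3 : g * V ≤ 1 / 2 * g ^ 2 + 1 / 2 * V ^ 2 := by linarith [sq_nonneg (g - V)]
  have c4 : g * (21 / 4 * δ * e) ≤ 1 / 4 * β * g ^ 2 + 441 / 1024 * (L * α ^ 2 * e ^ 2) := by
    -- The left side carries no factor `β`, so the inequality is first multiplied by `β`; `hδy` then
    -- converts `δ ^ 2` into `L * β * α ^ 2`.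
    have h1 : β * (g * (21 / 4 * δ * e))
        ≤ β * (1 / 4 * β * g ^ 2 + 441 / 1024 * (L * α ^ 2 * e ^ 2)) := by
      have h2 := mul_le_mul_of_nonneg_right hδy (sq_nonneg e)
      linarith [sq_nonneg (1 / 2 * β * g - 21 / 4 * δ * e)]
    exact le_of_mul_le_mul_left h1 hβ
  have c5 : g * w ≤ g * (21 / 4 * δ * e) + 3 / 250 * β * (g * V) := by
    have := mul_le_mul_of_nonneg_left hw hg0
    linarith
  -- the quadratic term
  have q1 : (β * V + w) ^ 2 ≤ 2 * (253 / 250 * (β * V)) ^ 2 + 2 * (21 / 4 * δ * e) ^ 2 := by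
    have h1 : β * V + w ≤ 253 / 250 * (β * V) + 21 / 4 * δ * e := by linarith
    have h2 := pow_le_pow_left₀ (add_nonneg (mul_nonneg hβ.le hV0) hw0) h1 2
    linarith [sq_nonneg (253 / 250 * (β * V) - 21 / 4 * δ * e)]
  have q2 : (21 / 4 * δ * e) ^ 2 ≤ 441 / 1024 * (L * β * α ^ 2 * e ^ 2) := by
    linarith [mul_le_mul_of_nonneg_right hδy (sq_nonneg e)]
  have q3 : L * (β * V) ^ 2 ≤ 1 / 88 * (β * V ^ 2) := by
    linarith [mul_le_mul_of_nonneg_right hy1 (mul_nonneg hβ.le (sq_nonneg V))]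
  have q4 : L * (L * β * α ^ 2 * e ^ 2) ≤ 1 / 88 * (L * α ^ 2 * e ^ 2) := by
    have : 0 ≤ L * α ^ 2 * e ^ 2 := by positivity
    linarith [mul_le_mul_of_nonneg_right hy1 this]
  have q5 : L / 2 * (β * V + w) ^ 2
      ≤ (253 / 250) ^ 2 / 88 * (β * V ^ 2) + 441 / 1024 / 88 * (L * α ^ 2 * e ^ 2) := by
    have h1 := mul_le_mul_of_nonneg_left q1 (half_pos hL).le
    have h2 := mul_le_mul_of_nonneg_left q2 hL.le
    linarith
  -- the consensus error
  have k1 := mul_le_mul_of_nonneg_left (contraction_sq hα hα1 he'0 hcontr)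
    (mul_nonneg (by norm_num : (0 : ℝ) ≤ 3) hL.le)
  have k2 : β * (L * e) ^ 2 ≤ 1 / 24 * (L * α ^ 2 * e ^ 2) := by
    have : 0 ≤ L * e ^ 2 := by positivity
    linarith [mul_le_mul_of_nonneg_right hy2 this]
  have k3 : β * (α * (L * e)) ^ 2 ≤ 1 / 88 * (L * α ^ 2 * e ^ 2) := by
    have : 0 ≤ L * α ^ 2 * e ^ 2 := by positivity
    linarith [mul_le_mul_of_nonneg_right hy1 this]
  have k4 : β * (L * β * V) ^ 2 ≤ 1 / 7744 * (β * V ^ 2) := by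
    have h1 : (L * β) ^ 2 ≤ (1 / 88) ^ 2 := pow_le_pow_left₀ hLβ.le (by linarith) 2
    have : 0 ≤ β * V ^ 2 := by positivity
    linarith [mul_le_mul_of_nonneg_right h1 this]
  -- (g + c)² ≤ (6/5) g² + 6 c² with c = L e + n, then c² ≤ 2 (L e)² + 2 n².
  have v1 : V ^ 2 ≤ 6 / 5 * g ^ 2 + 12 * (L * e) ^ 2 + 12 * n ^ 2 + τ ^ 2 := by
    linarith [sq_nonneg (g - 5 * (L * e + n)), sq_nonneg (L * e - n)]
  have v2 := mul_le_mul_of_nonneg_left v1 hβ.le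
  have d1 := mul_le_mul_of_nonneg_left c1 hβ.le
  have d2 := mul_le_mul_of_nonneg_left c2 hβ.le
  have d3 := mul_le_mul_of_nonneg_left c3 hβ.le
  -- Every error in `e` is now a multiple of `L * α ^ 2 * e ^ 2`, and these are absorbed by the term
  -- with coefficient -9/10 in `k1`. The errors in `τ` are absorbed by the drop from 1 to 3/16 in
  -- the tracking term, those in `g` by `-β * g ^ 2`.
  have p1 : 0 ≤ L * α ^ 2 * e ^ 2 := by positivity
  have p2 : 0 ≤ β * g ^ 2 := by positivity
  have p3 : 0 ≤ β * n ^ 2 := by positivity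
  have p4 : 0 ≤ β * τ ^ 2 := by positivity
  linarith

/-- (x + c)² ≤ (3/2) x² + 3 c²; then `s ^ 2 ≤ 1 / 8` gives 3/16, and the four summands of `c` turn 3
into 12. -/
theorem tracking_sq {s τ τ' n n' a b : ℝ} (hs : s ^ 2 ≤ 1 / 8)
    (hτ' : 0 ≤ τ') (h : τ' ≤ s * τ + (n' + n + (3 / 2 * a + b))) :
    τ' ^ 2 ≤ 3 / 16 * τ ^ 2 + 12 * (n ^ 2 + 9 / 4 * a ^ 2 + b ^ 2) + 12 * n' ^ 2 := by
  set c := n' + n + (3 / 2 * a + b) with hc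
  have h1 := pow_le_pow_left₀ hτ' h 2
  have h2 : (s * τ + c) ^ 2 ≤ 3 / 2 * (s ^ 2 * τ ^ 2) + 3 * c ^ 2 := by
    nlinarith [sq_nonneg (s * τ - 2 * c)]
  have h3 := mul_le_mul_of_nonneg_right hs (sq_nonneg τ)
  have h4 : c ^ 2 ≤ 4 * (n' ^ 2 + n ^ 2 + (3 / 2 * a) ^ 2 + b ^ 2) := by
    rw [hc]
    nlinarith [sq_nonneg (n' - n), sq_nonneg (3 / 2 * a - b), sq_nonneg (n' + n - (3 / 2 * a + b))]
  nlinarith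

variable {n r N : ℕ} {P : Matrix (Fin N) (Fin N) ℝ} {s α β M : ℝ}
  {X Y : Fin N → Matrix (Fin n) (Fin r) ℝ} {Xh : Matrix (Fin n) (Fin r) ℝ}

/-- The root mean square deviation from the average. -/
noncomputable def spread (Y : Fin N → Matrix (Fin n) (Fin r) ℝ) : ℝ :=
  rms fun i => Y i - mean Y

/-- Here the geometry is converted into the scalar inequality. Minimality of the new mean against
the old one gives the contraction, and criticality of both means compares their displacement with
that of the average. The intended `g` is the Riemannian gradient at `Xh`, and `ν` is the noise
level. -/
theorem StepSetting.potential_decrease (h : StepSetting P s α β M X Xh)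
    {Xh' g : Matrix (Fin n) (Fin r) ℝ} {δ L f f' ν : ℝ}
    (hcrit : IsCriticalMean (stepX P α β X Y) Xh')
    (hmin : rms (fun i => stepX P α β X Y i - Xh') ≤ rms fun i => stepX P α β X Y i - Xh)
    (he : rms (fun i => X i - Xh) ≤ δ) (he' : rms (fun i => stepX P α β X Y i - Xh') ≤ δ)
    (hδ : δ ≤ 1 / 320) (hV : β * rms Y ≤ 3 / 25 * α * δ) (hL : 0 < L)
    (hy1 : 88 * (L * β) ≤ 1) (hy2 : 24 * (L * β) ≤ α ^ 2) (hδy : 64 * δ ^ 2 ≤ L * β * α ^ 2)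
    (hg : g ∈ tangentSpace Xh) (hν : ‖mean Y - g‖ ≤ L * rms (fun i => X i - Xh) + ν)
    (hf : f' ≤ f + inner ℝ g (Xh' - Xh) + L / 2 * ‖Xh' - Xh‖ ^ 2) :
    f' + 3 * L * α * rms (fun i => stepX P α β X Y i - Xh') ^ 2
        + 3 / 10 * β * (3 / 16 * spread Y ^ 2
          + 12 * (ν ^ 2 + 9 / 4 * (α * (L * rms (fun i => X i - Xh))) ^ 2
            + (L * β * rms Y) ^ 2))
      ≤ f + 3 * L * α * rms (fun i => X i - Xh) ^ 2 + 3 / 10 * β * spread Y ^ 2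
        - β / 16 * ‖g‖ ^ 2 + 10 * β * ν ^ 2 := by
  set e := rms (fun i => X i - Xh) with he_def
  set e' := rms (fun i => stepX P α β X Y i - Xh') with he'_def
  set vbar := mean (fun i => tangentProj (X i) (Y i)) with hvbar
  have he0 : 0 ≤ e := rms_nonneg _
  have he'0 : 0 ≤ e' := rms_nonneg _
  have hV0 : 0 ≤ rms Y := rms_nonneg _
  have hβ := h.β_pos
  have hcontr : e' ≤ (1 - 3 / 10 * α) * e + β * rms Y := hmin.trans (h.rms_stepX_sub_le Y)
  have hee' : e' ≤ e + β * rms Y := by nlinarith [h.α_pos]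
  have hw : ‖Xh' - Xh + β • vbar‖ ≤ 21 / 4 * δ * e + 3 / 250 * (β * rms Y) := by
    refine le_trans ?_ (displacement_bound h.α_pos h.α_le h.M_nonneg h.M_mul_le hδ he0 he'0
      (mul_nonneg hβ.le hV0) he he' hee' hV)
    have h1 := h.norm_mean_stepX_sub_add_le Y
    have h2 := h.critical.norm_mean_dev_le h.hN
    have h3 := hcrit.norm_mean_dev_le h.hN
    rw [mean_sub, mean_const h.hN] at h2 h3
    have e1 : Xh' - Xh + β • vbar = (mean (stepX P α β X Y) - mean X + β • vbar)
        + (mean X - Xh) - (mean (stepX P α β X Y) - Xh') := by abel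
    rw [e1]
    refine (norm_sub_le _ _).trans ?_
    have h4 := norm_add_le (mean (stepX P α β X Y) - mean X + β • vbar) (mean X - Xh)
    have h5 : mean (fun i => stepX P α β X Y i) = mean (stepX P α β X Y) := rfl
    have h6 : mean (fun i => X i) = mean X := rfl
    rw [h5] at h3
    rw [h6] at h2
    linarith
  have hvn : ‖vbar‖ ≤ rms Y := (norm_mean_le h.hN _).trans (h.rms_tangentProj_le Y)
  have hVsq : rms Y ^ 2 ≤ (‖g‖ + (L * e + ν)) ^ 2 + spread Y ^ 2 := by
    rw [rms_sq_eq h.hN Y, spread]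
    have h1 : ‖mean Y‖ ≤ ‖g‖ + (L * e + ν) := by
      have := norm_add_le g (mean Y - g)
      rw [add_sub_cancel] at this
      linarith
    have := pow_le_pow_left₀ (norm_nonneg _) h1 2
    linarith
  refine StiefelGT.potential_decrease (w := ‖Xh' - Xh + β • vbar‖) h.α_pos h.α_le hβ hL hy1 hy2 hδy
    (norm_nonneg g) he'0 hV0 (norm_nonneg _) hcontr hw hVsq ?_
  have h1 : ‖vbar - g‖ ≤ L * e + ν + rms Y / 160 := by
    have h2 := h.norm_mean_tangentProj_sub_le Y hg
    have h3 := mul_le_mul_of_nonneg_right (he.trans hδ) hV0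
    linarith
  have h2 : inner ℝ g (Xh' - Xh) = inner ℝ g (Xh' - Xh + β • vbar)
      - β * (inner ℝ g (vbar - g) + ‖g‖ ^ 2) := by
    rw [inner_add_right g, real_inner_smul_right, inner_sub_right g vbar g,
      real_inner_self_eq_norm_sq]
    ring
  have h3 := real_inner_le_norm g (Xh' - Xh + β • vbar)
  have h4 := (abs_le.1 (abs_real_inner_le_norm g (vbar - g))).1
  have h5 := mul_le_mul_of_nonneg_left h1 (norm_nonneg g)
  have h6 : ‖Xh' - Xh‖ ≤ β * rms Y + ‖Xh' - Xh + β • vbar‖ := by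
    have h7 := norm_sub_le (Xh' - Xh + β • vbar) (β • vbar)
    rw [add_sub_cancel_right, norm_smul, Real.norm_of_nonneg hβ.le] at h7
    have := mul_le_mul_of_nonneg_left hvn hβ.le
    linarith
  have h7 := mul_le_mul_of_nonneg_left (pow_le_pow_left₀ (norm_nonneg _) h6 2) (half_pos hL).le
  have h8 : β * -(‖g‖ * (L * e + ν + rms Y / 160)) ≤ β * inner ℝ g (vbar - g) :=
    mul_le_mul_of_nonneg_left (by linarith) hβ.le
  linarith

end Descent

/-! ### Spectral properties of the weight matrix -/

section Network

variable {N : ℕ} {𝒢 : SimpleGraph (Fin N)} {W : Matrix (Fin N) (Fin N) ℝ}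

namespace NetworkAssumption

theorem nonneg (h : NetworkAssumption 𝒢 W) (i j : Fin N) : 0 ≤ W i j := by
  by_cases hij : 𝒢.Adj i j ∨ i = j
  · exact (h.pos i j hij).le
  · exact (h.zero i j hij).ge

theorem symm_apply (h : NetworkAssumption 𝒢 W) (i j : Fin N) : W i j = W j i :=
  congrFun (congrFun h.symm j) i

theorem col_sum (h : NetworkAssumption 𝒢 W) (j : Fin N) : ∑ i, W i j = 1 := by
  rw [← h.row_sum j]
  exact Finset.sum_congr rfl fun i _ => h.symm_apply i j

/-- Each row contributes its weighted variance; unit column sums turn the weighted second moments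
into `∑ x i ^ 2`. -/
theorem sum_sq_sub_sum_mulVec_sq (h : NetworkAssumption 𝒢 W) (x : Fin N → ℝ) :
    ∑ i, x i ^ 2 - ∑ i, (W *ᵥ x) i ^ 2 = ∑ i, ∑ j, W i j * (x j - (W *ᵥ x) i) ^ 2 := by
  have e (i : Fin N) : ∑ j, W i j * (x j - (W *ᵥ x) i) ^ 2
      = ∑ j, W i j * x j ^ 2 - (W *ᵥ x) i ^ 2 := by
    have h1 : ∑ j, W i j * (x j - (W *ᵥ x) i) ^ 2 = ∑ j, W i j * x j ^ 2
        - 2 * (W *ᵥ x) i * ∑ j, W i j * x j + (W *ᵥ x) i ^ 2 * ∑ j, W i j := by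
      rw [Finset.mul_sum, Finset.mul_sum, ← Finset.sum_sub_distrib, ← Finset.sum_add_distrib]
      exact Finset.sum_congr rfl fun j _ => by ring
    have h2 : ∑ j, W i j * x j = (W *ᵥ x) i := rfl
    rw [h1, h2, h.row_sum]
    ring
  simp only [e, Finset.sum_sub_distrib]
  rw [Finset.sum_comm]
  simp [← Finset.sum_mul, h.col_sum]

/-- If `W` does not shrink `x`, all row variances vanish, so `x j` equals `(W *ᵥ x) i` for
neighbours `j` of `i` and, by the positive diagonal, for `j = i`. Connectedness makes `x` constant.
This yields the simplicity of the singular value 1. -/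
theorem eq_of_sum_sq_le (h : NetworkAssumption 𝒢 W) {x : Fin N → ℝ}
    (hx : ∑ i, x i ^ 2 ≤ ∑ i, (W *ᵥ x) i ^ 2) (i j : Fin N) : x i = x j := by
  have h0 (i j : Fin N) : 0 ≤ W i j * (x j - (W *ᵥ x) i) ^ 2 :=
    mul_nonneg (h.nonneg i j) (sq_nonneg _)
  have h1 : ∑ i, ∑ j, W i j * (x j - (W *ᵥ x) i) ^ 2 = 0 := by
    refine le_antisymm ?_ (Finset.sum_nonneg fun i _ => Finset.sum_nonneg fun j _ => h0 i j)
    rw [← h.sum_sq_sub_sum_mulVec_sq]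
    linarith
  have h2 (i j : Fin N) (hij : 𝒢.Adj i j ∨ i = j) : x j = (W *ᵥ x) i := by
    have h3 := (Finset.sum_eq_zero_iff_of_nonneg fun i _ =>
      Finset.sum_nonneg fun j _ => h0 i j).1 h1 i (Finset.mem_univ i)
    have h4 := (Finset.sum_eq_zero_iff_of_nonneg fun j _ => h0 i j).1 h3 j (Finset.mem_univ j)
    have h5 := (mul_eq_zero.1 h4).resolve_left (h.pos i j hij).ne'
    exact sub_eq_zero.1 (pow_eq_zero_iff two_ne_zero |>.1 h5)
  obtain ⟨p⟩ := h.connected.preconnected i j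
  induction p with
  | nil => rfl
  | cons hadj _ ih => rw [h2 _ _ (Or.inr rfl), ← h2 _ _ (Or.inl hadj), ih]

end NetworkAssumption

theorem adjoint_comp_toEuclideanLin (hW : Wᵀ = W) :
    LinearMap.adjoint (Matrix.toEuclideanLin W) ∘ₗ Matrix.toEuclideanLin W
      = Matrix.toEuclideanLin W ∘ₗ Matrix.toEuclideanLin W := by
  have h : Wᴴ = W := hW
  rw [← Matrix.toEuclideanLin_conjTranspose_eq_adjoint, h]

/-- In an eigenbasis of `WᵀW`, eigenvectors with eigenvalue at least 1 are constant, and two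
constant vectors cannot be orthonormal; hence the second eigenvalue is below 1. The all-ones vector
is fixed, so it is orthogonal to all later eigenvectors, and vectors of sum zero have no component
along the first. -/
theorem NetworkAssumption.contract_and_sigmaTwo_lt_one (h : NetworkAssumption 𝒢 W) (hN : 2 ≤ N) :
    sigmaTwo W < 1 ∧ ∀ z : Fin N → ℝ, ∑ i, z i = 0 →
      ∑ i, (W *ᵥ z) i ^ 2 ≤ sigmaTwo W ^ 2 * ∑ i, z i ^ 2 := by
  set T := Matrix.toEuclideanLin W with hT
  have hfin : Module.finrank ℝ (EuclideanSpace ℝ (Fin N)) = N := finrank_euclideanSpace_fin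
  have hsym := T.isSymmetric_adjoint_comp_self
  set lam := hsym.eigenvalues hfin with hlam
  set b := hsym.eigenvectorBasis hfin with hb
  let i₀ : Fin N := ⟨0, by omega⟩
  let i₁ : Fin N := ⟨1, by omega⟩
  have hσ : sigmaTwo W ^ 2 = lam i₁ := T.sq_singularValues_fin hfin i₁
  have hσ0 : 0 ≤ sigmaTwo W := T.singularValues_nonneg 1
  have hTx (x : EuclideanSpace ℝ (Fin N)) (i : Fin N) : T x i = (W *ᵥ x.ofLp) i := rfl
  have heig (i : Fin N) : (LinearMap.adjoint T ∘ₗ T) (b i) = lam i • b i :=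
    hsym.apply_eigenvectorBasis hfin i
  have hnsq (x : EuclideanSpace ℝ (Fin N)) : ‖x‖ ^ 2 = ∑ i, x i ^ 2 := by
    simp [EuclideanSpace.norm_sq_eq]
  have hTnsq (x : EuclideanSpace ℝ (Fin N)) :
      ‖T x‖ ^ 2 = inner ℝ x ((LinearMap.adjoint T ∘ₗ T) x) := by
    rw [LinearMap.comp_apply, LinearMap.adjoint_inner_right, real_inner_self_eq_norm_sq]
  have hbn (i : Fin N) : ‖b i‖ = 1 := b.orthonormal.1 i
  have hTb (i : Fin N) : ‖T (b i)‖ ^ 2 = lam i := by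
    rw [hTnsq, heig, real_inner_smul_right, real_inner_self_eq_norm_sq, hbn]; ring
  have hconst (i : Fin N) (hi : 1 ≤ lam i) (j k : Fin N) : b i j = b i k := by
    refine h.eq_of_sum_sq_le (x := (b i).ofLp) ?_ j k
    have h1 := hTb i
    rw [hnsq] at h1
    have h2 := hnsq (b i)
    rw [hbn] at h2
    simp only [hTx] at h1
    rw [h1, ← h2]
    simpa using hi
  have hlt : lam i₁ < 1 := by
    by_contra! hc
    have hc0 : 1 ≤ lam i₀ := hc.trans (hsym.eigenvalues_antitone hfin (by simp [i₀, i₁]))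
    have ho : inner ℝ (b i₀) (b i₁) = 0 := b.orthonormal.2 (by simp [i₀, i₁])
    rw [PiLp.inner_apply] at ho
    have e : ∑ i, inner ℝ (b i₀ i) (b i₁ i) = ∑ _i : Fin N, b i₀ i₀ * b i₁ i₀ := by
      refine Finset.sum_congr rfl fun i _ => ?_
      rw [hconst i₀ hc0 i i₀, hconst i₁ hc i i₀]
      simp [mul_comm]
    have hN0 : (N : ℝ) ≠ 0 := by positivity
    have hne (i : Fin N) (hi : 1 ≤ lam i) : b i i₀ ≠ 0 := by
      intro h0
      have h1 := hnsq (b i)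
      rw [hbn] at h1
      simp only [hconst i hi _ i₀] at h1
      simp [h0] at h1
    rw [e] at ho
    simp [hN0] at ho
    exact ho.elim (hne i₀ hc0) (hne i₁ hc)
  refine ⟨?_, fun z hz => ?_⟩
  · by_contra! hc
    nlinarith
  let one : EuclideanSpace ℝ (Fin N) := WithLp.toLp 2 fun _ => 1
  have hTone : T one = one := by
    ext i
    rw [hTx]
    simp [one, Matrix.mulVec, dotProduct, h.row_sum]
  have hSone : (LinearMap.adjoint T ∘ₗ T) one = one := by
    rw [hT, adjoint_comp_toEuclideanLin h.symm, ← hT, LinearMap.comp_apply, hTone, hTone]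
  have hbone (i : Fin N) (hi : i ≠ i₀) : inner ℝ (b i) one = 0 := by
    have h1 : lam i ≤ lam i₁ := by
      refine hsym.eigenvalues_antitone hfin ?_
      have : i.val ≠ 0 := fun h0 => hi (Fin.ext h0)
      rw [Fin.le_def]
      simp only [i₁]
      omega
    have h2 := hsym (b i) one
    rw [heig, hSone, real_inner_smul_left] at h2
    have h3 : (lam i - 1) * inner ℝ (b i) one = 0 := by linarith
    exact (mul_eq_zero.1 h3).resolve_left (by linarith)
  set x : EuclideanSpace ℝ (Fin N) := WithLp.toLp 2 z with hx
  have hxone : inner ℝ one x = 0 := by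
    rw [PiLp.inner_apply]
    simpa [one, hx] using hz
  have hb0 : inner ℝ (b i₀) x = 0 := by
    have h1 := b.sum_inner_mul_inner one x
    rw [hxone, Finset.sum_eq_single i₀ (fun i _ hi => by
      rw [real_inner_comm, hbone i hi, zero_mul]) (by simp)] at h1
    refine (mul_eq_zero.1 h1).resolve_left fun h0 => ?_
    have h2 := b.sum_inner_mul_inner one one
    rw [Finset.sum_eq_single i₀ (fun i _ hi => by
      rw [real_inner_comm, hbone i hi, zero_mul]) (by simp), h0, zero_mul,
      real_inner_self_eq_norm_sq, hnsq] at h2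
    have h3 : ∑ i, one i ^ 2 = N := by simp [one]
    have h4 : (0 : ℝ) < N := by positivity
    linarith
  have key : ‖T x‖ ^ 2 ≤ lam i₁ * ‖x‖ ^ 2 := by
    rw [hTnsq, ← real_inner_self_eq_norm_sq x, ← b.sum_inner_mul_inner x x,
      ← b.sum_inner_mul_inner x _, Finset.mul_sum]
    refine Finset.sum_le_sum fun i _ => ?_
    have h1 : inner ℝ (b i) ((LinearMap.adjoint T ∘ₗ T) x) = lam i * inner ℝ (b i) x := by
      rw [← hsym (b i) x, heig, real_inner_smul_left]
    rw [h1, real_inner_comm (b i) x]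
    by_cases hi : i = i₀
    · rw [hi, hb0]; simp
    · have h2 : lam i ≤ lam i₁ := by
        refine hsym.eigenvalues_antitone hfin ?_
        have : i.val ≠ 0 := fun h0 => hi (Fin.ext h0)
        rw [Fin.le_def]
        simp only [i₁]
        omega
      nlinarith [mul_self_nonneg (inner ℝ (b i) x)]
  rw [hnsq, hnsq] at key
  simp only [hTx] at key
  rw [hσ]
  exact key

theorem NetworkAssumption.isMixing_pow (h : NetworkAssumption 𝒢 W) (hN : 2 ≤ N) (t : ℕ) :
    IsMixing (W ^ t) (sigmaTwo W ^ t) := by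
  have hσ0 : 0 ≤ sigmaTwo W := (Matrix.toEuclideanLin W).singularValues_nonneg 1
  have hcontr := (h.contract_and_sigmaTwo_lt_one hN).2
  induction t with
  | zero =>
    refine ⟨fun i j => ?_, fun i j => ?_, fun i => ?_, by simp, fun z _ => ?_⟩
    · rw [pow_zero, Matrix.one_apply]; split_ifs <;> norm_num
    · simp only [pow_zero, Matrix.one_apply, eq_comm]
    · simp [Matrix.one_apply]
    · simp [Matrix.one_apply]
  | succ t ih =>
    have hsum (i : Fin N) (z : Fin N → ℝ) :
        ∑ j, (W ^ (t + 1)) i j * z j = (W *ᵥ (W ^ t *ᵥ z)) i := by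
      rw [Matrix.mulVec_mulVec, ← pow_succ']
      rfl
    refine ⟨fun i j => ?_, fun i j => ?_, fun i => ?_, by positivity, fun z hz => ?_⟩
    · rw [pow_succ', Matrix.mul_apply]
      exact Finset.sum_nonneg fun k _ => mul_nonneg (h.nonneg i k) (ih.nonneg k j)
    · have : (W ^ (t + 1))ᵀ = W ^ (t + 1) := by rw [Matrix.transpose_pow, h.symm]
      exact congrFun (congrFun this j) i
    · have h1 := hsum i fun _ => 1
      have h2 : (W ^ t *ᵥ fun _ => (1 : ℝ)) = fun _ => 1 := by
        funext k
        simpa [Matrix.mulVec, dotProduct] using ih.row_sum k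
      rw [h2] at h1
      simpa [Matrix.mulVec, dotProduct, h.row_sum] using h1
    · simp only [hsum]
      have h0 : ∑ i, (W ^ t *ᵥ z) i = 0 := by
        have e : ∑ i, (W ^ t *ᵥ z) i = ∑ i, z i := by
          simp only [Matrix.mulVec, dotProduct]
          rw [Finset.sum_comm]
          simp [← Finset.sum_mul, ih.col_sum]
        rw [e, hz]
      refine (hcontr _ h0).trans ?_
      have h1 := mul_le_mul_of_nonneg_left (ih.contract z hz) (sq_nonneg (sigmaTwo W))
      calc sigmaTwo W ^ 2 * ∑ i, (W ^ t *ᵥ z) i ^ 2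
          ≤ sigmaTwo W ^ 2 * ((sigmaTwo W ^ t) ^ 2 * ∑ i, z i ^ 2) := h1
        _ = _ := by ring

/-- For a single agent `W = 1` and `Lt W t = 0`, whereas a positive `α ≤ Φ / Lt` needs `Lt > 0`. -/
theorem NetworkAssumption.two_le (h : NetworkAssumption 𝒢 W) (hN : 0 < N) {t : ℕ}
    (hLt : 0 < Lt W t) : 2 ≤ N := by
  by_contra! hc
  obtain rfl : N = 1 := by omega
  have hW : W = 1 := by
    ext i j
    have := h.row_sum i
    simp only [Fin.sum_univ_one] at this
    obtain rfl : j = 0 := Subsingleton.elim _ _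
    obtain rfl : i = 0 := Subsingleton.elim _ _
    simpa using this
  rw [Lt, hW, one_pow, spectrum.one_eq, csInf_singleton] at hLt
  norm_num at hLt

/-- An eigenvalue below `-s` differs from 1, so its eigenvector has sum zero and the contraction
gives `|μ| ≤ s`. -/
theorem IsMixing.neg_le_of_mem_spectrum {P : Matrix (Fin N) (Fin N) ℝ} {s μ : ℝ}
    (hP : IsMixing P s) (hμ : μ ∈ spectrum ℝ P) : -s ≤ μ := by
  have h1 : Module.End.HasEigenvalue (Matrix.toLin' P) μ := by
    rw [Module.End.hasEigenvalue_iff_mem_spectrum, Matrix.spectrum_toLin']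
    exact hμ
  obtain ⟨v, hv⟩ := h1.exists_hasEigenvector
  have hv1 : P *ᵥ v = μ • v := by simpa [Matrix.toLin'_apply] using hv.apply_eq_smul
  have hv0 : v ≠ 0 := hv.2
  have hs := hP.factor_nonneg
  by_contra! hc
  have hsum : ∑ i, v i = 0 := by
    have h2 : ∑ i, (P *ᵥ v) i = ∑ i, v i := by
      simp only [Matrix.mulVec, dotProduct]
      rw [Finset.sum_comm]
      simp [← Finset.sum_mul, hP.col_sum]
    rw [hv1] at h2
    simp only [Pi.smul_apply, smul_eq_mul, ← Finset.mul_sum] at h2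
    have h3 : (μ - 1) * ∑ i, v i = 0 := by linarith
    exact (mul_eq_zero.1 h3).resolve_left (by linarith)
  have h2 := hP.contract v hsum
  have h3 : ∑ i, (∑ j, P i j * v j) ^ 2 = μ ^ 2 * ∑ i, v i ^ 2 := by
    have e (i : Fin N) : ∑ j, P i j * v j = μ * v i := congrFun hv1 i
    simp only [e, mul_pow, ← Finset.mul_sum]
  have h4 : 0 < ∑ i, v i ^ 2 := by
    obtain ⟨i, hi⟩ := Function.ne_iff.1 hv0
    have : 0 < v i ^ 2 := by have : v i ≠ 0 := hi; positivity
    exact this.trans_le (Finset.single_le_sum (f := fun i => v i ^ 2)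
      (fun _ _ => sq_nonneg _) (Finset.mem_univ i))
  rw [h3] at h2
  have h5 := le_of_mul_le_mul_right h2 h4
  nlinarith

theorem NetworkAssumption.Lt_le (h : NetworkAssumption 𝒢 W) (hN : 2 ≤ N) (t : ℕ) :
    Lt W t ≤ 1 + sigmaTwo W ^ t := by
  have hP := h.isMixing_pow hN t
  have h1 : (spectrum ℝ (W ^ t)).Nonempty := by
    refine ⟨1, ?_⟩
    rw [← Matrix.spectrum_toLin', ← Module.End.hasEigenvalue_iff_mem_spectrum]
    refine Module.End.hasEigenvalue_of_hasEigenvector (x := fun _ => 1) ⟨?_, fun h0 => ?_⟩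
    · rw [Module.End.mem_eigenspace_iff, Matrix.toLin'_apply, one_smul]
      funext i
      simpa [Matrix.mulVec, dotProduct] using hP.row_sum i
    · have := congrFun h0 ⟨0, by omega⟩
      simp at this
  have h2 : -(sigmaTwo W ^ t) ≤ sInf (spectrum ℝ (W ^ t)) :=
    le_csInf h1 fun μ hμ => hP.neg_le_of_mem_spectrum hμ
  rw [Lt]
  linarith

/-- The base is below 1, so the logarithm reverses the inequality. For `sigmaTwo W = 0` the
logarithmic condition is void and `1 ≤ t` suffices. -/
theorem NetworkAssumption.sigmaTwo_pow_le (h : NetworkAssumption 𝒢 W) (hN : 2 ≤ N) {t : ℕ}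
    (ht : 1 ≤ t) (hlog : Real.logb (sigmaTwo W) (1 / (2 * √(N : ℝ))) ≤ t) :
    sigmaTwo W ^ t ≤ 1 / (2 * √(N : ℝ)) := by
  have hσ0 : 0 ≤ sigmaTwo W := (Matrix.toEuclideanLin W).singularValues_nonneg 1
  have hσ1 := (h.contract_and_sigmaTwo_lt_one hN).1
  have hpos : 0 < 1 / (2 * √(N : ℝ)) := by
    have : 0 < √(N : ℝ) := Real.sqrt_pos.2 (by positivity)
    positivity
  rcases hσ0.eq_or_lt with h0 | h0
  · rw [← h0, zero_pow (by omega)]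
    exact hpos.le
  · have h1 := (Real.logb_le_iff_le_rpow_of_base_lt_one h0 hσ1 hpos).1 hlog
    rwa [Real.rpow_natCast] at h1

end Network

/-! ### Numerical consequences of the step-size conditions -/

namespace Params

variable {p : Params}

/-- The assumptions on the scalar parameters from which the numerical estimates follow. -/
structure Admissible (p : Params) : Prop where
  step : p.StepSize
  A_pos : 0 < p.A
  δ₁_le : p.δ₁ ≤ 1 / (5 * √(p.r : ℝ)) * p.δ₂
  one_le_Φ : 1 ≤ p.Φ
  Φ_le : p.Φ ≤ 2
  Lt_le : p.Lt ≤ 34 / 25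
  σ₂_nonneg : 0 ≤ p.σ₂
  σ₂_pow_lt : p.σ₂ ^ p.t < 1
  e₀_nonneg : 0 ≤ p.e₀

/-- A quotient by zero is zero and `1 / x` is negative for negative `x`, so a positive `β` below the
quotient forces its denominator to be positive. The positivity of `M`, `Lt`, `δ₁` and `1 - ρ` is
extracted from the step-size conditions in a similar way. -/
theorem StepSize.LG_pos (h : p.StepSize) : 0 < p.LG := by
  have h1 : p.β ≤ 1 / (9 * p.LG) := h.β_le.trans ((min_le_right _ _).trans (min_le_left _ _))
  have h2 := one_div_pos.1 (h.β_pos.trans_le h1)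
  linarith

theorem StepSize.M_pos (h : p.StepSize) : 0 < p.M := by
  have h1 : p.α ≤ 1 / p.M := h.α_le.trans ((min_le_right _ _).trans (min_le_left _ _))
  exact one_div_pos.1 (h.α_pos.trans_le h1)

theorem StepSize.M_mul_le (h : p.StepSize) : p.M * p.α ≤ 1 := by
  have h1 : p.α ≤ 1 / p.M := h.α_le.trans ((min_le_right _ _).trans (min_le_left _ _))
  rw [le_div_iff₀ h.M_pos] at h1
  linarith

theorem StepSize.α_le_one (h : p.StepSize) : p.α ≤ 1 := h.α_le.trans (min_le_left _ _)

theorem StepSize.Lt_pos (h : p.StepSize) (hΦ : 0 < p.Φ) : 0 < p.Lt := by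
  have h1 : p.α ≤ p.Φ / p.Lt := h.α_le.trans ((min_le_right _ _).trans (min_le_right _ _))
  by_contra! hc
  have := div_nonpos_of_nonneg_of_nonpos hΦ.le hc
  linarith [h.α_pos]

theorem StepSize.δ₁_pos (h : p.StepSize) (hA : 0 < p.A) : 0 < p.δ₁ := by
  have h1 : p.β ≤ p.α * p.δ₁ / (5 * (10 * p.A + p.LG)) :=
    h.β_le.trans ((min_le_left _ _).trans (min_le_right _ _))
  have h2 := h.LG_pos
  have h3 := h.β_pos.trans_le h1
  have h4 : 0 < p.α * p.δ₁ := by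
    by_contra! hc
    have := div_nonpos_of_nonpos_of_nonneg hc (by positivity : 0 ≤ 5 * (10 * p.A + p.LG))
    linarith
  exact pos_of_mul_pos_right h4 h.α_pos.le

theorem StepSize.β_mul_le (h : p.StepSize) (hA : 0 < p.A) :
    p.β * (10 * p.A + p.LG) ≤ p.α * p.δ₁ / 5 := by
  have h1 : p.β ≤ p.α * p.δ₁ / (5 * (10 * p.A + p.LG)) :=
    h.β_le.trans ((min_le_left _ _).trans (min_le_right _ _))
  have h2 := h.LG_pos
  rw [le_div_iff₀ (by positivity)] at h1
  linarith

namespace Admissible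

/-- For `r = 0` the convention `1 / 0 = 0` makes the upper bound for `δ₁` vanish. -/
theorem r_pos (h : p.Admissible) : 0 < p.r := by
  by_contra hc
  have h0 : p.r = 0 := by omega
  have h1 := h.δ₁_le
  rw [h0] at h1
  simp at h1
  linarith [h.step.δ₁_pos h.A_pos]

theorem ρ_lt_one (h : p.Admissible) : p.ρ < 1 := by
  have h1 : p.β ≤ (1 - p.ρ) / (10 * p.A + p.LG) * p.δ₁ :=
    h.step.β_le.trans ((min_le_left _ _).trans (min_le_left _ _))
  have h2 := h.step.LG_pos
  have h3 := h.A_pos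
  have h4 := h.step.δ₁_pos h3
  have h5 := h.step.β_pos.trans_le h1
  by_contra! hc
  have : (1 - p.ρ) / (10 * p.A + p.LG) * p.δ₁ ≤ 0 :=
    mul_nonpos_of_nonpos_of_nonneg
      (div_nonpos_of_nonpos_of_nonneg (by linarith) (by positivity)) h4.le
  linarith

theorem ρ_nonneg : 0 ≤ p.ρ := Real.sqrt_nonneg _

/-- Since `Φ ≤ 2`, the radicand in `ρ` is at least `(1 - α * Lt) ^ 2`. -/
theorem one_sub_ρ_le (h : p.Admissible) : 1 - p.ρ ≤ 34 / 25 * p.α := by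
  have hα := h.step.α_pos
  have hL : 0 < p.Lt := h.step.Lt_pos (zero_lt_one.trans_le h.one_le_Φ)
  have h1 : 1 - p.α * p.Lt ≤ p.ρ := by
    apply Real.le_sqrt_of_sq_le
    nlinarith [mul_nonneg (mul_pos hα hL).le (sub_nonneg.2 h.Φ_le)]
  have := mul_le_mul_of_nonneg_left h.Lt_le hα.le
  linarith

theorem two_le_Γ₀ (h : p.Admissible) : 2 ≤ p.Γ₀ := by
  have h1 := h.ρ_lt_one
  have h2 : 0 < (1 - p.ρ) ^ 2 := by have := sub_pos.2 h1; positivity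
  rw [Γ₀, le_div_iff₀ h2]
  nlinarith [ρ_nonneg (p := p)]

/-- (34/25)² ≤ 2. This allows a factor `Γ₀` to be traded for `α⁻²`. -/
theorem one_le_Γ₀_mul (h : p.Admissible) : 1 ≤ p.Γ₀ * p.α ^ 2 := by
  have h1 := h.ρ_lt_one
  have h2 : 0 < (1 - p.ρ) ^ 2 := by have := sub_pos.2 h1; positivity
  rw [Γ₀, div_mul_eq_mul_div, le_div_iff₀ h2]
  have h3 := pow_le_pow_left₀ (sub_pos.2 h1).le h.one_sub_ρ_le 2
  nlinarith [sq_nonneg p.α]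

theorem D₄_nonneg (h : p.Admissible) : 0 ≤ p.D₄ := by
  have := h.step.LG_pos
  unfold D₄
  positivity

theorem Γ₂_nonneg : 0 ≤ p.Γ₂ := by unfold Γ₂; positivity

theorem le_D₂ (h : p.Admissible) : 3 * p.LG + p.D₄ ≤ p.D₂ := by
  have h1 := h.step.LG_pos
  have h2 := h.A_pos
  have h3 := h.step.α_pos
  have h4 : 0 ≤ p.Ctil := by unfold Ctil; positivity
  have : 0 ≤ 2 * p.α * p.A + 13 * p.LG * p.Ctil * p.α ^ 2 := by positivity
  unfold D₂
  linarith

/-- The parts of `C₁` from which the three smallness conditions below are drawn. -/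
theorem le_C₁ (h : p.Admissible) : (3 * p.LG + 2 * p.D₄) * p.Γ₀ + 5 * p.LG ≤ p.C₁ := by
  have h0 := h.two_le_Γ₀
  have h1 := mul_le_mul_of_nonneg_right h.le_D₂ (by linarith : 0 ≤ p.Γ₀)
  have h2 : 5 * p.LG ≤ p.D₁ := by
    have := h.step.LG_pos
    have := h.step.M_pos
    have := h.A_pos
    have : 0 ≤ p.δ₁ ^ 2 * p.LG + 2 * p.M * p.A := by positivity
    unfold D₁
    linarith
  unfold C₁
  linarith

theorem β_mul_C₁_le (h : p.Admissible) : 8 * (p.β * p.C₁) ≤ 1 := by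
  have h1 : p.β ≤ 1 / (4 * (p.α * p.δ₁ * p.LG * (16 * p.Γ₀ + p.Γ₂) + 2 * p.C₁)) :=
    h.step.β_le.trans ((min_le_right _ _).trans (min_le_right _ _))
  have h2 := one_div_pos.1 (h.step.β_pos.trans_le h1)
  rw [le_div_iff₀ h2] at h1
  have h3 : 0 ≤ p.α * p.δ₁ * p.LG * (16 * p.Γ₀ + p.Γ₂) := by
    have := h.step.α_pos
    have := h.step.δ₁_pos h.A_pos
    have := h.step.LG_pos
    have := h.two_le_Γ₀
    have := Γ₂_nonneg (p := p)
    positivity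
  have h4 := mul_nonneg h.step.β_pos.le h3
  linarith

/-- `Γ₀ ≥ 2` gives `C₁ ≥ 11 * LG`, and 8 · 11 = 88. -/
theorem LG_mul_β_le (h : p.Admissible) : 88 * (p.LG * p.β) ≤ 1 := by
  have h1 := mul_le_mul_of_nonneg_left h.le_C₁ h.step.β_pos.le
  have h2 := h.β_mul_C₁_le
  have h3 : p.LG * 2 ≤ p.LG * p.Γ₀ := mul_le_mul_of_nonneg_left h.two_le_Γ₀ h.step.LG_pos.le
  have h4 : 0 ≤ p.D₄ * p.Γ₀ := mul_nonneg h.D₄_nonneg (by linarith [h.two_le_Γ₀])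
  have h5 := mul_le_mul_of_nonneg_left h3 h.step.β_pos.le
  have h6 := mul_nonneg h.step.β_pos.le h4
  linarith

theorem LG_mul_β_le_sq (h : p.Admissible) : 24 * (p.LG * p.β) ≤ p.α ^ 2 := by
  have h1 := mul_le_mul_of_nonneg_left h.le_C₁ h.step.β_pos.le
  have h2 := h.β_mul_C₁_le
  have h3 := mul_pos h.step.LG_pos h.step.β_pos
  have h4 : 0 ≤ p.β * (p.D₄ * p.Γ₀) :=
    mul_nonneg h.step.β_pos.le (mul_nonneg h.D₄_nonneg (by linarith [h.two_le_Γ₀]))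
  have h5 : 24 * (p.LG * p.β) * p.Γ₀ ≤ 1 := by linarith
  have h6 := mul_le_mul_of_nonneg_left h.one_le_Γ₀_mul (by linarith : 0 ≤ 24 * (p.LG * p.β))
  have h7 := mul_le_mul_of_nonneg_right h5 (sq_nonneg p.α)
  linarith

/-- `D₄` contains `δ₁ ^ 2 / β ^ 2`, so the upper bound on `β` through `C₁` is at the same time a
lower bound on `β` in terms of `δ₁`. -/
theorem δ₁_sq_le (h : p.Admissible) : 64 * p.δ₁ ^ 2 ≤ p.LG * p.β * p.α ^ 2 := by
  have h1 := mul_le_mul_of_nonneg_left h.le_C₁ h.step.β_pos.le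
  have h2 := h.β_mul_C₁_le
  have hLG := h.step.LG_pos
  have hβ := h.step.β_pos
  have h3 := mul_pos hLG hβ
  have hΓ := h.two_le_Γ₀
  have h4 : 0 ≤ p.β * (p.LG * p.Γ₀) := by positivity
  have h5 : 16 * (p.β * p.D₄) * p.Γ₀ ≤ 1 := by linarith
  have h6 : p.LG * p.β * (p.β * p.D₄) = 4 * p.r * p.δ₁ ^ 2 := by
    unfold D₄
    field_simp
  have hr : (1 : ℝ) ≤ p.r := by exact_mod_cast h.r_pos
  have h7 : 64 * p.δ₁ ^ 2 ≤ p.LG * p.β * (16 * (p.β * p.D₄)) := by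
    have := mul_le_mul_of_nonneg_right hr (sq_nonneg p.δ₁)
    linarith
  have h8 : 16 * (p.β * p.D₄) ≤ p.α ^ 2 := by
    have h9 : 0 ≤ 16 * (p.β * p.D₄) := mul_nonneg (by norm_num) (mul_nonneg hβ.le h.D₄_nonneg)
    have h10 := mul_le_mul_of_nonneg_left h.one_le_Γ₀_mul h9
    have h11 := mul_le_mul_of_nonneg_right h5 (sq_nonneg p.α)
    linarith
  exact h7.trans (mul_le_mul_of_nonneg_left h8 h3.le)

/-- The lower bound on `β` just obtained is compared with the upper bound `LG * β ≤ α * δ₁ / 5` from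
`βbar`. -/
theorem δ₁_le_α (h : p.Admissible) : 320 * p.δ₁ ≤ p.α := by
  have h1 := h.δ₁_sq_le
  have h2 := h.step.β_mul_le h.A_pos
  have h3 := mul_pos h.step.β_pos h.A_pos
  have hα := h.step.α_pos
  have hδ := h.step.δ₁_pos h.A_pos
  have h4 : p.LG * p.β ≤ p.α * p.δ₁ / 5 := by linarith
  have h5 := mul_le_mul_of_nonneg_right h4 (sq_nonneg p.α)
  have h6 : p.α ^ 2 ≤ 1 := pow_le_one₀ hα.le h.step.α_le_one
  have h7 := mul_le_mul_of_nonneg_left h6 (mul_pos hα hδ).le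
  have h8 : p.δ₁ * (320 * p.δ₁) ≤ p.δ₁ * p.α := by linarith
  exact le_of_mul_le_mul_left h8 hδ

theorem two_mul_e₀_le_Γ₁ (h : p.Admissible) : 2 * p.e₀ ≤ p.Γ₁ := by
  have h1 := h.ρ_lt_one
  have h2 := ρ_nonneg (p := p)
  have h3 : 0 < 1 - p.ρ ^ 2 := by nlinarith
  have h4 : 2 ≤ 2 / (1 - p.ρ ^ 2) := by
    rw [le_div_iff₀ h3]
    nlinarith
  exact mul_le_mul_of_nonneg_right h4 h.e₀_nonneg

theorem Γ₁_nonneg (h : p.Admissible) : 0 ≤ p.Γ₁ := by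
  linarith [h.two_mul_e₀_le_Γ₁, h.e₀_nonneg]

theorem le_Γ₃ (h : p.Admissible) {y : ℝ} (hy : 0 ≤ y) : 2 * (1 / (p.N : ℝ) * y) ≤ p.Γ₃ y := by
  have h1 : p.σ₂ ^ (2 * p.t) < 1 := by
    rw [mul_comm, pow_mul]
    exact pow_lt_one₀ (pow_nonneg h.σ₂_nonneg _) h.σ₂_pow_lt two_ne_zero
  have h0 : 0 ≤ p.σ₂ ^ (2 * p.t) := pow_nonneg h.σ₂_nonneg _
  have h2 : 2 ≤ 2 / (1 - p.σ₂ ^ (2 * p.t)) := by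
    rw [le_div_iff₀ (by linarith)]
    linarith
  rw [Γ₃, mul_assoc]
  exact mul_le_mul_of_nonneg_right h2 (by positivity)

theorem le_C₀ (h : p.Admissible) : 6 * p.LG * p.e₀ ≤ p.C₀ := by
  have h1 := h.D₄_nonneg
  have h2 := h.two_le_Γ₀
  have h3 : 0 ≤ p.D₄ * p.Γ₀ * p.α ^ 2 * p.δ₁ ^ 2 / 25 := by positivity
  have h4 : 3 * p.LG ≤ p.D₂ + p.D₄ := by linarith [h.le_D₂]
  have h5 := mul_le_mul h.two_mul_e₀_le_Γ₁ h4 (by linarith [h.step.LG_pos]) h.Γ₁_nonneg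
  unfold C₀
  linarith

theorem le_Dtil₃ (h : p.Admissible) : 44 * p.β ≤ p.Dtil₃ := by
  have h1 := h.step.LG_pos
  have h2 := h.step.β_pos
  have h3 : 44 * p.β ≤ p.D₃ := by
    rw [D₃, le_div_iff₀ (by positivity)]
    have := h.LG_mul_β_le
    have : 0 ≤ 4 * p.LG ^ 2 * p.β ^ 2 := by positivity
    linarith
  unfold Dtil₃
  linarith

theorem sixteen_le_κ (h : p.Admissible) : 16 ≤ p.κ := by
  have := h.two_le_Γ₀
  have : 0 ≤ p.Γ₀ * p.α ^ 2 * p.δ₁ ^ 2 := by positivity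
  unfold κ
  linarith

/-- The constant in front of the accumulated variances. -/
theorem noise_nonneg (h : p.Admissible) : 0 ≤ 2 * p.β * p.Γ₂ + p.Dtil₃ := by
  have h1 := h.step.β_pos
  have h2 := h.le_Dtil₃
  have h3 := mul_nonneg (mul_nonneg zero_le_two h1.le) (Γ₂_nonneg (p := p))
  linarith

/-- Term by term: `C₀` dominates the consensus part of the initial potential, `β / 2 * Γ₃` the
tracking part, `Dtil₃ ≥ 44 * β` the noise coefficient, and `κ ≥ 16` the overall factor. -/
theorem potential_le (h : p.Admissible) (hN : 0 < p.N) {F y S : ℝ} (hF : 0 ≤ F) (hy : 0 ≤ y)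
    (hS : 0 ≤ S) :
    16 * (F + 3 * p.LG * p.α * (1 / (p.N : ℝ) * p.e₀) + 3 / 10 * p.β * (1 / (p.N : ℝ) * y)
        + 14 * p.β * S)
      ≤ p.κ * (F + p.Γtil₃ y + (2 * p.β * p.Γ₂ + p.Dtil₃) * S) + p.Γtil₁ := by
  have hLG := h.step.LG_pos
  have hβ := h.step.β_pos
  have hα := h.step.α_pos
  have he := h.e₀_nonneg
  have hΓ₂ := Γ₂_nonneg (p := p)
  have hN1 : 1 / (p.N : ℝ) ≤ 1 := by
    rw [div_le_one (by positivity)]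
    exact_mod_cast hN
  have h1 : 3 * p.LG * p.α * (1 / (p.N : ℝ) * p.e₀) ≤ p.C₀ := by
    have h2 : p.α * (1 / (p.N : ℝ) * p.e₀) ≤ 1 * (1 * p.e₀) := by
      gcongr
      exact h.step.α_le_one
    have h3 := mul_le_mul_of_nonneg_left h2 (by positivity : 0 ≤ 3 * p.LG)
    have h4 := h.le_C₀
    have : 0 ≤ p.LG * p.e₀ := by positivity
    linarith
  have h2 : 3 / 10 * p.β * (1 / (p.N : ℝ) * y) ≤ p.β / 2 * p.Γ₃ y := by
    have h3 := mul_le_mul_of_nonneg_left (h.le_Γ₃ hy) (half_pos hβ).le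
    have : 0 ≤ p.β * (1 / (p.N : ℝ) * y) := by positivity
    linarith
  have h3 : p.C₀ + p.β / 2 * p.Γ₃ y ≤ p.Γtil₃ y := by
    have h4 : 0 ≤ p.β / 2 * (16 * p.α ^ 2 * p.LG ^ 2 * p.Γ₂ * p.Γ₁) := by
      have := h.Γ₁_nonneg
      positivity
    unfold Γtil₃
    linarith
  have h4 : 14 * p.β * S ≤ (2 * p.β * p.Γ₂ + p.Dtil₃) * S := by
    refine mul_le_mul_of_nonneg_right ?_ hS
    have := h.le_Dtil₃
    have : 0 ≤ 2 * p.β * p.Γ₂ := by positivity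
    linarith
  have h5 : 0 ≤ p.Γtil₁ := by
    have := h.Γ₁_nonneg
    unfold Γtil₁
    positivity
  have h6 : 0 ≤ 3 * p.LG * p.α * (1 / (p.N : ℝ) * p.e₀) := by positivity
  have h7 : 0 ≤ 3 / 10 * p.β * (1 / (p.N : ℝ) * y) := by positivity
  have h8 : 0 ≤ 14 * p.β * S := by positivity
  have h9 := mul_le_mul_of_nonneg_right h.sixteen_le_κ
    (by linarith : 0 ≤ F + p.Γtil₃ y + (2 * p.β * p.Γ₂ + p.Dtil₃) * S)
  linarith

end Admissible

end Params

/-! ### Pathwise analysis of the algorithm -/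

section Trajectory

variable {n r N : ℕ} {Ξ : Fin N → Type*}

/-- The standing assumptions on the problem, the network, the constants and the initial point. -/
structure Setting (D : Data n r N Ξ)
    (iam : (Fin N → Matrix (Fin n) (Fin r) ℝ) → Matrix (Fin n) (Fin r) ℝ)
    (p : Params) (L Ln : ℝ) : Prop where
  hN : 0 < N
  iam_spec : ∀ Z, (∀ i, Z i ∈ stiefel n r) → IsIAM Z (iam Z)
  mixing : IsMixing (D.W ^ D.t) (sigmaTwo D.W ^ D.t)
  s_le : sigmaTwo D.W ^ D.t ≤ 1 / (2 * √(N : ℝ))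
  s_sq : (sigmaTwo D.W ^ D.t) ^ 2 ≤ 1 / 8
  smooth : ∀ i, LSmooth L (D.f i)
  grad_bound : ∀ i, ∀ X ∈ stiefel n r, ‖euclGrad (D.f i) X‖ ≤ p.A
  spec_bound : ∀ i, ∀ X ∈ stiefel n r, specNorm (euclGrad (D.f i) X) ≤ Ln
  Ln_nonneg : 0 ≤ Ln
  retraction : ∀ X ∈ stiefel n r, ∀ v ∈ tangentSpace X,
    ‖polarRetraction X v - (X + v)‖ ≤ p.M * ‖v‖ ^ 2
  admissible : p.Admissible
  N_eq : p.N = N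
  α_eq : p.α = D.α
  β_eq : p.β = D.β
  LG_eq : p.LG = L + 2 * Ln
  e₀_eq : p.e₀ = ∑ i, ‖D.X₀ i - iam D.X₀‖ ^ 2
  X₀_mem : ∀ i, D.X₀ i ∈ stiefel n r
  X₀_rms_le : rms (fun i => D.X₀ i - iam D.X₀) ≤ p.δ₁
  X₀_max_le : ∀ i, ‖D.X₀ i - iam D.X₀‖ ≤ 1 / 6

variable {D : Data n r N Ξ}
  {iam : (Fin N → Matrix (Fin n) (Fin r) ℝ) → Matrix (Fin n) (Fin r) ℝ}
  {p : Params} {L Ln : ℝ}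

/-- The gradient estimates at the current points of the agents. -/
noncomputable def Data.estimate (D : Data n r N Ξ) (Nk : ℕ → ℕ) (s : (i : Fin N) → ℕ → ℕ → Ξ i)
    (k : ℕ) (i : Fin N) : Matrix (Fin n) (Fin r) ℝ :=
  D.batchGrad Nk s k i ((D.iter Nk s k).1 i)

/-- The root mean square error of the gradient estimates. -/
noncomputable def Data.noise (D : Data n r N Ξ) (Nk : ℕ → ℕ) (s : (i : Fin N) → ℕ → ℕ → Ξ i)
    (k : ℕ) : ℝ :=
  rms fun i => D.estimate Nk s k i - riemGrad (D.f i) ((D.iter Nk s k).1 i)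

/-- The root mean square distance of the agents to the induced arithmetic mean. -/
noncomputable def Data.consErr (D : Data n r N Ξ)
    (iam : (Fin N → Matrix (Fin n) (Fin r) ℝ) → Matrix (Fin n) (Fin r) ℝ)
    (Nk : ℕ → ℕ) (s : (i : Fin N) → ℕ → ℕ → Ξ i) (k : ℕ) : ℝ :=
  rms fun i => (D.iter Nk s k).1 i - iam (D.iter Nk s k).1

variable {Nk : ℕ → ℕ} {s : (i : Fin N) → ℕ → ℕ → Ξ i}

theorem Data.iter_succ_fst (k : ℕ) : (D.iter Nk s (k + 1)).1
    = stepX (D.W ^ D.t) D.α D.β (D.iter Nk s k).1 (D.iter Nk s k).2 := rfl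

theorem Data.iter_succ_snd (k : ℕ) (i : Fin N) : (D.iter Nk s (k + 1)).2 i
    = mix (D.W ^ D.t) (D.iter Nk s k).2 i + D.estimate Nk s (k + 1) i - D.estimate Nk s k i := rfl

theorem Data.iter_mem (h : ∀ i, D.X₀ i ∈ stiefel n r) (k : ℕ) (i : Fin N) :
    (D.iter Nk s k).1 i ∈ stiefel n r := by
  induction k generalizing i with
  | zero => exact h i
  | succ k ih => exact stepX_mem ih i

theorem norm_average_le {E : Type*} [NormedAddCommGroup E] [NormedSpace ℝ E] {m : ℕ} {g : ℕ → E}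
    {A : ℝ} (hA : 0 ≤ A) (h : ∀ j, ‖g j‖ ≤ A) :
    ‖(1 / (m : ℝ)) • ∑ j ∈ Finset.range m, g j‖ ≤ A := by
  rcases Nat.eq_zero_or_pos m with rfl | hm
  · simpa using hA
  have hm' : (0 : ℝ) < m := by positivity
  rw [norm_smul, Real.norm_of_nonneg (by positivity), one_div_mul_eq_div, div_le_iff₀ hm']
  refine (norm_sum_le _ _).trans ((Finset.sum_le_sum fun j _ => h j).trans_eq ?_)
  simp [mul_comm]

namespace Setting

/-- The oracle outputs for the given samples are bounded on the Stiefel manifold. -/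
def BoundedSamples (D : Data n r N Ξ) (A : ℝ) (s : (i : Fin N) → ℕ → ℕ → Ξ i) : Prop :=
  ∀ i k j, ∀ X ∈ stiefel n r, ‖D.G i X (s i k j)‖ ≤ A

theorem norm_estimate_le (h : Setting D iam p L Ln) (hs : BoundedSamples D p.A s) (k : ℕ)
    (i : Fin N) : ‖D.estimate Nk s k i‖ ≤ p.A :=
  norm_average_le h.admissible.A_pos.le fun j => hs i k j _ (D.iter_mem h.X₀_mem k i)

/-- The gradient tracking invariant: mixing preserves averages, so the increments of the trackers
telescope to the current estimates. -/
theorem mean_iter_snd (h : Setting D iam p L Ln) (k : ℕ) :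
    mean (D.iter Nk s k).2 = mean (D.estimate Nk s k) := by
  induction k with
  | zero => rfl
  | succ k ih =>
    have e : (D.iter Nk s (k + 1)).2 = fun i => mix (D.W ^ D.t) (D.iter Nk s k).2 i
        + D.estimate Nk s (k + 1) i - D.estimate Nk s k i := rfl
    have e1 := h.mixing.mean_mix (D.iter Nk s k).2
    rw [e, mean_sub, mean_add]
    rw [show mean (fun i => mix (D.W ^ D.t) (D.iter Nk s k).2 i) = _ from e1, ih]
    exact add_sub_cancel_left _ _

theorem norm_mean_iter_snd_le (h : Setting D iam p L Ln) (hs : BoundedSamples D p.A s) (k : ℕ) :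
    ‖mean (D.iter Nk s k).2‖ ≤ p.A := by
  rw [h.mean_iter_snd]
  exact (norm_mean_le h.hN _).trans
    (rms_le_of_forall_le h.hN h.admissible.A_pos.le fun i => h.norm_estimate_le hs k i)

/-- The bound reproduces itself: A + (1/2) · 6A from mixing and A from each of two estimates make
6A. -/
theorem norm_iter_snd_le (h : Setting D iam p L Ln) (hs : BoundedSamples D p.A s) (k : ℕ)
    (i : Fin N) : ‖(D.iter Nk s k).2 i‖ ≤ 6 * p.A := by
  have hA := h.admissible.A_pos
  induction k generalizing i with
  | zero => exact (h.norm_estimate_le (Nk := Nk) hs 0 i).trans (by linarith)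
  | succ k ih =>
    have h1 := h.mixing.norm_mix_le_add h.hN h.s_le (D.iter Nk s k).2 i
    have h2 := rms_le_of_forall_le h.hN (by linarith : 0 ≤ 6 * p.A) ih
    have h3 := h.norm_mean_iter_snd_le (Nk := Nk) hs k
    have h4 := h.norm_estimate_le (Nk := Nk) hs k i
    have h5 := h.norm_estimate_le (Nk := Nk) hs (k + 1) i
    rw [D.iter_succ_snd]
    refine (norm_sub_le _ _).trans ?_
    have h6 := norm_add_le (mix (D.W ^ D.t) (D.iter Nk s k).2 i) (D.estimate Nk s (k + 1) i)
    linarith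

theorem β_mul_le (h : Setting D iam p L Ln) {y : ℝ} (hy : y ≤ 6 * p.A) :
    p.β * y ≤ 3 / 25 * p.α * p.δ₁ := by
  have h1 := h.admissible.step.β_mul_le h.admissible.A_pos
  have h2 := mul_pos h.admissible.step.β_pos h.admissible.step.LG_pos
  have h3 := mul_le_mul_of_nonneg_left hy h.admissible.step.β_pos.le
  linarith

theorem isCriticalMean (h : Setting D iam p L Ln) (k : ℕ) :
    IsCriticalMean (D.iter Nk s k).1 (iam (D.iter Nk s k).1) := by
  have hm := D.iter_mem (Nk := Nk) (s := s) h.X₀_mem k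
  have hi := h.iam_spec _ hm
  exact ⟨hm, hi.1, hi.tangentProj_mean h.hN h.retraction⟩

theorem δ₁_le (h : Setting D iam p L Ln) : p.δ₁ ≤ 1 / 320 := by
  have := h.admissible.δ₁_le_α
  have := h.admissible.step.α_le_one
  linarith

theorem stepSetting_of_le (h : Setting D iam p L Ln) {k : ℕ} (h1 : D.consErr iam Nk s k ≤ p.δ₁)
    (h2 : ∀ i, ‖(D.iter Nk s k).1 i - iam (D.iter Nk s k).1‖ ≤ 1 / 6) :
    StepSetting (D.W ^ D.t) (sigmaTwo D.W ^ D.t) D.α D.β p.M (D.iter Nk s k).1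
      (iam (D.iter Nk s k).1) where
  hN := h.hN
  mixing := h.mixing
  s_le := h.s_le
  s_sq := h.s_sq
  α_pos := h.α_eq ▸ h.admissible.step.α_pos
  α_le := h.α_eq ▸ h.admissible.step.α_le_one
  β_pos := h.β_eq ▸ h.admissible.step.β_pos
  M_nonneg := h.admissible.step.M_pos.le
  M_mul_le := h.α_eq ▸ h.admissible.step.M_mul_le
  retraction := h.retraction
  critical := h.isCriticalMean k
  rms_le := h1.trans h.δ₁_le
  max_le := h2

theorem consErr_succ_le_rms (h : Setting D iam p L Ln) (k : ℕ) :
    D.consErr iam Nk s (k + 1)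
      ≤ rms fun i => (D.iter Nk s (k + 1)).1 i - iam (D.iter Nk s k).1 :=
  (h.iam_spec _ (D.iter_mem h.X₀_mem (k + 1))).rms_le (h.isCriticalMean k).mean_mem

/-- The iterates stay in the local region. -/
theorem region (h : Setting D iam p L Ln) (hs : BoundedSamples D p.A s) (k : ℕ) :
    D.consErr iam Nk s k ≤ p.δ₁ ∧
      ∀ i, ‖(D.iter Nk s k).1 i - iam (D.iter Nk s k).1‖ ≤ 1 / 6 := by
  induction k with
  | zero => exact ⟨h.X₀_rms_le, h.X₀_max_le⟩
  | succ k ih =>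
    have hst := h.stepSetting_of_le ih.1 ih.2
    have hα := h.admissible.step.α_pos
    have hα1 := h.admissible.step.α_le_one
    have hδ := h.δ₁_le
    have hδ0 := h.admissible.step.δ₁_pos h.admissible.A_pos
    have hαδ := mul_pos hα hδ0
    have hαδ' := mul_le_mul_of_nonneg_left hδ hα.le
    have hY := h.norm_iter_snd_le (Nk := Nk) hs k
    have hV := h.β_mul_le (rms_le_of_forall_le h.hN (by linarith [h.admissible.A_pos]) hY)
    have he : rms (fun i => (D.iter Nk s k).1 i - iam (D.iter Nk s k).1) ≤ p.δ₁ := ih.1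
    have hcons : D.consErr iam Nk s (k + 1) ≤ p.δ₁ := by
      -- The contraction removes (3/10) α δ₁, and the trackers restore at most (3/25) α δ₁.
      have h1 := (h.consErr_succ_le_rms (Nk := Nk) (s := s) k).trans
        (hst.rms_stepX_sub_le (D.iter Nk s k).2)
      rw [← h.α_eq, ← h.β_eq] at h1
      have h2 := mul_le_mul_of_nonneg_left he (by linarith : 0 ≤ 1 - 3 / 10 * p.α)
      linarith
    refine ⟨hcons, fun i => ?_⟩
    have h1 := hst.norm_stepX_sub_le (D.iter Nk s k).2 i
    -- The change of reference mean costs at most twice the displacement of the average; this fits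
    -- into the gap between 1/18 and 1/6 left by the single-agent estimate.
    have h2 := (h.isCriticalMean (Nk := Nk) (s := s) k).norm_sub_le h.hN
      (h.isCriticalMean (k + 1)) (he.trans (by linarith))
      (show D.consErr iam Nk s (k + 1) ≤ 1 by linarith)
    have h3 := hst.norm_mean_stepX_sub_le (D.iter Nk s k).2
    rw [norm_sub_rev (mean (D.iter Nk s k).1)] at h2
    rw [← h.α_eq, ← h.β_eq, h.α_eq, h.β_eq, ← D.iter_succ_fst, ← h.α_eq, ← h.β_eq] at h3
    rw [← D.iter_succ_fst, ← h.α_eq, ← h.β_eq] at h1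
    have h4 := norm_add_le ((D.iter Nk s (k + 1)).1 i - iam (D.iter Nk s k).1)
      (iam (D.iter Nk s k).1 - iam (D.iter Nk s (k + 1)).1)
    rw [sub_add_sub_cancel] at h4
    have h5 := h.β_mul_le (hY i)
    have h6 := mul_le_mul_of_nonneg_left he hα.le
    linarith

theorem stepSetting (h : Setting D iam p L Ln) (hs : BoundedSamples D p.A s) (k : ℕ) :
    StepSetting (D.W ^ D.t) (sigmaTwo D.W ^ D.t) D.α D.β p.M (D.iter Nk s k).1
      (iam (D.iter Nk s k).1) :=
  h.stepSetting_of_le (h.region hs k).1 (h.region hs k).2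

theorem rms_riemGrad_sub_le (h : Setting D iam p L Ln) {X Z : Fin N → Matrix (Fin n) (Fin r) ℝ}
    (hX : ∀ i, X i ∈ stiefel n r) (hZ : ∀ i, Z i ∈ stiefel n r) :
    rms (fun i => riemGrad (D.f i) (X i) - riemGrad (D.f i) (Z i))
      ≤ p.LG * rms (fun i => X i - Z i) := by
  have hL := h.admissible.step.LG_pos
  have h1 : rms (fun i => riemGrad (D.f i) (X i) - riemGrad (D.f i) (Z i))
      ≤ rms (fun i => p.LG • (X i - Z i)) := rms_mono fun i => by
    rw [norm_smul, Real.norm_of_nonneg hL.le, h.LG_eq]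
    exact (h.smooth i).norm_riemGrad_sub_le (hX i) (hZ i) (h.spec_bound i _ (hX i))
  rwa [rms_smul, abs_of_pos hL] at h1

theorem norm_mean_sub_grad_le (h : Setting D iam p L Ln) (k : ℕ) :
    ‖mean (D.iter Nk s k).2 - riemGrad D.cost (iam (D.iter Nk s k).1)‖
      ≤ p.LG * D.consErr iam Nk s k + D.noise Nk s k := by
  have hm := D.iter_mem (Nk := Nk) (s := s) h.X₀_mem k
  rw [h.mean_iter_snd, D.riemGrad_cost fun i => (h.smooth i).1, ← mean_sub]
  refine (norm_mean_le h.hN _).trans ?_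
  have h1 := rms_add_le
    (fun i => D.estimate Nk s k i - riemGrad (D.f i) ((D.iter Nk s k).1 i))
    (fun i => riemGrad (D.f i) ((D.iter Nk s k).1 i)
      - riemGrad (D.f i) (iam (D.iter Nk s k).1))
  simp only [sub_add_sub_cancel] at h1
  have h2 := h.rms_riemGrad_sub_le (X := (D.iter Nk s k).1)
    (Z := fun _ => iam (D.iter Nk s k).1) hm fun _ => (h.isCriticalMean k).mean_mem
  rw [add_comm (p.LG * _)]
  exact h1.trans (add_le_add le_rfl h2)

/-- The new deviation is the mixed old deviation plus the centred change of the estimates. That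
change consists of two noises and a gradient difference, controlled by `LG` times the displacement
of the agents. -/
theorem spread_succ_le (h : Setting D iam p L Ln) (hs : BoundedSamples D p.A s) (k : ℕ) :
    spread (D.iter Nk s (k + 1)).2 ≤ sigmaTwo D.W ^ D.t * spread (D.iter Nk s k).2
      + (D.noise Nk s (k + 1) + D.noise Nk s k + (3 / 2 * (p.α * (p.LG * D.consErr iam Nk s k))
        + p.LG * p.β * rms (D.iter Nk s k).2)) := by
  set Y := (D.iter Nk s k).2 with hY
  set F := D.estimate Nk s k with hF
  set F' := D.estimate Nk s (k + 1) with hF'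
  have e (i : Fin N) : (D.iter Nk s (k + 1)).2 i - mean (D.iter Nk s (k + 1)).2
      = mix (D.W ^ D.t) (fun j => Y j - mean Y) i
        + ((F' i - F i) - mean fun i => F' i - F i) := by
    rw [h.mean_iter_snd, D.iter_succ_snd, mix_sub, h.mixing.mix_const, h.mean_iter_snd k, mean_sub]
    change _ = mix (D.W ^ D.t) Y i - mean F + (F' i - F i - (mean F' - mean F))
    abel
  have h1 := rms_add_le (mix (D.W ^ D.t) fun j => Y j - mean Y)
    (fun i => (F' i - F i) - mean fun i => F' i - F i)
  have h2 := h.mixing.rms_mix_le_of_mean_zero (mean_sub_mean h.hN Y)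
  have h3 := rms_sub_mean_le h.hN fun i => F' i - F i
  have hX := D.iter_mem (Nk := Nk) (s := s) h.X₀_mem k
  have hX' := D.iter_mem (Nk := Nk) (s := s) h.X₀_mem (k + 1)
  have h4 := h.rms_riemGrad_sub_le hX' hX
  have h5 := (h.stepSetting (Nk := Nk) hs k).rms_stepX_sub_self_le (D.iter Nk s k).2
  rw [← D.iter_succ_fst, ← h.α_eq, ← h.β_eq] at h5
  have h6 := rms_add_le
    (fun i => (F' i - riemGrad (D.f i) ((D.iter Nk s (k + 1)).1 i))
      - (F i - riemGrad (D.f i) ((D.iter Nk s k).1 i)))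
    (fun i => riemGrad (D.f i) ((D.iter Nk s (k + 1)).1 i)
      - riemGrad (D.f i) ((D.iter Nk s k).1 i))
  have h7 := rms_sub_le
    (fun i => F' i - riemGrad (D.f i) ((D.iter Nk s (k + 1)).1 i))
    (fun i => F i - riemGrad (D.f i) ((D.iter Nk s k).1 i))
  have e2 (i : Fin N) : (F' i - riemGrad (D.f i) ((D.iter Nk s (k + 1)).1 i))
      - (F i - riemGrad (D.f i) ((D.iter Nk s k).1 i))
      + (riemGrad (D.f i) ((D.iter Nk s (k + 1)).1 i)
        - riemGrad (D.f i) ((D.iter Nk s k).1 i)) = F' i - F i := by abel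
  simp only [e2] at h6
  have h8 := mul_le_mul_of_nonneg_left h5 h.admissible.step.LG_pos.le
  have h9 : rms (fun i => F' i - riemGrad (D.f i) ((D.iter Nk s (k + 1)).1 i))
      = D.noise Nk s (k + 1) := rfl
  have h10 : rms (fun i => F i - riemGrad (D.f i) ((D.iter Nk s k).1 i))
      = D.noise Nk s k := rfl
  have h11 : rms (fun i => (D.iter Nk s k).1 i - iam (D.iter Nk s k).1)
      = D.consErr iam Nk s k := rfl
  rw [h9, h10] at h7
  rw [h11] at h8
  have e3 : spread (D.iter Nk s (k + 1)).2 = rms (fun i => (mix (D.W ^ D.t) fun j => Y j - mean Y) i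
      + ((F' i - F i) - mean fun i => F' i - F i)) := by
    simp only [spread, e]
  have e4 : spread Y = rms fun j => Y j - mean Y := rfl
  rw [e3, e4]
  linarith

/-- The potential which decreases along the iterates up to the noise. -/
noncomputable def potential (D : Data n r N Ξ)
    (iam : (Fin N → Matrix (Fin n) (Fin r) ℝ) → Matrix (Fin n) (Fin r) ℝ) (p : Params)
    (Nk : ℕ → ℕ) (s : (i : Fin N) → ℕ → ℕ → Ξ i) (k : ℕ) : ℝ :=
  D.cost (iam (D.iter Nk s k).1) + 3 * p.LG * p.α * D.consErr iam Nk s k ^ 2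
    + 3 / 10 * p.β * spread (D.iter Nk s k).2 ^ 2

/-- The next tracking error is represented by its bound without the noise of iteration `k + 1`.
`tracking_sq` supplies that noise in intermediate iterations, and in the last iteration the whole
nonnegative term is dropped. -/
theorem potential_decrease_aux (h : Setting D iam p L Ln) (hs : BoundedSamples D p.A s) (k : ℕ) :
    D.cost (iam (D.iter Nk s (k + 1)).1) + 3 * p.LG * p.α * D.consErr iam Nk s (k + 1) ^ 2
        + 3 / 10 * p.β * (3 / 16 * spread (D.iter Nk s k).2 ^ 2
          + 12 * (D.noise Nk s k ^ 2 + 9 / 4 * (p.α * (p.LG * D.consErr iam Nk s k)) ^ 2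
            + (p.LG * p.β * rms (D.iter Nk s k).2) ^ 2))
      ≤ potential D iam p Nk s k - p.β / 16 * D.gradSq iam Nk s k
        + 10 * p.β * D.noise Nk s k ^ 2 := by
  have hst := h.stepSetting (Nk := Nk) hs k
  have hcrit := h.isCriticalMean (Nk := Nk) (s := s) (k + 1)
  have hV := h.β_mul_le (rms_le_of_forall_le h.hN (by linarith [h.admissible.A_pos])
    (h.norm_iter_snd_le (Nk := Nk) hs k))
  have hf : D.cost (iam (D.iter Nk s (k + 1)).1) ≤ D.cost (iam (D.iter Nk s k).1)
      + inner ℝ (riemGrad D.cost (iam (D.iter Nk s k).1))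
        (iam (D.iter Nk s (k + 1)).1 - iam (D.iter Nk s k).1)
      + p.LG / 2 * ‖iam (D.iter Nk s (k + 1)).1 - iam (D.iter Nk s k).1‖ ^ 2 := by
    refine (D.cost_le_quadratic h.hN h.smooth hst.critical.mean_mem hcrit.mean_mem
      fun i => h.spec_bound i _ hst.critical.mean_mem).trans ?_
    rw [h.LG_eq]
    gcongr
    linarith [h.Ln_nonneg]
  rw [D.iter_succ_fst] at hcrit
  have key := hst.potential_decrease (L := p.LG) (δ := p.δ₁) (ν := D.noise Nk s k)
    (g := riemGrad D.cost (iam (D.iter Nk s k).1)) hcrit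
    (h.consErr_succ_le_rms k) (h.region hs k).1 (h.region hs (k + 1)).1 h.δ₁_le
    (by rwa [← h.α_eq, ← h.β_eq]) h.admissible.step.LG_pos
    (by rw [← h.β_eq]; exact h.admissible.LG_mul_β_le)
    (by rw [← h.β_eq, ← h.α_eq]; exact h.admissible.LG_mul_β_le_sq)
    (by rw [← h.β_eq, ← h.α_eq]; exact h.admissible.δ₁_sq_le)
    (tangentProj_mem hst.critical.mean_mem _) (h.norm_mean_sub_grad_le k) hf
  rw [← D.iter_succ_fst, ← h.α_eq, ← h.β_eq] at key
  exact key

theorem potential_succ_le (h : Setting D iam p L Ln) (hs : BoundedSamples D p.A s) (k : ℕ) :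
    potential D iam p Nk s (k + 1) ≤ potential D iam p Nk s k - p.β / 16 * D.gradSq iam Nk s k
      + 10 * p.β * D.noise Nk s k ^ 2 + 18 / 5 * p.β * D.noise Nk s (k + 1) ^ 2 := by
  have h1 := h.potential_decrease_aux (Nk := Nk) hs k
  have h2 := tracking_sq h.s_sq (rms_nonneg _) (h.spread_succ_le (Nk := Nk) hs k)
  have h3 := mul_le_mul_of_nonneg_left h2
    (mul_nonneg (by norm_num : (0 : ℝ) ≤ 3 / 10) h.admissible.step.β_pos.le)
  have h4 : rms (fun i => (D.iter Nk s (k + 1)).2 i - mean (D.iter Nk s (k + 1)).2)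
      = spread (D.iter Nk s (k + 1)).2 := rfl
  rw [h4] at h3
  have h5 : potential D iam p Nk s (k + 1) = D.cost (iam (D.iter Nk s (k + 1)).1)
      + 3 * p.LG * p.α * D.consErr iam Nk s (k + 1) ^ 2
      + 3 / 10 * p.β * spread (D.iter Nk s (k + 1)).2 ^ 2 := rfl
  linarith

theorem potential_add_sum_le (h : Setting D iam p L Ln) (hs : BoundedSamples D p.A s) (K : ℕ) :
    potential D iam p Nk s K + p.β / 16 * ∑ k ∈ Finset.range K, D.gradSq iam Nk s k
      ≤ potential D iam p Nk s 0 + 10 * p.β * ∑ k ∈ Finset.range K, D.noise Nk s k ^ 2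
        + 18 / 5 * p.β * ∑ k ∈ Finset.range (K + 1), D.noise Nk s k ^ 2 := by
  induction K with
  | zero =>
    have : 0 ≤ 18 / 5 * p.β * ∑ k ∈ Finset.range (0 + 1), D.noise Nk s k ^ 2 := by
      have := h.admissible.step.β_pos
      positivity
    simp only [Finset.range_zero, Finset.sum_empty, mul_zero, add_zero]
    linarith
  | succ K ih =>
    have h1 := h.potential_succ_le (Nk := Nk) hs K
    rw [Finset.sum_range_succ _ K, Finset.sum_range_succ _ K, Finset.sum_range_succ _ (K + 1)]
    linarith

theorem potential_zero (h : Setting D iam p L Ln) : potential D iam p Nk s 0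
    = D.cost (iam D.X₀) + 3 * p.LG * p.α * (1 / (p.N : ℝ) * p.e₀)
      + 3 / 10 * p.β * (1 / (p.N : ℝ) * D.trackErr₀ Nk s) := by
  have h1 : D.consErr iam Nk s 0 ^ 2 = 1 / (p.N : ℝ) * p.e₀ := by
    rw [Data.consErr, rms_sq, h.e₀_eq, h.N_eq]
    rfl
  have h2 : spread (D.iter Nk s 0).2 ^ 2 = 1 / (p.N : ℝ) * D.trackErr₀ Nk s := by
    rw [spread, rms_sq, h.N_eq]
    rfl
  rw [potential, h1, h2]
  rfl

theorem costMin_le (h : Setting D iam p L Ln) {X : Matrix (Fin n) (Fin r) ℝ}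
    (hX : X ∈ stiefel n r) : D.costMin ≤ D.cost X :=
  csInf_le (D.bddBelow_cost h.hN h.smooth h.spec_bound h.grad_bound) ⟨X, hX, rfl⟩

theorem sum_gradSq_le (h : Setting D iam p L Ln) (hs : BoundedSamples D p.A s) (K : ℕ) :
    p.β * ∑ k ∈ Finset.range (K + 1), D.gradSq iam Nk s k
      ≤ 16 * ((D.cost (iam D.X₀) - D.costMin) + 3 * p.LG * p.α * (1 / (p.N : ℝ) * p.e₀)
        + 3 / 10 * p.β * (1 / (p.N : ℝ) * D.trackErr₀ Nk s)
        + 14 * p.β * ∑ k ∈ Finset.range (K + 1), D.noise Nk s k ^ 2) := by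
  have hβ := h.admissible.step.β_pos
  have h1 := h.potential_add_sum_le (Nk := Nk) hs K
  -- Closing with this version avoids the noise of iteration `K + 1`, so only the batches 0, …, K
  -- enter; the coefficient is 10 + 18/5 ≤ 14.
  have h2 := h.potential_decrease_aux (Nk := Nk) hs K
  have h3 := h.costMin_le (h.isCriticalMean (Nk := Nk) (s := s) (K + 1)).mean_mem
  have h4 : 0 ≤ 3 * p.LG * p.α * D.consErr iam Nk s (K + 1) ^ 2 := by
    have := h.admissible.step.LG_pos
    have := h.admissible.step.α_pos
    positivity
  have h5 : 0 ≤ 3 / 10 * p.β * (3 / 16 * spread (D.iter Nk s K).2 ^ 2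
          + 12 * (D.noise Nk s K ^ 2 + 9 / 4 * (p.α * (p.LG * D.consErr iam Nk s K)) ^ 2
            + (p.LG * p.β * rms (D.iter Nk s K).2) ^ 2)) := by positivity
  have h6 : 0 ≤ p.β * ∑ k ∈ Finset.range (K + 1), D.noise Nk s k ^ 2 := by positivity
  rw [h.potential_zero] at h1
  rw [Finset.sum_range_succ _ K]
  rw [Finset.sum_range_succ _ K] at h1 h6 ⊢
  linarith

end Setting

end Trajectory

instance matrixSecondCountable (n r : ℕ) : SecondCountableTopology (Matrix (Fin n) (Fin r) ℝ) :=
  inferInstanceAs (SecondCountableTopology (Fin n → Fin r → ℝ))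

/-- The Borel property with respect to the topology which comes from the Frobenius norm. -/
instance matrixNormBorelSpace (n r : ℕ) : @BorelSpace (Matrix (Fin n) (Fin r) ℝ)
    PseudoMetricSpace.toUniformSpace.toTopologicalSpace _ := ⟨rfl⟩

instance matrixNormSecondCountable (n r : ℕ) :
    @SecondCountableTopology (Matrix (Fin n) (Fin r) ℝ)
      PseudoMetricSpace.toUniformSpace.toTopologicalSpace :=
  matrixSecondCountable n r

/-! ### Variance of averages of independent vectors -/

section Variance

variable {E : Type*} [NormedAddCommGroup E] [InnerProductSpace ℝ E] [CompleteSpace E]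
  [MeasurableSpace E] [BorelSpace E] [SecondCountableTopology E]
  {Ω : Type*} [MeasurableSpace Ω] {μ : Measure Ω} [IsProbabilityMeasure μ]

omit [InnerProductSpace ℝ E] [CompleteSpace E] in
theorem integrable_of_measurable_of_bound {U : Ω → E} (hU : Measurable U) {C : ℝ}
    (hUC : ∀ᵐ ω ∂μ, ‖U ω‖ ≤ C) : Integrable U μ :=
  Integrable.of_bound hU.aestronglyMeasurable C hUC

/-- Independence makes the joint law a product, and Fubini integrates the centred factor first. -/
theorem integral_inner_eq_zero_of_indepFun {U V : Ω → E} (hU : Measurable U) (hV : Measurable V)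
    {C : ℝ} (hUC : ∀ᵐ ω ∂μ, ‖U ω‖ ≤ C) (hVC : ∀ᵐ ω ∂μ, ‖V ω‖ ≤ C) (hind : IndepFun U V μ)
    (hV0 : ∫ ω, V ω ∂μ = 0) : ∫ ω, inner ℝ (U ω) (V ω) ∂μ = 0 := by
  have hprod := (indepFun_iff_map_prod_eq_prod_map_map hU.aemeasurable hV.aemeasurable).1 hind
  have hm : Measurable fun z : E × E => (inner ℝ z.1 z.2 : ℝ) := measurable_fst.inner measurable_snd
  have hint : Integrable (fun z : E × E => (inner ℝ z.1 z.2 : ℝ))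
      ((μ.map U).prod (μ.map V)) := by
    rw [← hprod, integrable_map_measure hm.aestronglyMeasurable (hU.prodMk hV).aemeasurable]
    refine Integrable.of_bound (hm.comp (hU.prodMk hV)).aestronglyMeasurable (C * C) ?_
    filter_upwards [hUC, hVC] with ω h1 h2
    exact (norm_inner_le_norm _ _).trans (mul_le_mul h1 h2 (norm_nonneg _)
      ((norm_nonneg _).trans h1))
  have hVint : Integrable (id : E → E) (μ.map V) := by
    rw [integrable_map_measure aestronglyMeasurable_id hV.aemeasurable]
    exact Integrable.of_bound hV.aestronglyMeasurable C hVC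
  have hV0' : ∫ v, id v ∂(μ.map V) = 0 := by
    rw [integral_map hV.aemeasurable aestronglyMeasurable_id]
    exact hV0
  have := Measure.isProbabilityMeasure_map (μ := μ) hU.aemeasurable
  have := Measure.isProbabilityMeasure_map (μ := μ) hV.aemeasurable
  calc ∫ ω, inner ℝ (U ω) (V ω) ∂μ
      = ∫ z : E × E, inner ℝ z.1 z.2 ∂(μ.map fun ω => (U ω, V ω)) :=
        (integral_map (hU.prodMk hV).aemeasurable hm.aestronglyMeasurable).symm
    _ = 0 := by
        rw [hprod, integral_prod _ hint]
        exact integral_eq_zero_of_ae (.of_forall fun x =>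
          (integral_inner hVint x).trans (by rw [hV0', inner_zero_right]; rfl))

/-- The variance of a mean of independent, centred random vectors. -/
theorem integral_norm_sq_average_le {Z : ℕ → Ω → E} (hZ : ∀ j, Measurable (Z j)) {C σ : ℝ}
    (hC : ∀ j, ∀ᵐ ω ∂μ, ‖Z j ω‖ ≤ C) (hind : iIndepFun Z μ) (h0 : ∀ j, ∫ ω, Z j ω ∂μ = 0)
    (hσ : ∀ j, ∫ ω, ‖Z j ω‖ ^ 2 ∂μ ≤ σ ^ 2) {m : ℕ} (hm : 0 < m) :
    ∫ ω, ‖(1 / (m : ℝ)) • ∑ j ∈ Finset.range m, Z j ω‖ ^ 2 ∂μ ≤ σ ^ 2 / m := by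
  have hm' : (0 : ℝ) < m := by exact_mod_cast hm
  have hint (i j : ℕ) : Integrable (fun ω => (inner ℝ (Z i ω) (Z j ω) : ℝ)) μ := by
    refine Integrable.of_bound ((hZ i).inner (hZ j)).aestronglyMeasurable (C * C) ?_
    filter_upwards [hC i, hC j] with ω h1 h2
    exact (norm_inner_le_norm _ _).trans (mul_le_mul h1 h2 (norm_nonneg _)
      ((norm_nonneg _).trans h1))
  have e (ω : Ω) : ‖(1 / (m : ℝ)) • ∑ j ∈ Finset.range m, Z j ω‖ ^ 2 = (1 / (m : ℝ)) ^ 2 *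
      ∑ i ∈ Finset.range m, ∑ j ∈ Finset.range m, inner ℝ (Z i ω) (Z j ω) := by
    rw [norm_smul, mul_pow, Real.norm_of_nonneg (by positivity), ← real_inner_self_eq_norm_sq,
      sum_inner]
    simp only [inner_sum]
  simp only [e]
  rw [integral_const_mul, integral_finsetSum _ fun i _ => integrable_finsetSum _ fun j _ =>
    hint i j]
  have h1 : ∑ i ∈ Finset.range m, ∫ ω, ∑ j ∈ Finset.range m, inner ℝ (Z i ω) (Z j ω) ∂μ
      ≤ ∑ _i ∈ Finset.range m, σ ^ 2 := by
    refine Finset.sum_le_sum fun i hi => ?_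
    rw [integral_finsetSum _ fun j _ => hint i j, Finset.sum_eq_single_of_mem i hi fun j _ hj =>
      integral_inner_eq_zero_of_indepFun (hZ i) (hZ j) (hC i) (hC j) (hind.indepFun hj.symm) (h0 j)]
    simp only [real_inner_self_eq_norm_sq]
    exact hσ i
  rw [Finset.sum_const, Finset.card_range, nsmul_eq_mul] at h1
  refine (mul_le_mul_of_nonneg_left h1 (by positivity)).trans_eq ?_
  field_simp

end Variance

/-! ### Measurability and independence of the iterates -/

section Stochastic

variable {n r N : ℕ} {Ξ : Fin N → Type*} [∀ i, MeasurableSpace (Ξ i)] {D : Data n r N Ξ}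

theorem measurable_linearCombination {Ω' ι : Type*} [MeasurableSpace Ω'] (S : Finset ι) (c : ι → ℝ)
    {X : ι → Ω' → Matrix (Fin n) (Fin r) ℝ} (hX : ∀ j, Measurable (X j)) :
    Measurable fun ω => ∑ j ∈ S, c j • X j ω :=
  Finset.measurable_fun_sum _ fun j _ => (hX j).const_smul (c j)

theorem Data.measurable_batchGrad {Ω' : Type*} [MeasurableSpace Ω']
    (hG : ∀ i, Measurable fun p : Matrix (Fin n) (Fin r) ℝ × Ξ i => D.G i p.1 p.2) (Nk : ℕ → ℕ)
    {s : Ω' → (i : Fin N) → ℕ → ℕ → Ξ i} {k : ℕ} {i : Fin N}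
    (hs : ∀ j, Measurable fun ω => s ω i k j)
    {X : Ω' → Matrix (Fin n) (Fin r) ℝ} (hX : Measurable X) :
    Measurable fun ω => D.batchGrad Nk (s ω) k i (X ω) :=
  (Finset.measurable_fun_sum (Finset.range (Nk k)) fun j _ =>
    (hG i).comp (hX.prodMk (hs j))).const_smul (1 / (Nk k : ℝ))

theorem measurable_stepX {Ω' : Type*} [MeasurableSpace Ω'] (P : Matrix (Fin N) (Fin N) ℝ)
    (α β : ℝ) {X Y : Ω' → Fin N → Matrix (Fin n) (Fin r) ℝ}
    (hX : ∀ i, Measurable fun ω => X ω i) (hY : ∀ i, Measurable fun ω => Y ω i) (i : Fin N) :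
    Measurable fun ω => stepX P α β (X ω) (Y ω) i := by
  have hP {U V : Ω' → Matrix (Fin n) (Fin r) ℝ} (hU : Measurable U) (hV : Measurable V) :
      Measurable fun ω => tangentProj (U ω) (V ω) :=
    continuous_tangentProj.measurable.comp (hU.prodMk hV)
  have h1 : Measurable fun ω => ∑ j, P i j • X ω j := measurable_linearCombination _ _ hX
  exact continuous_polarRetraction.measurable.comp ((hX i).prodMk
    (((hP (hX i) h1).const_smul α).sub ((hP (hX i) (hY i)).const_smul β)))

/-- Points at iteration `k` involve only samples before `k`, trackers also those of `k`. The
σ-algebra on `Ω'` is arbitrary so that the one generated by past samples can be used. -/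
theorem Data.measurable_iter {Ω' : Type*} [MeasurableSpace Ω']
    (hG : ∀ i, Measurable fun p : Matrix (Fin n) (Fin r) ℝ × Ξ i => D.G i p.1 p.2) (Nk : ℕ → ℕ)
    {s : Ω' → (i : Fin N) → ℕ → ℕ → Ξ i} (k : ℕ) :
    ((∀ l < k, ∀ i j, Measurable fun ω => s ω i l j) →
      ∀ i, Measurable fun ω => (D.iter Nk (s ω) k).1 i) ∧
    ((∀ l ≤ k, ∀ i j, Measurable fun ω => s ω i l j) →
      ∀ i, Measurable fun ω => (D.iter Nk (s ω) k).2 i) := by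
  induction k with
  | zero =>
    exact ⟨fun _ i => measurable_const, fun hs i =>
      D.measurable_batchGrad hG Nk (hs 0 le_rfl i) measurable_const⟩
  | succ k ih =>
    have hX' (hs : ∀ l < k + 1, ∀ i j, Measurable fun ω => s ω i l j) (i : Fin N) :
        Measurable fun ω => (D.iter Nk (s ω) (k + 1)).1 i := by
      simp only [D.iter_succ_fst]
      exact measurable_stepX _ _ _ (ih.1 fun l hl => hs l (by omega))
        (ih.2 fun l hl => hs l (by omega)) i
    refine ⟨hX', fun hs i => ?_⟩
    have hX := ih.1 fun l hl => hs l (by omega)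
    have hY := ih.2 fun l hl => hs l (by omega)
    have h1 : Measurable fun ω => mix (D.W ^ D.t) (D.iter Nk (s ω) k).2 i :=
      measurable_linearCombination _ _ hY
    have h2 : Measurable fun ω => D.estimate Nk (s ω) (k + 1) i :=
      D.measurable_batchGrad hG Nk (hs (k + 1) le_rfl i) (hX' (fun l hl => hs l hl.le) i)
    have h3 : Measurable fun ω => D.estimate Nk (s ω) k i :=
      D.measurable_batchGrad hG Nk (hs k (by omega) i) (hX i)
    simp only [D.iter_succ_snd]
    exact (h1.add h2).sub h3

variable {Ω : Type*} [MeasurableSpace Ω] {μ : Measure Ω}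
  {ν : (i : Fin N) → Measure (Ξ i)} {ξ : (i : Fin N) → ℕ → ℕ → Ω → Ξ i} {σ A₁ : ℝ}

theorem SamplingAssumption.ae_of_ae (h : SamplingAssumption μ ν ξ) {i : Fin N} {P : Ξ i → Prop}
    (hP : ∀ᵐ x ∂(ν i), P x) (k j : ℕ) : ∀ᵐ ω ∂μ, P (ξ i k j ω) :=
  ae_of_ae_map (h.measurable i k j).aemeasurable (by rwa [h.law i k j])

/-- The points of the agents at iteration `k` are independent of the samples of iteration `k`. -/
theorem SamplingAssumption.indepFun_iter (h : SamplingAssumption μ ν ξ)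
    (hG : ∀ i, Measurable fun p : Matrix (Fin n) (Fin r) ℝ × Ξ i => D.G i p.1 p.2)
    (Nk : ℕ → ℕ) (k : ℕ) (i : Fin N) :
    IndepFun (fun ω => (D.iter Nk (fun i k j => ξ i k j ω) k).1 i) (fun ω j => ξ i k j ω) μ := by
  let m : ℕ → MeasurableSpace Ω := fun l =>
    MeasurableSpace.comap (fun ω => fun p : Fin N × ℕ => ξ p.1 l p.2 ω) MeasurableSpace.pi
  have hm (l : ℕ) (i : Fin N) (j : ℕ) : Measurable[m l] fun ω => ξ i l j ω :=
    (measurable_pi_apply (X := fun p : Fin N × ℕ => Ξ p.1) (i, j)).comp (comap_measurable _)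
  have hle (l : ℕ) : m l ≤ ‹MeasurableSpace Ω› :=
    (measurable_pi_lambda _ fun p => h.measurable p.1 l p.2).comap_le
  -- The past and the current iteration are disjoint index sets, so the σ-algebras they generate are
  -- independent.
  have hind : Indep (⨆ l ∈ Set.Iio k, m l) (⨆ l ∈ ({k} : Set ℕ), m l) μ :=
    indep_iSup_of_disjoint hle ((iIndepFun_iff_iIndep _ _ _).1 h.indep_iter)
      (Set.disjoint_singleton_right.2 (lt_irrefl k))
  rw [IndepFun_iff_Indep]
  refine indep_of_indep_of_le_left (indep_of_indep_of_le_right hind ?_) ?_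
  · rw [iSup_singleton]
    refine Measurable.comap_le ?_
    exact @measurable_pi_lambda _ _ _ (m k) _ _ fun j => hm k i j
  · refine Measurable.comap_le ?_
    refine (@Data.measurable_iter n r N Ξ _ D Ω (⨆ l ∈ Set.Iio k, m l) hG Nk
      (fun ω i k j => ξ i k j ω) k).1 (fun l hl i j => ?_) i
    exact (hm l i j).mono (le_biSup m hl) le_rfl

end Stochastic

/-! ### Expected noise and expected gradient norms -/

section Expectation

variable {n r N : ℕ} {Ξ : Fin N → Type*} [∀ i, MeasurableSpace (Ξ i)] {D : Data n r N Ξ}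
  {iam : (Fin N → Matrix (Fin n) (Fin r) ℝ) → Matrix (Fin n) (Fin r) ℝ}
  {p : Params} {L Ln : ℝ} {Ω : Type*} [MeasurableSpace Ω] {μ : Measure Ω} [IsProbabilityMeasure μ]
  {ν : (i : Fin N) → Measure (Ξ i)} {ξ : (i : Fin N) → ℕ → ℕ → Ω → Ξ i} {σ A₁ : ℝ}

omit [IsProbabilityMeasure μ] in
theorem ae_boundedSamples (ho : OracleAssumption D ν σ A₁) (hs : SamplingAssumption μ ν ξ) {A : ℝ}
    (hA : A₁ ≤ A) : ∀ᵐ ω ∂μ, Setting.BoundedSamples D A fun i k j => ξ i k j ω :=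
  ae_all_iff.2 fun i => ae_all_iff.2 fun k => ae_all_iff.2 fun j =>
    (hs.ae_of_ae (ho.bounded i) k j).mono fun _ h X hX => (h X hX).trans hA

/-- The variance of the gradient estimate at a fixed point. -/
theorem integral_norm_batchGrad_sub_sq_le (ho : OracleAssumption D ν σ A₁)
    (hs : SamplingAssumption μ ν ξ) {Nk : ℕ → ℕ} {k : ℕ} (hk : 0 < Nk k) (i : Fin N)
    {X : Matrix (Fin n) (Fin r) ℝ} (hX : X ∈ stiefel n r) :
    ∫ ω, ‖D.batchGrad Nk (fun i k j => ξ i k j ω) k i X - riemGrad (D.f i) X‖ ^ 2 ∂μ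
      ≤ σ ^ 2 / Nk k := by
  have hk' : (Nk k : ℝ) ≠ 0 := by positivity
  have hGm : Measurable fun x => D.G i X x := (ho.measurable i).comp measurable_prodMk_left
  have hGb (j : ℕ) : ∀ᵐ ω ∂μ, ‖D.G i X (ξ i k j ω)‖ ≤ A₁ :=
    (hs.ae_of_ae (ho.bounded i) k j).mono fun _ h => h X hX
  have hZ (j : ℕ) : Measurable fun ω => D.G i X (ξ i k j ω) - riemGrad (D.f i) X :=
    (hGm.comp (hs.measurable i k j)).sub measurable_const
  have key := integral_norm_sq_average_le (μ := μ) (σ := σ) hZ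
    (C := A₁ + ‖riemGrad (D.f i) X‖) (fun j => ?_) ?_ (fun j => ?_) (fun j => ?_) hk
  · refine le_of_eq_of_le ?_ key
    refine integral_congr_ae (.of_forall fun ω => ?_)
    simp only [Data.batchGrad]
    rw [Finset.sum_sub_distrib, Finset.sum_const, Finset.card_range, smul_sub,
      ← Nat.cast_smul_eq_nsmul ℝ, smul_smul, one_div_mul_cancel hk', one_smul]
  · filter_upwards [hGb j] with ω hω
    exact (norm_sub_le _ _).trans (add_le_add hω le_rfl)
  · exact (hs.indep_batch i k).comp (fun _ x => D.G i X x - riemGrad (D.f i) X)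
      fun _ => hGm.sub measurable_const
  · have hint := integrable_of_measurable_of_bound (hGm.comp (hs.measurable i k j)) (hGb j)
    have e := integral_sub hint (integrable_const (riemGrad (D.f i) X))
    simp only [Function.comp_apply] at e
    rw [e, integral_const, probReal_univ, one_smul,
      sub_eq_zero, ← ho.unbiased i X hX, ← hs.law i k j,
      integral_map (hs.measurable i k j).aemeasurable hGm.aestronglyMeasurable]
  · refine le_of_eq_of_le ?_ (ho.variance i X hX)
    have hm : Measurable fun x => ‖D.G i X x - riemGrad (D.f i) X‖ ^ 2 :=
      (hGm.sub measurable_const).norm.pow_const 2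
    rw [← hs.law i k j, integral_map (hs.measurable i k j).aemeasurable hm.aestronglyMeasurable]

namespace Setting

omit [∀ i, MeasurableSpace (Ξ i)] in
theorem norm_riemGrad_le (h : Setting D iam p L Ln) (i : Fin N) {X : Matrix (Fin n) (Fin r) ℝ}
    (hX : X ∈ stiefel n r) : ‖riemGrad (D.f i) X‖ ≤ p.A :=
  (StiefelGT.norm_riemGrad_le hX).trans (h.grad_bound i X hX)

omit [∀ i, MeasurableSpace (Ξ i)] in
theorem norm_estimate_sub_sq_le (h : Setting D iam p L Ln) {Nk : ℕ → ℕ}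
    {s : (i : Fin N) → ℕ → ℕ → Ξ i} (hs : BoundedSamples D p.A s) (k : ℕ) (i : Fin N) :
    ‖‖D.estimate Nk s k i - riemGrad (D.f i) ((D.iter Nk s k).1 i)‖ ^ 2‖ ≤ (p.A + p.A) ^ 2 := by
  rw [Real.norm_of_nonneg (by positivity)]
  gcongr
  exact (norm_sub_le _ _).trans (add_le_add (h.norm_estimate_le hs k i)
    (h.norm_riemGrad_le i (D.iter_mem h.X₀_mem k i)))

omit [IsProbabilityMeasure μ] in
theorem measurable_iter_fst (ho : OracleAssumption D ν σ A₁) (hs : SamplingAssumption μ ν ξ)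
    (Nk : ℕ → ℕ) (k : ℕ) (i : Fin N) :
    Measurable fun ω => (D.iter Nk (fun i k j => ξ i k j ω) k).1 i :=
  (D.measurable_iter ho.measurable Nk k).1 (fun l _ i j => hs.measurable i l j) i

theorem integrable_norm_estimate_sub_sq (h : Setting D iam p L Ln) (ho : OracleAssumption D ν σ A₁)
    (hs : SamplingAssumption μ ν ξ) (hA : A₁ ≤ p.A) (Nk : ℕ → ℕ) (k : ℕ) (i : Fin N) :
    Integrable (fun ω => ‖D.estimate Nk (fun i k j => ξ i k j ω) k i
      - riemGrad (D.f i) ((D.iter Nk (fun i k j => ξ i k j ω) k).1 i)‖ ^ 2) μ := by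
  have hX := measurable_iter_fst (D := D) ho hs Nk k i
  refine Integrable.of_bound (Measurable.aestronglyMeasurable ?_) ((p.A + p.A) ^ 2)
    ((ae_boundedSamples ho hs hA).mono fun ω hω => h.norm_estimate_sub_sq_le hω k i)
  exact (((D.measurable_batchGrad ho.measurable Nk (s := fun ω i k j => ξ i k j ω)
    (fun j => hs.measurable i k j) hX).sub
    ((h.smooth i).continuous_riemGrad.measurable.comp hX)).norm).pow_const 2

/-- The current point is independent of the current batch, so under the product law the point can be
frozen; the inner integral is then the variance at a fixed point of the manifold. -/
theorem integral_norm_estimate_sub_sq_le (h : Setting D iam p L Ln)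
    (ho : OracleAssumption D ν σ A₁) (hs : SamplingAssumption μ ν ξ) (hA : A₁ ≤ p.A)
    {Nk : ℕ → ℕ} {k : ℕ} (hk : 0 < Nk k) (i : Fin N) :
    ∫ ω, ‖D.estimate Nk (fun i k j => ξ i k j ω) k i
      - riemGrad (D.f i) ((D.iter Nk (fun i k j => ξ i k j ω) k).1 i)‖ ^ 2 ∂μ
      ≤ σ ^ 2 / Nk k := by
  let X : Ω → Matrix (Fin n) (Fin r) ℝ := fun ω => (D.iter Nk (fun i k j => ξ i k j ω) k).1 i
  let S : Ω → ℕ → Ξ i := fun ω j => ξ i k j ω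
  have hX : Measurable X := measurable_iter_fst (D := D) ho hs Nk k i
  have hS : Measurable S := measurable_pi_lambda _ fun j => hs.measurable i k j
  let H : Matrix (Fin n) (Fin r) ℝ × (ℕ → Ξ i) → ℝ := fun z =>
    ‖(1 / (Nk k : ℝ)) • ∑ j ∈ Finset.range (Nk k), D.G i z.1 (z.2 j) - riemGrad (D.f i) z.1‖ ^ 2
  have hH : Measurable H := by
    have h1 (j : ℕ) : Measurable fun z : Matrix (Fin n) (Fin r) ℝ × (ℕ → Ξ i) =>
        D.G i z.1 (z.2 j) := (ho.measurable i).comp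
      (measurable_fst.prodMk ((measurable_pi_apply j).comp measurable_snd))
    have h2 : Measurable fun z : Matrix (Fin n) (Fin r) ℝ × (ℕ → Ξ i) => riemGrad (D.f i) z.1 :=
      (h.smooth i).continuous_riemGrad.measurable.comp measurable_fst
    exact ((((Finset.measurable_fun_sum (Finset.range (Nk k)) fun j _ => h1 j).const_smul
      (1 / (Nk k : ℝ))).sub h2).norm).pow_const 2
  have hprod := (indepFun_iff_map_prod_eq_prod_map_map hX.aemeasurable hS.aemeasurable).1
    (hs.indepFun_iter ho.measurable Nk k i)
  have hint : Integrable H ((μ.map X).prod (μ.map S)) := by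
    rw [← hprod, integrable_map_measure hH.aestronglyMeasurable (hX.prodMk hS).aemeasurable]
    exact h.integrable_norm_estimate_sub_sq ho hs hA Nk k i
  have := Measure.isProbabilityMeasure_map (μ := μ) hX.aemeasurable
  have := Measure.isProbabilityMeasure_map (μ := μ) hS.aemeasurable
  have hSt : ∀ᵐ x ∂(μ.map X), x ∈ stiefel n r := by
    have hc : IsClosed (stiefel n r) := isClosed_eq
      (continuous_id.matrix_transpose.matrix_mul continuous_id) continuous_const
    exact (ae_map_iff hX.aemeasurable (p := fun x => x ∈ stiefel n r) hc.measurableSet).2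
      (.of_forall fun ω => D.iter_mem h.X₀_mem k i)
  calc ∫ ω, H (X ω, S ω) ∂μ = ∫ z, H z ∂(μ.map fun ω => (X ω, S ω)) :=
        (integral_map (hX.prodMk hS).aemeasurable hH.aestronglyMeasurable).symm
    _ = ∫ x, ∫ y, H (x, y) ∂(μ.map S) ∂(μ.map X) := by rw [hprod, integral_prod _ hint]
    _ ≤ ∫ _x, σ ^ 2 / Nk k ∂(μ.map X) := by
        refine integral_mono_ae hint.integral_prod_left (integrable_const _) ?_
        filter_upwards [hSt] with x hx
        have hHx : Measurable fun y => H (x, y) := hH.comp measurable_prodMk_left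
        rw [integral_map hS.aemeasurable hHx.aestronglyMeasurable]
        exact integral_norm_batchGrad_sub_sq_le ho hs hk i hx
    _ = σ ^ 2 / Nk k := by simp

theorem integrable_noise_sq (h : Setting D iam p L Ln) (ho : OracleAssumption D ν σ A₁)
    (hs : SamplingAssumption μ ν ξ) (hA : A₁ ≤ p.A) (Nk : ℕ → ℕ) (k : ℕ) :
    Integrable (fun ω => D.noise Nk (fun i k j => ξ i k j ω) k ^ 2) μ := by
  simp only [Data.noise, rms_sq]
  exact (integrable_finsetSum _ fun i _ =>
    h.integrable_norm_estimate_sub_sq ho hs hA Nk k i).const_mul _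

theorem integral_noise_sq_le (h : Setting D iam p L Ln) (ho : OracleAssumption D ν σ A₁)
    (hs : SamplingAssumption μ ν ξ) (hA : A₁ ≤ p.A) {Nk : ℕ → ℕ} {k : ℕ} (hk : 0 < Nk k) :
    ∫ ω, D.noise Nk (fun i k j => ξ i k j ω) k ^ 2 ∂μ ≤ σ ^ 2 / Nk k := by
  have hN : (N : ℝ) ≠ 0 := by exact_mod_cast h.hN.ne'
  simp only [Data.noise, rms_sq]
  rw [integral_const_mul, integral_finsetSum _ fun i _ =>
    h.integrable_norm_estimate_sub_sq ho hs hA Nk k i]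
  refine (mul_le_mul_of_nonneg_left (Finset.sum_le_sum fun i _ =>
    h.integral_norm_estimate_sub_sq_le ho hs hA hk i) (by positivity)).trans_eq ?_
  rw [Finset.sum_const, Finset.card_univ, Fintype.card_fin, nsmul_eq_mul, ← mul_assoc,
    one_div_mul_cancel hN, one_mul]

theorem integrable_trackErr₀ (h : Setting D iam p L Ln) (ho : OracleAssumption D ν σ A₁)
    (hs : SamplingAssumption μ ν ξ) (hA : A₁ ≤ p.A) (Nk : ℕ → ℕ) :
    Integrable (fun ω => D.trackErr₀ Nk fun i k j => ξ i k j ω) μ := by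
  have hm (i : Fin N) :
      Measurable fun ω => D.batchGrad Nk (fun i k j => ξ i k j ω) 0 i (D.X₀ i) :=
    D.measurable_batchGrad ho.measurable Nk (fun j => hs.measurable i 0 j) measurable_const
  refine integrable_finsetSum _ fun i _ => ?_
  refine Integrable.of_bound (Measurable.aestronglyMeasurable ?_) ((p.A + p.A) ^ 2) ?_
  · exact (((hm i).sub ((Finset.measurable_fun_sum Finset.univ fun j _ => hm j).const_smul
      (1 / (N : ℝ)))).norm).pow_const 2
  · filter_upwards [ae_boundedSamples ho hs hA] with ω hω
    rw [Real.norm_of_nonneg (by positivity)]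
    gcongr
    exact (norm_sub_le _ _).trans (add_le_add (h.norm_estimate_le (Nk := Nk) hω 0 i)
      (h.norm_mean_iter_snd_le (Nk := Nk) hω 0))

omit [∀ i, MeasurableSpace (Ξ i)] in
/-- The induced arithmetic mean is a Lipschitz function of the points near consensus. -/
theorem lipschitzOnWith_iam (hN : 0 < N) :
    LipschitzOnWith 2 iam {Z | IsCriticalMean Z (iam Z) ∧ rms (fun i => Z i - iam Z) ≤ 1} := by
  refine LipschitzOnWith.of_dist_le_mul fun Z hZ U hU => ?_
  rw [dist_eq_norm]
  refine (hZ.1.norm_sub_le hN hU.1 hZ.2 hU.2).trans ?_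
  rw [← mean_sub]
  refine mul_le_mul_of_nonneg_left ((norm_mean_le hN _).trans
    (rms_le_of_forall_le hN dist_nonneg fun i => ?_)) zero_le_two
  rw [← dist_eq_norm]
  exact dist_le_pi_dist Z U i

omit [∀ i, MeasurableSpace (Ξ i)] in
theorem gradSq_le (h : Setting D iam p L Ln) {Nk : ℕ → ℕ} {s : (i : Fin N) → ℕ → ℕ → Ξ i} (k : ℕ) :
    D.gradSq iam Nk s k ≤ p.A ^ 2 := by
  have hm := (h.isCriticalMean (Nk := Nk) (s := s) k).mean_mem
  exact pow_le_pow_left₀ (norm_nonneg _)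
    (D.norm_riemGrad_cost_le h.hN (fun i => (h.smooth i).1) hm fun i => h.grad_bound i _ hm) 2

/-- No measurability of `iam` is assumed. Almost surely the iterates lie in the set where it is
Lipschitz, and there it agrees with a Lipschitz map on the whole space, which is measurable. -/
theorem integrable_gradSq (h : Setting D iam p L Ln) (ho : OracleAssumption D ν σ A₁)
    (hs : SamplingAssumption μ ν ξ) (hA : A₁ ≤ p.A) (Nk : ℕ → ℕ) (k : ℕ) :
    Integrable (fun ω => D.gradSq iam Nk (fun i k j => ξ i k j ω) k) μ := by
  obtain ⟨g, hg, hgiam⟩ := (lipschitzOnWith_iam (iam := iam) h.hN).extend_finite_dimension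
  have hX : Measurable fun ω => (D.iter Nk (fun i k j => ξ i k j ω) k).1 :=
    measurable_pi_lambda _ (measurable_iter_fst (D := D) ho hs Nk k)
  have hc := (D.lSmooth_cost h.hN h.smooth).continuous_riemGrad.comp hg.continuous
  refine Integrable.of_bound (AEStronglyMeasurable.congr
    (f := fun ω => ‖riemGrad D.cost (g (D.iter Nk (fun i k j => ξ i k j ω) k).1)‖ ^ 2)
    ((hc.norm.pow 2).measurable.comp hX).aestronglyMeasurable ?_) (p.A ^ 2)
    (.of_forall fun ω => ?_)
  · filter_upwards [ae_boundedSamples ho hs hA] with ω hω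
    rw [Data.gradSq, ← hgiam]
    refine ⟨h.isCriticalMean k, (h.region hω k).1.trans ?_⟩
    linarith [h.δ₁_le]
  · exact (Real.norm_of_nonneg (sq_nonneg _)).trans_le (h.gradSq_le k)

/-- The sum of the expected squared gradient norms. -/
theorem sum_integral_gradSq_le (h : Setting D iam p L Ln) (ho : OracleAssumption D ν σ A₁)
    (hs : SamplingAssumption μ ν ξ) (hA : A₁ ≤ p.A) {Nk : ℕ → ℕ} (hNk : ∀ k, 0 < Nk k) (K : ℕ) :
    p.β * ∑ k ∈ Finset.range (K + 1), ∫ ω, D.gradSq iam Nk (fun i k j => ξ i k j ω) k ∂μ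
      ≤ p.κ * (D.gap iam μ ξ p Nk + σ ^ 2 * (2 * p.β * p.Γ₂ + p.Dtil₃)
        * ∑ k ∈ Finset.range (K + 1), (Nk k : ℝ)⁻¹) + p.Γtil₁ := by
  have hβ := h.admissible.step.β_pos
  have hg := h.integrable_gradSq ho hs hA Nk
  have hn := h.integrable_noise_sq ho hs hA Nk
  have ht := h.integrable_trackErr₀ ho hs hA Nk
  have hsn := integrable_finsetSum (Finset.range (K + 1)) fun k _ => hn k
  have h1 := integral_mono_ae ((integrable_finsetSum (Finset.range (K + 1))
      fun k _ => hg k).const_mul p.β)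
    (((((integrable_const (D.cost (iam D.X₀) - D.costMin
        + 3 * p.LG * p.α * (1 / (p.N : ℝ) * p.e₀))).add
      ((ht.const_mul (1 / (p.N : ℝ))).const_mul (3 / 10 * p.β))).add
      (hsn.const_mul (14 * p.β))).const_mul 16))
    ((ae_boundedSamples ho hs hA).mono fun ω hω => h.sum_gradSq_le (Nk := Nk) hω K)
  have e1 := integral_add ((integrable_const (D.cost (iam D.X₀) - D.costMin
        + 3 * p.LG * p.α * (1 / (p.N : ℝ) * p.e₀))).add
      ((ht.const_mul (1 / (p.N : ℝ))).const_mul (3 / 10 * p.β))) (hsn.const_mul (14 * p.β))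
  have e2 := integral_add (integrable_const (μ := μ) (D.cost (iam D.X₀) - D.costMin
        + 3 * p.LG * p.α * (1 / (p.N : ℝ) * p.e₀)))
      ((ht.const_mul (1 / (p.N : ℝ))).const_mul (3 / 10 * p.β))
  simp only [Pi.add_apply] at h1 e1 e2
  rw [integral_const_mul, integral_const_mul, e1, e2, integral_const, probReal_univ, one_smul,
    integral_const_mul, integral_const_mul, integral_const_mul,
    integral_finsetSum _ fun k _ => hg k, integral_finsetSum _ fun k _ => hn k] at h1
  have h2 : ∑ k ∈ Finset.range (K + 1), ∫ ω, D.noise Nk (fun i k j => ξ i k j ω) k ^ 2 ∂μ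
      ≤ σ ^ 2 * ∑ k ∈ Finset.range (K + 1), (Nk k : ℝ)⁻¹ := by
    rw [Finset.mul_sum]
    exact Finset.sum_le_sum fun k _ => h.integral_noise_sq_le ho hs hA (hNk k)
  have h3 := h.admissible.potential_le (h.N_eq ▸ h.hN)
    (sub_nonneg.2 (h.costMin_le (h.iam_spec _ h.X₀_mem).1))
    (integral_nonneg fun ω => Finset.sum_nonneg fun i _ => sq_nonneg _ :
      0 ≤ ∫ ω, D.trackErr₀ Nk (fun i k j => ξ i k j ω) ∂μ)
    (Finset.sum_nonneg fun k _ => integral_nonneg fun ω => sq_nonneg _ :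
      0 ≤ ∑ k ∈ Finset.range (K + 1), ∫ ω, D.noise Nk (fun i k j => ξ i k j ω) k ^ 2 ∂μ)
  have h4 := mul_le_mul_of_nonneg_left (mul_le_mul_of_nonneg_left h2 h.admissible.noise_nonneg)
    (by linarith [h.admissible.sixteen_le_κ] : 0 ≤ p.κ)
  refine h1.trans ((le_of_eq_of_le ?_ h3).trans ?_)
  · ring
  · rw [Data.gap]
    change p.κ * (D.cost (iam D.X₀) - D.costMin + _ + _) + _ ≤ _
    linarith

end Setting

end Expectation

/-! ### Sums of reciprocal sample sizes -/

section Sums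

theorem sum_inv_le_of_exponential {q : ℝ} (hq0 : 0 < q) (hq1 : q < 1) {Nk : ℕ → ℕ}
    (hNk : ∀ k, Nk k = ⌈q ^ (-(k : ℤ))⌉₊) (K : ℕ) :
    ∑ k ∈ Finset.range K, (Nk k : ℝ)⁻¹ ≤ 1 / (1 - q) := by
  have h1 (k : ℕ) : (Nk k : ℝ)⁻¹ ≤ q ^ k := by
    have h2 := Nat.le_ceil (q ^ (-(k : ℤ)))
    rw [← hNk, zpow_neg, zpow_natCast] at h2
    exact inv_le_of_inv_le₀ (by positivity) h2
  rw [one_div, ← tsum_geometric_of_lt_one hq0.le hq1]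
  exact (Finset.sum_le_sum fun k _ => h1 k).trans
    ((summable_geometric_of_lt_one hq0.le hq1).sum_le_tsum _ fun k _ => by positivity)

theorem inv_le_of_polynomial {a : ℝ} {Nk : ℕ → ℕ}
    (hNk : ∀ k, Nk k = ⌈((k : ℝ) + 1) ^ a⌉₊) (k : ℕ) : (Nk k : ℝ)⁻¹ ≤ ((k : ℝ) + 1) ^ (-a) := by
  have h2 := Nat.le_ceil (((k : ℝ) + 1) ^ a)
  rw [← hNk] at h2
  rw [Real.rpow_neg (by positivity)]
  exact inv_anti₀ (by positivity) h2

/-- Bernoulli's inequality with exponent `1 - a` gives (1-a)(K+1)^(-a) ≤ (K+1)^(1-a) - K^(1-a),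
which telescopes. -/
theorem sum_rpow_neg_le_of_lt_one {a : ℝ} (ha0 : 0 < a) (ha1 : a < 1) (K : ℕ) :
    ∑ k ∈ Finset.range K, ((k : ℝ) + 1) ^ (-a) ≤ (K : ℝ) ^ (1 - a) / (1 - a) := by
  have ha : 0 < 1 - a := by linarith
  induction K with
  | zero => simp [Real.zero_rpow ha.ne']
  | succ K ih =>
    have hK : (0 : ℝ) < K + 1 := by positivity
    have h1 := rpow_one_add_le_one_add_mul_self (s := -(1 / ((K : ℝ) + 1)))
      (neg_le_neg (by rw [div_le_one hK]; linarith [(K.cast_nonneg : (0 : ℝ) ≤ K)])) ha.le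
      (by linarith : 1 - a ≤ 1)
    have h2 : (K : ℝ) = (K + 1) * (1 + -(1 / ((K : ℝ) + 1))) := by field_simp; ring
    have h3 : (K : ℝ) ^ (1 - a) = ((K : ℝ) + 1) ^ (1 - a) * (1 + -(1 / ((K : ℝ) + 1))) ^ (1 - a) := by
      rw [← Real.mul_rpow hK.le, ← h2]
      rw [← sub_eq_add_neg, sub_nonneg, div_le_one hK]
      linarith [(K.cast_nonneg : (0 : ℝ) ≤ K)]
    have h4 : ((K : ℝ) + 1) ^ (1 - a) = (K + 1) * ((K : ℝ) + 1) ^ (-a) := by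
      rw [sub_eq_add_neg, Real.rpow_add hK, Real.rpow_one]
    have h5 : (K : ℝ) ^ (1 - a) ≤ ((K : ℝ) + 1) ^ (1 - a) - (1 - a) * ((K : ℝ) + 1) ^ (-a) := by
      rw [h3]
      refine (mul_le_mul_of_nonneg_left h1 (by positivity)).trans_eq ?_
      rw [h4]
      field_simp
      ring
    rw [Finset.sum_range_succ, le_div_iff₀ ha]
    rw [le_div_iff₀ ha] at ih
    push_cast
    linarith

theorem sum_rpow_neg_le_of_one_lt {a : ℝ} (ha : 1 < a) (K : ℕ) :
    ∑ k ∈ Finset.range (K + 1), ((k : ℝ) + 1) ^ (-a) ≤ a / (a - 1) := by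
  have hc : 0 < a - 1 := by linarith
  -- The right side is the first term plus the integral of x^(-a) over [1, K+1]; its increments are
  -- estimated by log y ≥ 1 - 1/y and exp x ≥ 1 + x.
  have key : ∑ k ∈ Finset.range (K + 1), ((k : ℝ) + 1) ^ (-a)
      ≤ 1 + (1 - ((K : ℝ) + 1) ^ (1 - a)) / (a - 1) := by
    induction K with
    | zero => simp
    | succ K ih =>
      have hK : (0 : ℝ) < K + 1 := by positivity
      have hK' : (0 : ℝ) < K + 1 + 1 := by positivity
      have h1 : 1 / ((K : ℝ) + 1 + 1) ≤ Real.log (((K : ℝ) + 1 + 1) / (K + 1)) := by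
        refine le_of_eq_of_le ?_ (Real.one_sub_inv_le_log_of_pos (by positivity))
        field_simp
        ring
      have h2 : 1 + (a - 1) * (1 / ((K : ℝ) + 1 + 1)) ≤ (((K : ℝ) + 1 + 1) / (K + 1)) ^ (a - 1) := by
        rw [Real.rpow_def_of_pos (by positivity)]
        have := Real.add_one_le_exp (Real.log (((K : ℝ) + 1 + 1) / (K + 1)) * (a - 1))
        have := mul_le_mul_of_nonneg_left h1 hc.le
        linarith
      have h3 : ((K : ℝ) + 1) ^ (1 - a)
          = ((K : ℝ) + 1 + 1) ^ (1 - a) * (((K : ℝ) + 1 + 1) / (K + 1)) ^ (a - 1) := by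
        rw [Real.div_rpow hK'.le hK.le, ← mul_div_assoc, ← Real.rpow_add hK', sub_add_sub_cancel,
          sub_self, Real.rpow_zero, one_div, ← Real.rpow_neg hK.le, neg_sub]
      have h4 : ((K : ℝ) + 1 + 1) ^ (1 - a) = (K + 1 + 1) * ((K : ℝ) + 1 + 1) ^ (-a) := by
        rw [sub_eq_add_neg, Real.rpow_add hK', Real.rpow_one]
      have h5 : ((K : ℝ) + 1 + 1) ^ (1 - a) + (a - 1) * ((K : ℝ) + 1 + 1) ^ (-a)
          ≤ ((K : ℝ) + 1) ^ (1 - a) := by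
        rw [h3]
        refine le_of_eq_of_le ?_ (mul_le_mul_of_nonneg_left h2 (by positivity))
        rw [h4]
        field_simp
      rw [Finset.sum_range_succ]
      push_cast
      have h6 : ((K : ℝ) + 1 + 1) ^ (-a) ≤ (1 - ((K : ℝ) + 1 + 1) ^ (1 - a)) / (a - 1)
          - (1 - ((K : ℝ) + 1) ^ (1 - a)) / (a - 1) := by
        rw [← sub_div, le_div_iff₀ hc]
        linarith
      linarith
  refine key.trans ?_
  rw [← sub_nonneg]
  have : a / (a - 1) - (1 + (1 - ((K : ℝ) + 1) ^ (1 - a)) / (a - 1))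
      = ((K : ℝ) + 1) ^ (1 - a) / (a - 1) := by
    field_simp
    ring
  rw [this]
  positivity

theorem sum_rpow_neg_one_le (K : ℕ) :
    ∑ k ∈ Finset.range (K + 1), ((k : ℝ) + 1) ^ (-1 : ℝ) ≤ Real.log ((K : ℝ) + 1) + 1 := by
  have h := harmonic_le_one_add_log (K + 1)
  rw [harmonic] at h
  push_cast at h
  simp only [Real.rpow_neg_one]
  linarith

end Sums

/-! ### From summed gradients to the minimum -/

section Rates

variable {n r N : ℕ} {Ξ : Fin N → Type*} [∀ i, MeasurableSpace (Ξ i)] {D : Data n r N Ξ}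
  {iam : (Fin N → Matrix (Fin n) (Fin r) ℝ) → Matrix (Fin n) (Fin r) ℝ}
  {p : Params} {L Ln : ℝ} {Ω : Type*} [MeasurableSpace Ω] {μ : Measure Ω} [IsProbabilityMeasure μ]
  {ν : (i : Fin N) → Measure (Ξ i)} {ξ : (i : Fin N) → ℕ → ℕ → Ω → Ξ i} {σ A₁ : ℝ}

namespace Setting

/-- The minimum is at most the average. A sampling policy enters through a bound `T` for the partial
sums of `1 / N_k` and through the initial gap. -/
theorem minGradBound (h : Setting D iam p L Ln) (ho : OracleAssumption D ν σ A₁)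
    (hs : SamplingAssumption μ ν ξ) (hA : A₁ ≤ p.A) {Nk : ℕ → ℕ} (hNk : ∀ k, 0 < Nk k)
    {T B : ℕ → ℝ} (hT : ∀ K, ∑ k ∈ Finset.range (K + 1), (Nk k : ℝ)⁻¹ ≤ T K)
    (hB : ∀ K : ℕ, (p.κ * (D.gap iam μ ξ p Nk + σ ^ 2 * (2 * p.β * p.Γ₂ + p.Dtil₃) * T K) + p.Γtil₁)
      / (p.β * (K + 1)) ≤ B K) : D.MinGradBound iam μ ξ Nk B := by
  refine ⟨h.integrable_gradSq ho hs hA Nk, fun K => le_trans ?_ (hB K)⟩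
  have hβ := h.admissible.step.β_pos
  have h1 := h.sum_integral_gradSq_le ho hs hA hNk K
  have h2 : p.κ * (σ ^ 2 * (2 * p.β * p.Γ₂ + p.Dtil₃)
      * ∑ k ∈ Finset.range (K + 1), (Nk k : ℝ)⁻¹)
      ≤ p.κ * (σ ^ 2 * (2 * p.β * p.Γ₂ + p.Dtil₃) * T K) :=
    mul_le_mul_of_nonneg_left (mul_le_mul_of_nonneg_left (hT K)
      (mul_nonneg (sq_nonneg σ) h.admissible.noise_nonneg)) (by linarith [h.admissible.sixteen_le_κ])
  let g : ℕ → ℝ := fun k => ∫ ω, D.gradSq iam Nk (fun i k j => ξ i k j ω) k ∂μ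
  have h3 := Finset.card_nsmul_le_sum (Finset.range (K + 1)) g
    ((Finset.range (K + 1)).inf' Finset.nonempty_range_add_one g) fun k hk => Finset.inf'_le g hk
  rw [Finset.card_range, nsmul_eq_mul] at h3
  push_cast at h3
  have h4 := mul_le_mul_of_nonneg_left h3 hβ.le
  rw [le_div_iff₀ (by positivity)]
  linarith

end Setting

end Rates

/-! ### From the stated hypotheses to the working assumptions -/

section Construction

variable {n r N : ℕ} {Ξ : Fin N → Type*} {D : Data n r N Ξ}
  {iam : (Fin N → Matrix (Fin n) (Fin r) ℝ) → Matrix (Fin n) (Fin r) ℝ}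

theorem Setting.of_assumptions (hN : 0 < N) {𝒢 : SimpleGraph (Fin N)}
    {L Ln A₁ A₂ M δ₁ δ₂ Φ : ℝ}
    (hiam : ∀ Z, (∀ i, Z i ∈ stiefel n r) → IsIAM Z (iam Z))
    (hnet : NetworkAssumption 𝒢 D.W) (hsmooth : ∀ i, LSmooth L (D.f i)) (hA₁ : 0 < A₁)
    (hA₂ : ∀ i, ∀ X ∈ stiefel n r, ‖euclGrad (D.f i) X‖ ≤ A₂)
    (hLn : ∀ i, ∀ X ∈ stiefel n r, specNorm (euclGrad (D.f i) X) ≤ Ln)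
    (hM : ∀ X ∈ stiefel n r, ∀ v ∈ tangentSpace X,
      ‖polarRetraction X v - (X + v)‖ ≤ M * ‖v‖ ^ 2)
    (hδ₁ : δ₁ ≤ 1 / (5 * √(r : ℝ)) * δ₂) (hδ₂ : δ₂ ≤ 1 / 6)
    (hX₀ : InRegion δ₁ δ₂ D.X₀ (iam D.X₀)) (hΦ : 1 ≤ Φ)
    (hΦ_region : ∀ i, Φ ≤ 2 - ‖D.X₀ i - iam D.X₀‖ ^ 2)
    (ht : 1 ≤ D.t) (ht_log : Real.logb (sigmaTwo D.W) (1 / (2 * √(N : ℝ))) ≤ D.t)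
    {p : Params} (hp : p = D.params iam δ₁ δ₂ Φ M L Ln A₁ A₂) (hstep : p.StepSize) :
    Setting D iam p L Ln := by
  have hA : p.A = max A₁ A₂ := by rw [hp]; rfl
  have hA_pos : 0 < p.A := hA ▸ lt_max_of_lt_left hA₁
  have hLt : p.Lt = Lt D.W D.t := by rw [hp]; rfl
  have hδ : p.δ₁ = δ₁ := by rw [hp]; rfl
  have hδ0 : 0 < δ₁ := hδ ▸ hstep.δ₁_pos hA_pos
  have hΦ' : p.Φ = Φ := by rw [hp]; rfl
  have hN2 : 2 ≤ N := hnet.two_le hN (hLt ▸ hstep.Lt_pos (by rw [hΦ']; linarith))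
  have hN2' : (2 : ℝ) ≤ N := by exact_mod_cast hN2
  have hmix := hnet.isMixing_pow hN2 D.t
  have hσ0 : 0 ≤ sigmaTwo D.W := (Matrix.toEuclideanLin D.W).singularValues_nonneg 1
  have hs := hnet.sigmaTwo_pow_le hN2 ht ht_log
  have hs0 : 0 ≤ sigmaTwo D.W ^ D.t := pow_nonneg hσ0 _
  -- The square is at most 1/(4N), and N ≥ 2.
  have hs2 : (sigmaTwo D.W ^ D.t) ^ 2 ≤ 1 / 8 := by
    refine (pow_le_pow_left₀ hs0 hs 2).trans ?_
    rw [div_pow, mul_pow, Real.sq_sqrt (by positivity), one_pow]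
    exact one_div_le_one_div_of_le (by norm_num) (by linarith)
  have hs3 : sigmaTwo D.W ^ D.t ≤ 9 / 25 := by
    by_contra! hc
    nlinarith
  have i₀ : Fin N := ⟨0, hN⟩
  refine ⟨hN, hiam, hmix, hs, hs2, hsmooth, fun i X hX => (hA₂ i X hX).trans ?_, hLn,
    (norm_nonneg _).trans (hLn i₀ _ hX₀.2.1.1), ?_, ⟨hstep, hA_pos, ?_, ?_, ?_, ?_, ?_, ?_, ?_⟩, ?_,
    ?_, ?_, ?_, ?_, hX₀.1, ?_, fun i => (hX₀.2.2.2 i).trans hδ₂⟩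
  · rw [hA]
    exact le_max_right _ _
  · rw [hp]
    exact hM
  · rw [hp]
    exact hδ₁
  · rwa [hΦ']
  · rw [hΦ']
    linarith [hΦ_region i₀, sq_nonneg ‖D.X₀ i₀ - iam D.X₀‖]
  · rw [hLt]
    linarith [hnet.Lt_le hN2 D.t]
  · rw [hp]
    exact hσ0
  · rw [hp]
    exact hs3.trans_lt (by norm_num)
  · rw [hp]
    change 0 ≤ ∑ i, ‖D.X₀ i - iam D.X₀‖ ^ 2
    positivity
  · rw [hp]; rfl
  · rw [hp]; rfl
  · rw [hp]; rfl
  · rw [hp]; rfl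
  · rw [hp]; rfl
  · rw [hδ]
    refine le_of_sq_le_sq ?_ hδ0.le
    rw [rms_sq, one_div_mul_eq_div, div_le_iff₀ (by positivity), mul_comm]
    exact hX₀.2.2.1

end Construction

end StiefelGT

/-! ### The convergence rates -/

open StiefelGT in
/-- Convergence rates of the distributed Riemannian stochastic gradient tracking algorithm on the
Stiefel manifold for exponentially growing, polynomially growing, and constant sample sizes. -/
theorem theorem2 {n r N : ℕ} (hN : 0 < N)
    {Ξ : Fin N → Type*} [∀ i, MeasurableSpace (Ξ i)]
    {Ω : Type*} [MeasurableSpace Ω] (μ : Measure Ω) [IsProbabilityMeasure μ]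
    (D : Data n r N Ξ) (𝒢 : SimpleGraph (Fin N))
    (ν : (i : Fin N) → Measure (Ξ i)) (ξ : (i : Fin N) → ℕ → ℕ → Ω → Ξ i)
    (L Ln σ A₁ A₂ M δ₁ δ₂ Φ : ℝ)
    (iam : (Fin N → Matrix (Fin n) (Fin r) ℝ) → Matrix (Fin n) (Fin r) ℝ)
    (hiam : ∀ Z, (∀ i, Z i ∈ stiefel n r) → IsIAM Z (iam Z))
    -- network, smoothness, oracle, and sampling assumptions
    (hnet : NetworkAssumption 𝒢 D.W)
    (hsmooth : ∀ i, LSmooth L (D.f i))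
    (horacle : OracleAssumption D ν σ A₁)
    (hsample : SamplingAssumption μ ν ξ)
    -- the constants `A₂`, `L_n`, `M`
    (hA₂ : ∀ i, ∀ X ∈ stiefel n r, ‖euclGrad (D.f i) X‖ ≤ A₂)
    (hLn : ∀ i, ∀ X ∈ stiefel n r, specNorm (euclGrad (D.f i) X) ≤ Ln)
    (hM : ∀ X ∈ stiefel n r, ∀ v ∈ tangentSpace X,
      ‖polarRetraction X v - (X + v)‖ ≤ M * ‖v‖ ^ 2)
    -- the local region and the initial point
    (hδ₁ : δ₁ ≤ 1 / (5 * √(r : ℝ)) * δ₂) (hδ₂ : δ₂ ≤ 1 / 6)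
    (hX₀ : InRegion δ₁ δ₂ D.X₀ (iam D.X₀))
    -- the constant `Φ`: a lower bound of `2 - max_i ‖Z_i - Ẑ‖²` on the local region
    (hΦ : 1 ≤ Φ)
    (hΦ_region : ∀ (Z : Fin N → Matrix (Fin n) (Fin r) ℝ) (Zhat : Matrix (Fin n) (Fin r) ℝ),
      InRegion δ₁ δ₂ Z Zhat → ∀ i, Φ ≤ 2 - ‖Z i - Zhat‖ ^ 2)
    -- the number of communication rounds
    (ht : 1 ≤ D.t)
    (ht_log : Real.logb (sigmaTwo D.W) (1 / (2 * √(N : ℝ))) ≤ D.t)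
    -- the step sizes
    (p : Params) (hp : p = D.params iam δ₁ δ₂ Φ M L Ln A₁ A₂) (hstep : p.StepSize) :
    -- (i) exponentially growing sample size
    (∀ q : ℝ, 0 < q → q < 1 → ∀ Nk : ℕ → ℕ, (∀ k, Nk k = ⌈q ^ (-(k : ℤ))⌉₊) →
      D.MinGradBound iam μ ξ Nk fun K =>
        (p.κ * (D.gap iam μ ξ p Nk
            + σ ^ 2 * (2 * p.β * p.Γ₂ * (1 + q) + p.Dtil₃) / (1 - q)) + p.Γtil₁)
          / (p.β * (K + 1))) ∧
    -- (ii) polynomially growing sample size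
    (∀ a : ℝ, 0 < a → ∀ Nk : ℕ → ℕ, (∀ k, Nk k = ⌈((k : ℝ) + 1) ^ a⌉₊) →
      (a = 1 → D.MinGradBound iam μ ξ Nk fun K =>
        (p.Γtil₁ + p.κ * (D.gap iam μ ξ p Nk
            + 2 * σ ^ 2 * (4 * p.β * p.Γ₂ + p.Dtil₃) * (Real.log ((K : ℝ) + 1) + 1)))
          / (p.β * (K + 1))) ∧
      (a < 1 → D.MinGradBound iam μ ξ Nk fun K =>
        σ ^ 2 * p.κ * (6 * p.β * p.Γ₂ + p.Dtil₃) / (p.β * (1 - a) * ((K : ℝ) + 1) ^ a)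
          + (p.κ * D.gap iam μ ξ p Nk + p.Γtil₁) / (p.β * (K + 1))) ∧
      (1 < a → D.MinGradBound iam μ ξ Nk fun K =>
        σ ^ 2 * p.κ * (3 * p.Γ₂ * a + p.Γ₂ + a * p.Dtil₃ / p.β) / ((a - 1) * (K + 1))
          + (p.κ * D.gap iam μ ξ p Nk + p.Γtil₁) / (p.β * (K + 1)))) ∧
    -- (iii) constant sample size
    (∀ Q : ℕ, 0 < Q → ∀ Nk : ℕ → ℕ, (∀ k, Nk k = Q) →
      D.MinGradBound iam μ ξ Nk fun K =>
        p.κ * (σ ^ 2 * (4 * p.β * p.Γ₂ + p.Dtil₃) / (p.β * Q))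
          + (p.Γtil₁ + p.κ * D.gap iam μ ξ p Nk) / (p.β * (K + 1))) := by
  have h := Setting.of_assumptions hN hiam hnet hsmooth horacle.pos hA₂ hLn hM hδ₁ hδ₂ hX₀ hΦ
    (hΦ_region _ _ hX₀) ht ht_log hp hstep
  have hA : A₁ ≤ p.A := by
    rw [hp]
    exact le_max_left _ _
  clear hp
  have hβ := hstep.β_pos
  have hκ : 0 ≤ p.κ := by linarith [h.admissible.sixteen_le_κ]
  have hΓ : 0 ≤ p.β * p.Γ₂ := mul_nonneg hβ.le Params.Admissible.Γ₂_nonneg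
  have hD : 0 ≤ p.Dtil₃ := by linarith [h.admissible.le_Dtil₃]
  have hκσ : 0 ≤ p.κ * σ ^ 2 := mul_nonneg hκ (sq_nonneg σ)
  refine ⟨fun q hq0 hq1 Nk hNk => ?_, fun a ha Nk hNk => ?_, fun Q hQ Nk hNk => ?_⟩
  · refine h.minGradBound horacle hsample hA (fun k => by rw [hNk, Nat.ceil_pos]; positivity)
      (fun K => sum_inv_le_of_exponential hq0 hq1 hNk (K + 1)) fun K => ?_
    have h1 : 0 < 1 - q := by linarith
    have h2 : 2 * p.β * p.Γ₂ + p.Dtil₃ ≤ 2 * p.β * p.Γ₂ * (1 + q) + p.Dtil₃ := by nlinarith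
    rw [mul_one_div]
    gcongr
  · have hpos (k : ℕ) : 0 < Nk k := by
      rw [hNk, Nat.ceil_pos]
      positivity
    have hT (K : ℕ) : ∑ k ∈ Finset.range (K + 1), (Nk k : ℝ)⁻¹
        ≤ ∑ k ∈ Finset.range (K + 1), ((k : ℝ) + 1) ^ (-a) :=
      Finset.sum_le_sum fun k _ => inv_le_of_polynomial hNk k
    refine ⟨fun ha1 => ?_, fun ha1 => ?_, fun ha1 => ?_⟩
    · subst ha1
      refine h.minGradBound horacle hsample hA hpos
        (fun K => (hT K).trans (sum_rpow_neg_one_le K)) fun K => ?_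
      have h1 : 0 ≤ Real.log ((K : ℝ) + 1) + 1 := by
        have := Real.log_nonneg (by linarith [(K.cast_nonneg : (0 : ℝ) ≤ K)] : (1 : ℝ) ≤ K + 1)
        linarith
      rw [add_comm p.Γtil₁]
      gcongr
      · linarith
      · linarith [sq_nonneg σ]
      · exact Params.Admissible.Γ₂_nonneg
      · norm_num
    · refine h.minGradBound horacle hsample hA hpos
        (fun K => (hT K).trans (sum_rpow_neg_le_of_lt_one ha ha1 (K + 1))) fun K => ?_
      have hK : (0 : ℝ) < K + 1 := by positivity
      have h1 : 0 < 1 - a := by linarith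
      have h2 : ((K : ℝ) + 1) ^ (1 - a) = (K + 1) / ((K : ℝ) + 1) ^ a := by
        rw [Real.rpow_sub hK, Real.rpow_one]
      -- The claim is brought to the common denominator `β * (K + 1)`, since (K+1)^(-a) =
      -- (K+1)^(1-a) / (K+1).
      have h3 : σ ^ 2 * p.κ * (6 * p.β * p.Γ₂ + p.Dtil₃) / (p.β * (1 - a) * ((K : ℝ) + 1) ^ a)
          + (p.κ * D.gap iam μ ξ p Nk + p.Γtil₁) / (p.β * (K + 1))
          = (p.κ * (D.gap iam μ ξ p Nk + σ ^ 2 * (6 * p.β * p.Γ₂ + p.Dtil₃)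
            * (((K : ℝ) + 1) ^ (1 - a) / (1 - a))) + p.Γtil₁) / (p.β * (K + 1)) := by
        rw [h2]
        field_simp
        ring
      rw [h3]
      push_cast
      gcongr ?_ / _
      gcongr p.κ * (_ + σ ^ 2 * (?_ + _) * _) + _
      nlinarith
    · refine h.minGradBound horacle hsample hA hpos
        (fun K => (hT K).trans (sum_rpow_neg_le_of_one_lt ha1 K)) fun K => ?_
      have hK : (0 : ℝ) < K + 1 := by positivity
      have h1 : 0 < a - 1 := by linarith
      have h3 : σ ^ 2 * p.κ * (3 * p.Γ₂ * a + p.Γ₂ + a * p.Dtil₃ / p.β) / ((a - 1) * (K + 1))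
          + (p.κ * D.gap iam μ ξ p Nk + p.Γtil₁) / (p.β * (K + 1))
          = (p.κ * (D.gap iam μ ξ p Nk + σ ^ 2 * ((3 * (p.β * p.Γ₂) * a + p.β * p.Γ₂
            + a * p.Dtil₃) / (a - 1))) + p.Γtil₁) / (p.β * (K + 1)) := by
        field_simp
        ring
      rw [h3, mul_assoc (σ ^ 2), ← mul_div_assoc (2 * p.β * p.Γ₂ + p.Dtil₃)]
      gcongr ?_ / _
      gcongr p.κ * (_ + σ ^ 2 * (?_ / _)) + _
      nlinarith
  · refine h.minGradBound horacle hsample hA (fun k => by rw [hNk]; exact hQ)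
      (T := fun K => ((K : ℝ) + 1) / Q) (fun K => ?_) fun K => ?_
    · simp [hNk, div_eq_mul_inv]
    · have hQ' : (0 : ℝ) < Q := by exact_mod_cast hQ
      have h3 : p.κ * (σ ^ 2 * (4 * p.β * p.Γ₂ + p.Dtil₃) / (p.β * Q))
          + (p.Γtil₁ + p.κ * D.gap iam μ ξ p Nk) / (p.β * (K + 1))
          = (p.κ * (D.gap iam μ ξ p Nk + σ ^ 2 * (4 * p.β * p.Γ₂ + p.Dtil₃)
            * (((K : ℝ) + 1) / Q)) + p.Γtil₁) / (p.β * (K + 1)) := by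
        field_simp
        ring
      rw [h3]
      gcongr ?_ / _
      gcongr p.κ * (_ + σ ^ 2 * (?_ + _) * _) + _
      nlinarith
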